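/- Let $E$ be a finite-dimensional Euclidean space. A *reflection* (resp. *rotation*) is an orthogonal transformation whose fixed point subspace has codimension one (resp. two). A *reflection group*, *rotation group* or *reflection-rotation group* is a finite group of orthogonal transformations generated by the reflections, the rotations, or the reflections and rotations it contains, respectively (trivial groups are allowed). *Admissible triples.* An admissible triple on a Euclidean space $V$ is a triple $(G,H,F)$, where $G<\mathrm O(V)$ is a finite irreducible group generated by two subgroups that are normal in $G$, a rotation group $H$ and a reflection group $F$, such that $hs\in F$ whenever $h\in H$, $s\in F$ is a reflection and $hs$ is a reflection. Then $G/H$ is a Coxeter group whose reflections are the cosets of the reflections in $F$. Its irreducible components are the subgroups generated by the connected components of its Coxeter diagram; equivalently, the subgroups generated by the connected components of the graph on all its reflections in which two reflections are joined if and only if they do not commute. A component is *trivial* if its diagram is an isolated vertex, i.e. if it is generated by a single reflection. Fix an orthogonal decomposition $E=\bigoplus_{i\in I}V_i$ with $I$ finite. An element of $\mathrm O(V_i)$ is extended by the identity to an element of $\mathrm O(E)$. *Groups.* Consider the reflection-rotation groups $G<\mathrm O(E)$ for which the $V_i$ are irreducible components, i.e. $G$-invariant and irreducible. Let $\pi_i$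 be the projection of $G$ to $\mathrm O(V_i)$. A rotation $g\in G$ is of the *first kind* if it is a rotation in one $V_i$ and the identity on all other summands; it is of the *second kind* if it is a reflection in each of two distinct summands and the identity on all others. *Data.* Consider data consisting of a family of admissible triples $(G_i,H_i,F_i)$ on $V_i$, $i\in I$, an equivalence relation on the set of irreducible components of $\tilde G=\prod_{i\in I} G_i/H_i$ such that 1. the elements of an equivalence class belong to pairwise different $G_i/H_i$, 2. each $G_i/H_i$ contains at most one trivial irreducible component that is not equivalent to another component, 3. equivalence classes of nontrivial irreducible components contain precisely two isomorphic components, and, for each class of nontrivial components, an isomorphism between its two components (read in the opposite direction as its inverse) that maps the reflections onto the reflections. *From data to groups.* For $i\ne j$, call the cosets of reflections $s\in F_i$ and $t\in F_j$ *equivalent* if they lie in equivalent components and, when these are nontrivial, correspond to each other under the given isomorphism. The group assigned to a datum is generated by all $H_i$, by the products $st$ of reflections $s\in F_i$, $t\in F_j$, $i\neq j$, with equivalent cosets, and by the reflections $s\in F_i$ whose cosets are not equivalent to any other coset of a reflection. *From groups to data.* The datum induced by $G$ has $G_i=\pi_i(G)$, $H_i=\pi_i(H)$ and $F_i=\pi_i(F)$,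 where $H<G$ is generated by the rotations of the first kind in $G$, and $F<G$ by the reflections and the rotations of the second kind in $G$. For $i\neq j$, call the cosets of reflections $s\in F_i$ and $t\in F_j$ *related* if $s\notin G$ and $st\in G$. Two distinct components are equivalent if and only if they belong to different factors and contain related reflections, and the isomorphisms between equivalent nontrivial components map reflections onto related reflections. **Theorem.** The map that assigns to a datum its group is a bijection from the set of data onto the set of reflection-rotation groups $G<\mathrm O(E)$ for which the $V_i$ are irreducible components. Its inverse assigns to $G$ the datum induced by $G$: for every such $G$ and every datum $A$, the datum $A$ is induced by $G$ if and only if the group assigned to $A$ is $G$. Moreover, the group assigned to a datum contains a reflection if and only if some equivalence class consists of a single trivial component. -/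

import Mathlib

namespace ReflRot

open Module

/-! ### Reflections, rotations and the groups they generate -/

section Orthogonal

variable {V : Type*} [NormedAddCommGroup V] [InnerProductSpace ℝ V]

/-- An orthogonal transformation is a reflection if its fixed point subspace has codimension one. -/
def IsReflection (g : V ≃ₗᵢ[ℝ] V) : Prop :=
  finrank ℝ (LinearMap.fixedSubmodule (g.toLinearEquiv : V →ₗ[ℝ] V)) + 1 = finrank ℝ V

/-- An orthogonal transformation is a rotation (an orthogonal pseudoreflection) if its fixed point
subspace has codimension two. -/
def IsRotation (g : V ≃ₗᵢ[ℝ] V) : Prop :=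
  finrank ℝ (LinearMap.fixedSubmodule (g.toLinearEquiv : V →ₗ[ℝ] V)) + 2 = finrank ℝ V

/-- A finite reflection group: a finite group generated by reflections. -/
structure IsReflectionGroup (G : Subgroup (V ≃ₗᵢ[ℝ] V)) : Prop where
  finite : Finite G
  generated : Subgroup.closure {g | g ∈ G ∧ IsReflection g} = G

/-- A finite rotation group: a finite group generated by rotations. -/
structure IsRotationGroup (G : Subgroup (V ≃ₗᵢ[ℝ] V)) : Prop where
  finite : Finite G
  generated : Subgroup.closure {g | g ∈ G ∧ IsRotation g} = G

/-- A finite reflection-rotation group: a finite group generated by reflections and rotations. -/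
structure IsReflectionRotationGroup (G : Subgroup (V ≃ₗᵢ[ℝ] V)) : Prop where
  finite : Finite G
  generated : Subgroup.closure {g | g ∈ G ∧ (IsReflection g ∨ IsRotation g)} = G

/-- The subspace `U` is mapped into itself by every element of `G`. -/
def IsInvariant (G : Subgroup (V ≃ₗᵢ[ℝ] V)) (U : Submodule ℝ V) : Prop :=
  ∀ g ∈ G, ∀ v ∈ U, g v ∈ U

/-- `G` acts irreducibly on `V`. -/
structure IsIrreducible (G : Subgroup (V ≃ₗᵢ[ℝ] V)) : Prop where
  nontrivial : Nontrivial V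
  eq_bot_or_eq_top : ∀ U : Submodule ℝ V, IsInvariant G U → U = ⊥ ∨ U = ⊤

end Orthogonal

/-! ### Admissible triples and the irreducible components of `G / H` -/

/-- A triple `(G, H, F)`: a finite irreducible group `G` of orthogonal transformations of `V`,
generated by a rotation group `H` and a reflection group `F`, both normal in `G`, such that
a reflection of the form `h * s`, with `h ∈ H` and `s` a reflection in `F`, always belongs
to `F`. -/
@[ext]
structure AdmissibleTriple (V : Type*) [NormedAddCommGroup V] [InnerProductSpace ℝ V] where
  G : Subgroup (V ≃ₗᵢ[ℝ] V)
  H : Subgroup (V ≃ₗᵢ[ℝ] V)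
  F : Subgroup (V ≃ₗᵢ[ℝ] V)
  finite : Finite G
  irreducible : IsIrreducible G
  H_rotation : IsRotationGroup H
  F_reflection : IsReflectionGroup F
  H_le : H ≤ G
  F_le : F ≤ G
  H_normal : (H.subgroupOf G).Normal
  F_normal : (F.subgroupOf G).Normal
  generated : H ⊔ F = G
  mem_F : ∀ h ∈ H, ∀ s ∈ F, IsReflection s → IsReflection (h * s) → h * s ∈ F

namespace AdmissibleTriple

variable {V : Type*} [NormedAddCommGroup V] [InnerProductSpace ℝ V]

instance (T : AdmissibleTriple V) : (T.H.subgroupOf T.G).Normal := T.H_normal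

/-- The quotient group `G / H`. -/
abbrev Q (T : AdmissibleTriple V) : Type _ := T.G ⧸ T.H.subgroupOf T.G

/-- The coset in `G / H` of an element of `F`. -/
def coset (T : AdmissibleTriple V) (s : T.F) : T.Q :=
  QuotientGroup.mk ⟨s, T.F_le s.2⟩

/-- The reflections in the Coxeter group `G / H`: the cosets of the reflections in `F`. -/
def reflections (T : AdmissibleTriple V) : Set T.Q :=
  {q | ∃ s : T.F, IsReflection (s : V ≃ₗᵢ[ℝ] V) ∧ T.coset s = q}

/-- The graph on all reflections of `G / H` in which two reflections are joined if and only if they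
do not commute, i.e. if and only if their product has order at least three. Its
full subgraph on the simple reflections is the underlying graph of the Coxeter diagram of `G / H`.
Every reflection is conjugate, within the subgroup generated by a connected component of that
diagram, to a simple reflection in this component, and hence is connected to it; reflections from
different components of the diagram commute. So both graphs have the same connected components, and
these generate the same subgroups, the irreducible components of `G / H`. -/
def reflectionGraph (T : AdmissibleTriple V) : SimpleGraph T.reflections where
  Adj a b := ¬ Commute (a : T.Q) (b : T.Q)
  symm := ⟨fun _ _ h h' => h h'.symm⟩
  loopless := ⟨fun a h => h (Commute.refl (a : T.Q))⟩

/-- An irreducible component of the Coxeter group `G / H`: the subgroup generated by the reflections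
in a connected component. -/
def IsIrreducibleComponent (T : AdmissibleTriple V) (K : Subgroup T.Q) : Prop :=
  ∃ c : T.reflectionGraph.ConnectedComponent,
    K = Subgroup.closure ((fun a : T.reflections => (a : T.Q)) '' c.supp)

/-- The set of irreducible components of `G / H`. -/
abbrev Component (T : AdmissibleTriple V) : Type _ :=
  {K : Subgroup T.Q // T.IsIrreducibleComponent K}

/-- An irreducible component is trivial if its Coxeter diagram is an isolated vertex, i.e. if it is
generated by a single reflection. -/
def IsTrivial (T : AdmissibleTriple V) (K : T.Component) : Prop :=
  ∃ q ∈ T.reflections, K.1 = Subgroup.zpowers q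

end AdmissibleTriple

/-! ### Orthogonal decompositions -/

section Decomposition

variable (ι : Type*) [Fintype ι] [DecidableEq ι]
  (E : Type*) [NormedAddCommGroup E] [InnerProductSpace ℝ E]

/-- An orthogonal direct sum decomposition of `E` into subspaces `V i`. -/
structure OrthogonalDecomposition where
  V : ι → Submodule ℝ E
  internal : DirectSum.IsInternal V
  orthogonal : OrthogonalFamily ℝ (fun i => V i) fun i => (V i).subtypeₗᵢ

end Decomposition

variable {ι : Type*} [Fintype ι] [DecidableEq ι]
  {E : Type*} [NormedAddCommGroup E] [InnerProductSpace ℝ E]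

namespace OrthogonalDecomposition

/-- The orthogonal group of the `i`-th summand. -/
abbrev O (D : OrthogonalDecomposition ι E) (i : ι) : Type _ := D.V i ≃ₗᵢ[ℝ] D.V i

/-- The orthogonal transformation of `E` that acts on each `V i` as `a i`. -/
noncomputable def blockDiag (D : OrthogonalDecomposition ι E) (a : ∀ i, D.O i) : E ≃ₗᵢ[ℝ] E :=
  ((D.internal.isometryL2OfOrthogonalFamily D.orthogonal).trans
    (LinearIsometryEquiv.piLpCongrRight 2 a)).trans
      (D.internal.isometryL2OfOrthogonalFamily D.orthogonal).symm

theorem blockDiag_apply_coe (D : OrthogonalDecomposition ι E) (a : ∀ i, D.O i) (i : ι)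
    (v : D.V i) : D.blockDiag a (v : E) = (a i v : D.V i) := by
  have key : ∀ w : D.V i, (D.internal.isometryL2OfOrthogonalFamily D.orthogonal).symm
      (PiLp.single 2 i w) = (w : E) := by
    intro w
    rw [DirectSum.IsInternal.isometryL2OfOrthogonalFamily_symm_apply]
    rw [Finset.sum_eq_single i]
    · simp
    · intro j _ hj
      simp [hj]
    · simp
  have h2 : D.internal.isometryL2OfOrthogonalFamily D.orthogonal (v : E) = PiLp.single 2 i v := by
    rw [← key v, LinearIsometryEquiv.apply_symm_apply]
  simp only [blockDiag, LinearIsometryEquiv.trans_apply, h2,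
    LinearIsometryEquiv.piLpCongrRight_single, key]

/-- The element `s` of `O(V i)`, extended by the identity to the other summands. -/
noncomputable def single (D : OrthogonalDecomposition ι E) (i : ι) (s : D.O i) : E ≃ₗᵢ[ℝ] E :=
  D.blockDiag (Pi.mulSingle i s)

/-- The product of `s ∈ O(V i)` and `t ∈ O(V j)`, extended by the identity to the other
summands. -/
noncomputable def pair (D : OrthogonalDecomposition ι E) (i j : ι) (s : D.O i) (t : D.O j) :
    E ≃ₗᵢ[ℝ] E :=
  D.blockDiag (Pi.mulSingle i s * Pi.mulSingle j t)

/-- The image `π i (G)` in `O(V i)` of a group `G` that preserves the decomposition. -/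
def proj (D : OrthogonalDecomposition ι E) (G : Subgroup (E ≃ₗᵢ[ℝ] E)) (i : ι) :
    Subgroup (D.O i) where
  carrier := {a | ∃ g ∈ G, ∀ v : D.V i, g (v : E) = (a v : D.V i)}
  one_mem' := ⟨1, G.one_mem, fun _ => rfl⟩
  mul_mem' := by
    rintro a b ⟨g, hg, hga⟩ ⟨h, hh, hhb⟩
    refine ⟨g * h, G.mul_mem hg hh, fun v => ?_⟩
    change g (h v) = _
    rw [hhb, hga]
    rfl
  inv_mem' := by
    rintro a ⟨g, hg, hga⟩
    refine ⟨g⁻¹, G.inv_mem hg, fun v => ?_⟩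
    change g.symm v = _
    rw [LinearIsometryEquiv.symm_apply_eq, hga]
    exact congrArg Subtype.val (a.apply_symm_apply v).symm

/-- A reflection-rotation group `G` on `E` for which the `V i` are the irreducible components. -/
structure IsGroupWithComponents (D : OrthogonalDecomposition ι E)
    (G : Subgroup (E ≃ₗᵢ[ℝ] E)) : Prop where
  reflectionRotation : IsReflectionRotationGroup G
  invariant : ∀ i, IsInvariant G (D.V i)
  irreducible : ∀ i, IsIrreducible (D.proj G i)

/-- Rotations of the first kind: a rotation in one summand and the identity on the others. -/
def IsFirstKind (D : OrthogonalDecomposition ι E) (g : E ≃ₗᵢ[ℝ] E) : Prop :=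
  ∃ (i : ι) (a : D.O i), IsRotation a ∧ g = D.single i a

/-- Rotations of the second kind: a reflection in each of two distinct summands and the identity on
the others. -/
def IsSecondKind (D : OrthogonalDecomposition ι E) (g : E ≃ₗᵢ[ℝ] E) : Prop :=
  ∃ (i j : ι) (s : D.O i) (t : D.O j),
    i ≠ j ∧ IsReflection s ∧ IsReflection t ∧ g = D.pair i j s t

/-- The subgroup of `G` generated by the rotations of the first kind in `G`. (The generating set is
invariant under conjugation by `G`, so this subgroup is normal in `G`.) -/
def firstKindSubgroup (D : OrthogonalDecomposition ι E) (G : Subgroup (E ≃ₗᵢ[ℝ] E)) :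
    Subgroup (E ≃ₗᵢ[ℝ] E) :=
  Subgroup.closure {g | g ∈ G ∧ D.IsFirstKind g}

/-- The subgroup of `G` generated by the reflections and the rotations of the second kind in `G`.
(The generating set is invariant under conjugation by `G`, so this subgroup is normal in `G`.) -/
def secondKindSubgroup (D : OrthogonalDecomposition ι E) (G : Subgroup (E ≃ₗᵢ[ℝ] E)) :
    Subgroup (E ≃ₗᵢ[ℝ] E) :=
  Subgroup.closure {g | g ∈ G ∧ (IsReflection g ∨ D.IsSecondKind g)}

/-- Relatedness in `G` of (the cosets of) a reflection `s` of `V i` and a reflection `t` of `V j`,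
`i ≠ j`: there is a rotation of the second kind in `G` with components `s` and `t`, and `s` itself
does not belong to `G`. -/
def Related (D : OrthogonalDecomposition ι E) (G : Subgroup (E ≃ₗᵢ[ℝ] E)) (i j : ι)
    (s : D.O i) (t : D.O j) : Prop :=
  D.single i s ∉ G ∧ D.pair i j s t ∈ G

end OrthogonalDecomposition

/-! ### The classifying data -/

/-- The data on a decomposition `D`: admissible triples `(G i, H i, F i)` on the summands `V i`, an
equivalence relation on the set of irreducible components of `∏ i, G i / H i`, and isomorphisms
between equivalent, distinct, nontrivial components. -/
structure Datum (D : OrthogonalDecomposition ι E) where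
  triple : ∀ i, AdmissibleTriple (D.V i)
  rel : Setoid (Σ i, (triple i).Component)
  /-- Distinct equivalent components belong to different factors. -/
  rel_factor : ∀ x y, rel x y → x.1 = y.1 → x = y
  /-- Each factor has at most one trivial component that is not equivalent to another component. -/
  unpaired : ∀ (i : ι) (K L : (triple i).Component),
    (triple i).IsTrivial K → (∀ y, rel ⟨i, K⟩ y → y = ⟨i, K⟩) →
    (triple i).IsTrivial L → (∀ y, rel ⟨i, L⟩ y → y = ⟨i, L⟩) → K = L
  /-- The class of a nontrivial component consists of exactly two components. -/
  paired : ∀ x : Σ i, (triple i).Component, ¬ (triple x.1).IsTrivial x.2 →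
    Set.ncard {y | rel x y} = 2
  /-- An isomorphism from each nontrivial component to the other component of its class. -/
  iso : ∀ x y : Σ i, (triple i).Component, rel x y → x ≠ y →
    ¬ (triple x.1).IsTrivial x.2 → (x.2.1 ≃* y.2.1)
  /-- There is one isomorphism for each pair: reversing the pair gives the inverse. -/
  iso_symm : ∀ x y hxy hne hx hy,
    iso y x (rel.symm hxy) (Ne.symm hne) hy = (iso x y hxy hne hx).symm
  /-- The isomorphisms map the reflections onto the reflections. -/
  iso_reflections : ∀ x y hxy hne hx (q : x.2.1),
    (q : (triple x.1).Q) ∈ (triple x.1).reflections ↔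
      (iso x y hxy hne hx q : (triple y.1).Q) ∈ (triple y.1).reflections

namespace Datum

variable {D : OrthogonalDecomposition ι E}

/-- The relation between the reflections `p` of the `i`-th and `q` of the `j`-th factor, `i ≠ j`,
that is defined by a datum: they lie in equivalent components and, if these are nontrivial, they
correspond to each other under the given isomorphism. -/
def Equivalent (A : Datum D) (i j : ι) (p : (A.triple i).Q) (q : (A.triple j).Q) : Prop :=
  ∃ (K : (A.triple i).Component) (L : (A.triple j).Component) (hp : p ∈ K.1) (_ : q ∈ L.1)
    (hKL : A.rel ⟨i, K⟩ ⟨j, L⟩) (hne : (⟨i, K⟩ : Σ i, (A.triple i).Component) ≠ ⟨j, L⟩),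
    ∀ hK : ¬ (A.triple i).IsTrivial K,
      (A.iso ⟨i, K⟩ ⟨j, L⟩ hKL hne hK ⟨p, hp⟩ : (A.triple j).Q) = q

/-- The group defined by a datum. It is generated by the groups `H i`, by the products `s * t` of
reflections `s ∈ F i` and `t ∈ F j`, `i ≠ j`, with equivalent cosets, and by the reflections
`s ∈ F i` whose cosets are not equivalent to any other coset of a reflection. -/
def group (A : Datum D) : Subgroup (E ≃ₗᵢ[ℝ] E) :=
  Subgroup.closure
    ({g | ∃ (i : ι) (h : D.O i), h ∈ (A.triple i).H ∧ g = D.single i h} ∪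
     {g | ∃ (i j : ι) (s : (A.triple i).F) (t : (A.triple j).F), i ≠ j ∧
        IsReflection (s : D.O i) ∧ IsReflection (t : D.O j) ∧
        A.Equivalent i j ((A.triple i).coset s) ((A.triple j).coset t) ∧ g = D.pair i j s t} ∪
     {g | ∃ (i : ι) (s : (A.triple i).F), IsReflection (s : D.O i) ∧
        (∀ (j : ι) (t : (A.triple j).F), i ≠ j → IsReflection (t : D.O j) →
          ¬ A.Equivalent i j ((A.triple i).coset s) ((A.triple j).coset t)) ∧
        g = D.single i s})

/-- The datum `A` is the one induced by the group `G`: its triples are the images in `O(V i)` of `G`,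
of the subgroup generated by the rotations of the first kind, and of the subgroup generated by the
reflections and rotations of the second kind; its equivalence relation and its isomorphisms are those
induced by relatedness of reflections. -/
structure IsInducedBy (A : Datum D) (G : Subgroup (E ≃ₗᵢ[ℝ] E)) : Prop where
  G_eq : ∀ i, (A.triple i).G = D.proj G i
  H_eq : ∀ i, (A.triple i).H = D.proj (D.firstKindSubgroup G) i
  F_eq : ∀ i, (A.triple i).F = D.proj (D.secondKindSubgroup G) i
  rel_iff : ∀ x y : Σ i, (A.triple i).Component, A.rel x y ↔ x = y ∨
    (x.1 ≠ y.1 ∧ ∃ (s : (A.triple x.1).F) (t : (A.triple y.1).F),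
      IsReflection (s : D.O x.1) ∧ IsReflection (t : D.O y.1) ∧
      (A.triple x.1).coset s ∈ x.2.1 ∧ (A.triple y.1).coset t ∈ y.2.1 ∧
      D.Related G x.1 y.1 s t)
  iso_iff : ∀ x y hxy hne hx (s : (A.triple x.1).F) (t : (A.triple y.1).F),
    IsReflection (s : D.O x.1) → IsReflection (t : D.O y.1) →
    ∀ hs : (A.triple x.1).coset s ∈ x.2.1,
      ((A.iso x y hxy hne hx ⟨(A.triple x.1).coset s, hs⟩ : (A.triple y.1).Q) =
        (A.triple y.1).coset t ↔ D.Related G x.1 y.1 s t)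

/-- Some equivalence class of the datum consists of a single trivial component. -/
def HasUnpairedTrivialComponent (A : Datum D) : Prop :=
  ∃ x : Σ i, (A.triple i).Component, (A.triple x.1).IsTrivial x.2 ∧ ∀ y, A.rel x y → y = x

end Datum

end ReflRot

/-! A group that preserves the decomposition is block diagonal, and the codimension of the fixed
space is additive over blocks (`codim_blockDiag`). Hence a reflection in such a group lives in one
block, and a rotation is either of the first kind or a pair of reflections in two blocks. Modulo the
rotations of the first kind, all that remains is how reflections in different blocks are glued to
each other; this is what a datum records.

The main tool is that `G / H` is a Coxeter group in the following sense: a map on its reflections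
that respects squares and conjugation extends to a homomorphism (`exists_lift`). For `F` itself this
comes from root systems and the exchange condition (`IsRootSystem.list_prod_eq_one`). To pass to the
quotient one needs that `H ∩ F` is generated by products of two reflections of `F`
(`mem_pairSubgroup`). A generating rotation of `H` either fixes a regular vector, and then it
stabilizes a chamber up to conjugation by `F`, or its fixed space lies in a mirror; in that case
admissibility makes it a product of two reflections of `F`. The same dichotomy shows that `F`
contains all reflections of `G` (`mem_refls`). Extending maps by `1` outside a component then gives
projections onto the components, their sign characters, and the decomposition of `G / H` as a direct
product of its components.

From data to groups, the danger is that the generated group contains more reflections and rotations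
than intended. Two invariants prevent this (`Respects`, `group_le`): the parts of an element in two
glued nontrivial components correspond under the isomorphism, and the signs over an equivalence
class with several members multiply to one. They determine which elements supported on one or two
blocks can occur (`cos_of_single_mem`, `exists_rel_of_pair_mem`), so that the group induces the
datum it came from (`isInducedBy_group`).

From groups to data, commutators do the work. The commutator of two rotations of the second kind
that share a single block is supported on that block, so it is trivial modulo rotations of the first
kind and the cosets commute. Thus, if `t` is glued to `s` in another block and `t'` does not commute
with `t`, then `t'` is glued to a reflection in the block of `s` (`exists_related_of_not_commute`).
So gluing spreads over whole components, nontrivial components are glued in pairs, and gluing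
induces isomorphisms (`Rel.exists_mulEquiv`). The group of the resulting datum is the original one
(`datum_group`).

Finally, a datum is determined by the group that induces it (`IsInducedBy.unique`), because an
isomorphism between components is determined on reflections. The criterion for reflections follows
from `cos_of_single_mem`. -/

namespace ReflRot

open Module

/-! ### Reflections and rotations: unit normals, determinants and fixed spaces -/

section Geometry

set_option linter.unusedSectionVars false

variable {V : Type*} [NormedAddCommGroup V] [InnerProductSpace ℝ V]

/-- The orthogonal reflection in the hyperplane orthogonal to `u`. -/
noncomputable def refl (u : V) : V ≃ₗᵢ[ℝ] V := (ℝ ∙ u)ᗮ.reflection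

theorem refl_apply {u : V} (hu : ‖u‖ = 1) (v : V) : refl u v = v - (2 * inner ℝ u v) • u := by
  have h := (ℝ ∙ u).reflection_orthogonal_apply v
  have h2 : (ℝ ∙ u).reflection v = 2 • (inner ℝ u v / ((‖u‖ : ℝ) ^ 2)) • u - v :=
    Submodule.reflection_singleton_apply u v
  rw [refl, h, h2, hu]
  simp only [one_pow, div_one, ← Nat.cast_smul_eq_nsmul ℝ, smul_smul]
  push_cast
  abel

theorem refl_self (u : V) : refl u u = -u :=
  Submodule.reflection_orthogonalComplement_singleton_eq_neg u

theorem refl_eq_self_iff (u v : V) : refl u v = v ↔ inner ℝ u v = 0 := by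
  rw [refl, Submodule.reflection_eq_self_iff, Submodule.mem_orthogonal_singleton_iff_inner_right]

theorem refl_mul_self (u : V) : refl u * refl u = 1 := Submodule.reflection_mul_reflection _

theorem refl_inv (u : V) : (refl u)⁻¹ = refl u := Submodule.reflection_inv

theorem refl_neg (u : V) : refl (-u) = refl u := by
  unfold refl
  congr 2
  rw [← Set.neg_singleton, Submodule.span_neg]

theorem refl_map (g : V ≃ₗᵢ[ℝ] V) {u : V} (hu : ‖u‖ = 1) : refl (g u) = g * refl u * g⁻¹ := by
  have hgu : ‖g u‖ = 1 := by rw [g.norm_map, hu]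
  ext v
  have h : (g * refl u * g⁻¹) v = g (refl u (g⁻¹ v)) := rfl
  have h3 : g (g⁻¹ v) = v := g.apply_symm_apply v
  have h2 : inner ℝ (g u) v = inner ℝ u (g⁻¹ v) := by
    rw [← g.inner_map_map u, h3]
  rw [h, refl_apply hgu, refl_apply hu, map_sub, map_smul, h2, h3]

/-- The submodule fixed by an orthogonal transformation. -/
abbrev fixed (g : V ≃ₗᵢ[ℝ] V) : Submodule ℝ V :=
  LinearMap.fixedSubmodule (g.toLinearEquiv : V →ₗ[ℝ] V)

theorem mem_fixed {g : V ≃ₗᵢ[ℝ] V} {v : V} : v ∈ fixed g ↔ g v = v := by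
  rw [LinearMap.mem_fixedSubmodule_iff]; rfl

theorem fixed_refl (u : V) : fixed (refl u) = (ℝ ∙ u)ᗮ := by
  ext v
  rw [mem_fixed, refl, Submodule.reflection_eq_self_iff]

variable [FiniteDimensional ℝ V]

theorem isReflection_refl {u : V} (hu : ‖u‖ = 1) : IsReflection (refl u) := by
  have hu0 : u ≠ 0 := by rintro rfl; simp at hu
  have := Submodule.finrank_add_finrank_orthogonal (ℝ ∙ u)
  rw [finrank_span_singleton hu0] at this
  change finrank ℝ (fixed (refl u)) + 1 = _
  rw [fixed_refl]
  omega

/-- The orthogonal complement of the fixed space is an invariant line, so `g` acts on it by a sign.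
The sign is not `1`, since no nonzero vector of the complement is fixed. -/
theorem IsReflection.exists_refl {g : V ≃ₗᵢ[ℝ] V} (hg : IsReflection g) :
    ∃ u : V, ‖u‖ = 1 ∧ g = refl u := by
  have h1 : finrank ℝ (fixed g)ᗮ = 1 := by
    have := Submodule.finrank_add_finrank_orthogonal (fixed g)
    have h2 : finrank ℝ (fixed g) + 1 = finrank ℝ V := hg
    omega
  obtain ⟨v, hv, hvs⟩ := finrank_eq_one_iff'.1 h1
  have hv0 : (v : V) ≠ 0 := by simpa using hv
  have hn : ‖(v : V)‖ ≠ 0 := norm_ne_zero_iff.2 hv0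
  set u : V := ‖(v : V)‖⁻¹ • (v : V) with hudef
  have hu : ‖u‖ = 1 := by
    rw [hudef, norm_smul, norm_inv, norm_norm, inv_mul_cancel₀ hn]
  have huo : u ∈ (fixed g)ᗮ := Submodule.smul_mem _ _ v.2
  have hspan : ∀ w ∈ (fixed g)ᗮ, ∃ c : ℝ, c • u = w := by
    intro w hw
    obtain ⟨c, hc⟩ := hvs ⟨w, hw⟩
    refine ⟨c * ‖(v : V)‖, ?_⟩
    have hc' : c • (v : V) = w := congrArg Subtype.val hc
    rw [hudef, smul_smul, mul_assoc, mul_inv_cancel₀ hn, mul_one, hc']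
  have hgu : g u ∈ (fixed g)ᗮ := by
    rw [Submodule.mem_orthogonal]
    intro w hw
    have hw' : g w = w := mem_fixed.1 hw
    rw [← hw', g.inner_map_map]
    exact (Submodule.mem_orthogonal _ _).1 huo w hw
  obtain ⟨c, hc⟩ := hspan _ hgu
  have hc1 : |c| = 1 := by
    have : ‖g u‖ = 1 := by rw [g.norm_map, hu]
    rw [← hc, norm_smul, hu, mul_one] at this
    simpa using this
  have hne : g u ≠ u := by
    intro h
    have h0 := (Submodule.mem_orthogonal _ _).1 huo u (mem_fixed.2 h)
    rw [real_inner_self_eq_norm_sq, hu] at h0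
    norm_num at h0
  have hgu' : g u = -u := by
    rcases eq_or_eq_neg_of_abs_eq hc1 with h | h
    · rw [h, one_smul] at hc
      exact (hne hc.symm).elim
    · rw [← hc, h, neg_one_smul]
  refine ⟨u, hu, ?_⟩
  ext w
  obtain ⟨y, hy, z, hz, rfl⟩ := (fixed g).exists_add_mem_mem_orthogonal w
  obtain ⟨c, rfl⟩ := hspan z hz
  rw [map_add, map_add, g.map_smul, (refl u).map_smul, hgu', refl_self, mem_fixed.1 hy,
    (refl_eq_self_iff u y).2]
  rw [real_inner_comm]
  exact (Submodule.mem_orthogonal _ _).1 huo y hy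

/-- The determinant of an orthogonal transformation. -/
noncomputable def detHom : (V ≃ₗᵢ[ℝ] V) →* ℝ where
  toFun g := LinearMap.det (g.toLinearEquiv : V →ₗ[ℝ] V)
  map_one' := LinearMap.det_id
  map_mul' g h := LinearMap.det_comp (g.toLinearEquiv : V →ₗ[ℝ] V) (h.toLinearEquiv : V →ₗ[ℝ] V)

theorem detHom_refl {u : V} (hu : ‖u‖ = 1) : detHom (refl u) = -1 := by
  have hu0 : u ≠ 0 := by rintro rfl; simp at hu
  have h := Submodule.det_reflection (𝕜 := ℝ) (K := (ℝ ∙ u)ᗮ)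
  rw [Submodule.orthogonal_orthogonal, finrank_span_singleton hu0, pow_one] at h
  exact h

theorem IsReflection.detHom_eq {g : V ≃ₗᵢ[ℝ] V} (hg : IsReflection g) : detHom g = -1 := by
  obtain ⟨u, hu, rfl⟩ := hg.exists_refl
  exact detHom_refl hu

theorem eq_one_of_finrank_fixed {g : V ≃ₗᵢ[ℝ] V} (h : finrank ℝ (fixed g) = finrank ℝ V) :
    g = 1 := by
  have := Submodule.eq_top_of_finrank_eq h
  ext v
  exact mem_fixed.1 (this ▸ Submodule.mem_top : v ∈ fixed g)

/-- The Cartan–Dieudonné step: for a moved vector `v`, the reflection along `v - g v` exchanges `v`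
and `g v`, and `v - g v` is orthogonal to everything that `g` fixes. -/
theorem exists_refl_mul_fixed_lt {g : V ≃ₗᵢ[ℝ] V} (hg : g ≠ 1) :
    ∃ u : V, ‖u‖ = 1 ∧ fixed g < fixed (refl u * g) := by
  obtain ⟨v, hv⟩ : ∃ v, g v ≠ v := by
    by_contra! h
    exact hg (LinearIsometryEquiv.ext h)
  have hx : v - g v ≠ 0 := sub_ne_zero.2 (Ne.symm hv)
  have hn : ‖v - g v‖ ≠ 0 := norm_ne_zero_iff.2 hx
  set u : V := ‖v - g v‖⁻¹ • (v - g v) with hu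
  have hu1 : ‖u‖ = 1 := by rw [hu, norm_smul, norm_inv, norm_norm, inv_mul_cancel₀ hn]
  have hrefl : refl u = (ℝ ∙ (v - g v))ᗮ.reflection := by
    unfold refl
    congr 2
    exact Submodule.span_singleton_smul_eq (isUnit_iff_ne_zero.2 (inv_ne_zero hn)) _
  refine ⟨u, hu1, SetLike.lt_iff_le_and_exists.2 ⟨fun w hw => ?_, v, ?_, ?_⟩⟩
  · rw [mem_fixed] at hw ⊢
    change refl u (g w) = w
    rw [hw, refl_eq_self_iff, hu, real_inner_smul_left, inner_sub_left]
    nth_rewrite 2 [← hw]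
    rw [g.inner_map_map, sub_self, mul_zero]
  · rw [mem_fixed]
    change refl u (g v) = v
    have h : refl u v = g v := by
      rw [hrefl]
      exact Submodule.reflection_sub (g.norm_map v).symm
    rw [← h]
    exact Submodule.reflection_reflection _ _
  · rw [mem_fixed]
    exact hv

theorem IsRotation.ne_one {g : V ≃ₗᵢ[ℝ] V} (hg : IsRotation g) : g ≠ 1 := by
  rintro rfl
  have h : finrank ℝ (fixed (1 : V ≃ₗᵢ[ℝ] V)) + 2 = finrank ℝ V := hg
  have h2 : fixed (1 : V ≃ₗᵢ[ℝ] V) = ⊤ := by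
    rw [eq_top_iff]
    intro v _
    exact mem_fixed.2 rfl
  rw [h2, finrank_top] at h
  omega

theorem IsReflection.not_isRotation {g : V ≃ₗᵢ[ℝ] V} (hg : IsReflection g) : ¬ IsRotation g := by
  intro h
  unfold IsReflection at hg
  unfold IsRotation at h
  omega

/-- Multiplication by a suitable reflection lowers the codimension to at most one. It cannot drop to
zero, as `g` would then be a reflection; hence `g` is a product of two reflections. -/
theorem IsRotation.detHom_eq {g : V ≃ₗᵢ[ℝ] V} (hg : IsRotation g) : detHom g = 1 := by
  obtain ⟨u, hu, hlt⟩ := exists_refl_mul_fixed_lt hg.ne_one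
  have h1 := Submodule.finrank_lt_finrank_of_lt hlt
  have h2 : finrank ℝ (fixed g) + 2 = finrank ℝ V := hg
  have h3 := Submodule.finrank_le (fixed (refl u * g))
  have h4 : IsReflection (refl u * g) := by
    change finrank ℝ (fixed (refl u * g)) + 1 = _
    by_contra h5
    have h6 : refl u * g = 1 := eq_one_of_finrank_fixed (by omega)
    have h7 : g = refl u := by
      rw [← refl_inv u]
      exact (inv_eq_of_mul_eq_one_right h6).symm
    exact (isReflection_refl hu).not_isRotation (h7 ▸ hg)
  have h5 := h4.detHom_eq
  rw [map_mul, detHom_refl hu] at h5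
  linarith

/-- In codimension at most two, the determinant detects the parity of the codimension. -/
theorem isReflection_of_detHom {g : V ≃ₗᵢ[ℝ] V} (hf : finrank ℝ V ≤ finrank ℝ (fixed g) + 2)
    (hd : detHom g = -1) : IsReflection g := by
  change finrank ℝ (fixed g) + 1 = _
  have h3 := Submodule.finrank_le (fixed g)
  by_contra h
  rcases (by omega : finrank ℝ (fixed g) = finrank ℝ V ∨ finrank ℝ (fixed g) + 2 = finrank ℝ V)
    with h1 | h1
  · rw [eq_one_of_finrank_fixed h1, map_one] at hd
    norm_num at hd
  · rw [IsRotation.detHom_eq h1] at hd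
    norm_num at hd

theorem eq_one_or_isRotation_of_detHom {g : V ≃ₗᵢ[ℝ] V}
    (hf : finrank ℝ V ≤ finrank ℝ (fixed g) + 2) (hd : detHom g = 1) : g = 1 ∨ IsRotation g := by
  have h3 := Submodule.finrank_le (fixed g)
  rcases (by omega : finrank ℝ (fixed g) = finrank ℝ V ∨ finrank ℝ (fixed g) + 1 = finrank ℝ V ∨
    finrank ℝ (fixed g) + 2 = finrank ℝ V) with h1 | h1 | h1
  · exact Or.inl (eq_one_of_finrank_fixed h1)
  · rw [IsReflection.detHom_eq h1] at hd
    norm_num at hd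
  · exact Or.inr h1

theorem IsReflection.mul_eq_one_or_isRotation {s t : V ≃ₗᵢ[ℝ] V} (hs : IsReflection s)
    (ht : IsReflection t) : s * t = 1 ∨ IsRotation (s * t) := by
  refine eq_one_or_isRotation_of_detHom ?_ ?_
  · have h1 : fixed s ⊓ fixed t ≤ fixed (s * t) := by
      rintro v ⟨hvs, hvt⟩
      have hvs' := mem_fixed.1 hvs
      have hvt' := mem_fixed.1 hvt
      rw [mem_fixed]
      change s (t v) = v
      rw [hvt', hvs']
    have h2 := Submodule.finrank_mono h1
    have h3 := Submodule.finrank_sup_add_finrank_inf_eq (fixed s) (fixed t)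
    have h4 := Submodule.finrank_le (fixed s ⊔ fixed t)
    have hs' : finrank ℝ (fixed s) + 1 = finrank ℝ V := hs
    have ht' : finrank ℝ (fixed t) + 1 = finrank ℝ V := ht
    omega
  · rw [map_mul, hs.detHom_eq, ht.detHom_eq]
    norm_num

theorem IsRotation.mul_isReflection {h s : V ≃ₗᵢ[ℝ] V} (hh : IsRotation h) (hs : IsReflection s)
    (hle : fixed h ≤ fixed s) : IsReflection (h * s) := by
  refine isReflection_of_detHom ?_ ?_
  · have h1 : fixed h ≤ fixed (h * s) := by
      intro v hv
      rw [mem_fixed]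
      change h (s v) = v
      rw [mem_fixed.1 (hle hv), mem_fixed.1 hv]
    have h2 := Submodule.finrank_mono h1
    have h3 : finrank ℝ (fixed h) + 2 = finrank ℝ V := hh
    omega
  · rw [map_mul, hs.detHom_eq, hh.detHom_eq]
    norm_num

theorem finrank_fixed_conj (g h : V ≃ₗᵢ[ℝ] V) :
    finrank ℝ (fixed (g * h * g⁻¹)) = finrank ℝ (fixed h) := by
  have : fixed (g * h * g⁻¹) = (fixed h).map (g.toLinearEquiv : V →ₗ[ℝ] V) := by
    ext v
    rw [mem_fixed, Submodule.mem_map]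
    constructor
    · intro hv
      refine ⟨g⁻¹ v, mem_fixed.2 (g.injective ?_), g.apply_symm_apply v⟩
      exact hv.trans (g.apply_symm_apply v).symm
    · rintro ⟨w, hw, rfl⟩
      change g (h (g.symm (g w))) = g w
      rw [g.symm_apply_apply, mem_fixed.1 hw]
  rw [this]
  exact LinearEquiv.finrank_map_eq g.toLinearEquiv _

theorem IsReflection.conj {s : V ≃ₗᵢ[ℝ] V} (hs : IsReflection s) (g : V ≃ₗᵢ[ℝ] V) :
    IsReflection (g * s * g⁻¹) := by
  change finrank ℝ (fixed _) + 1 = _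
  rw [finrank_fixed_conj]
  exact hs

theorem IsRotation.conj {s : V ≃ₗᵢ[ℝ] V} (hs : IsRotation s) (g : V ≃ₗᵢ[ℝ] V) :
    IsRotation (g * s * g⁻¹) := by
  change finrank ℝ (fixed _) + 2 = _
  rw [finrank_fixed_conj]
  exact hs

theorem IsReflection.mul_self {g : V ≃ₗᵢ[ℝ] V} (hg : IsReflection g) : g * g = 1 := by
  obtain ⟨u, hu, rfl⟩ := hg.exists_refl
  exact refl_mul_self u

theorem IsReflection.inv_eq {g : V ≃ₗᵢ[ℝ] V} (hg : IsReflection g) : g⁻¹ = g :=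
  inv_eq_of_mul_eq_one_left hg.mul_self

theorem IsReflection.ne_one {g : V ≃ₗᵢ[ℝ] V} (hg : IsReflection g) : g ≠ 1 := by
  rintro rfl
  have := hg.detHom_eq
  rw [map_one] at this
  norm_num at this

end Geometry
end ReflRot

namespace ReflRot

open Module

/-! ### Root systems, the exchange condition and the presentation of a Weyl group by its reflections
-/

section RootSystem

theorem list_map_reverse_prod {α Q : Type*} [Group Q] {f : α → Q} {M : List α}
    (hf : ∀ c ∈ M, f c * f c = 1) : (M.reverse.map f).prod = (M.map f).prod⁻¹ := by
  induction M with
  | nil => simp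
  | cons c M ih =>
    rw [List.forall_mem_cons] at hf
    rw [List.reverse_cons, List.map_append, List.prod_append, ih hf.2, List.map_cons,
      List.map_cons, List.prod_cons, List.prod_cons, mul_inv_rev,
      inv_eq_of_mul_eq_one_left hf.1]
    simp

variable {V : Type*} [NormedAddCommGroup V] [InnerProductSpace ℝ V]

/-- A finite set of unit vectors that is stable under the reflections in its elements. -/
structure IsRootSystem (Φ : Set V) : Prop where
  finite : Φ.Finite
  norm : ∀ a ∈ Φ, ‖a‖ = 1
  refl_mem : ∀ a ∈ Φ, ∀ b ∈ Φ, refl a b ∈ Φ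

theorem IsRootSystem.neg_mem {Φ : Set V} (hΦ : IsRootSystem Φ) {a : V} (ha : a ∈ Φ) : -a ∈ Φ := by
  rw [← refl_self]
  exact hΦ.refl_mem a ha a ha

/-- The roots that are positive on `x`. -/
def posRoots (Φ : Set V) (x : V) : Set V := {a ∈ Φ | 0 < inner ℝ a x}

/-- `x` does not lie on any of the hyperplanes orthogonal to the roots. -/
def IsRegular (Φ : Set V) (x : V) : Prop := ∀ a ∈ Φ, inner ℝ a x ≠ 0

theorem IsRootSystem.mem_or_neg_mem_posRoots {Φ : Set V} (hΦ : IsRootSystem Φ) {x : V}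
    (hx : IsRegular Φ x) {a : V} (ha : a ∈ Φ) : a ∈ posRoots Φ x ∨ -a ∈ posRoots Φ x := by
  rcases lt_or_gt_of_ne (hx a ha) with h | h
  · exact Or.inr ⟨hΦ.neg_mem ha, by rw [inner_neg_left]; linarith⟩
  · exact Or.inl ⟨ha, h⟩

theorem neg_notMem_posRoots {Φ : Set V} {x a : V} (ha : a ∈ posRoots Φ x) :
    -a ∉ posRoots Φ x := by
  intro h
  have h1 := h.2
  rw [inner_neg_left] at h1
  linarith [ha.2]

/-- The convex cone generated by `S`. -/
abbrev cone (S : Set V) : Submodule NNReal V := Submodule.span NNReal S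

theorem cone_pos {S : Set V} {x : V} (hS : ∀ a ∈ S, 0 < inner ℝ a x) {v : V} (hv : v ∈ cone S) :
    v = 0 ∨ 0 < inner ℝ v x := by
  induction hv using Submodule.span_induction with
  | mem a ha => exact Or.inr (hS a ha)
  | zero => exact Or.inl rfl
  | add a b _ _ iha ihb =>
    rcases iha with rfl | ha
    · simpa using ihb
    · rcases ihb with rfl | hb
      · simpa using Or.inr ha
      · rw [inner_add_left]
        exact Or.inr (by linarith)
  | smul c a _ iha =>
    rcases iha with rfl | ha
    · simp
    · rcases eq_or_ne c 0 with rfl | hc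
      · simp
      · right
        rw [NNReal.smul_def, real_inner_smul_left]
        have : (0 : ℝ) < c := by exact_mod_cast pos_iff_ne_zero.2 hc
        positivity

/-- A set of positive roots that generates the cone of all positive roots and is minimal with this
property. -/
structure IsSimpleSystem (Φ : Set V) (x : V) (S : Set V) : Prop where
  subset : S ⊆ posRoots Φ x
  generates : posRoots Φ x ⊆ cone S
  minimal : ∀ a ∈ S, a ∉ cone (S \ {a})

/-- A generating set of positive roots of least cardinality is minimal. -/
theorem IsRootSystem.exists_isSimpleSystem {Φ : Set V} (hΦ : IsRootSystem Φ) (x : V) :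
    ∃ S, IsSimpleSystem Φ x S := by
  classical
  have hex : ∃ n : ℕ, ∃ S : Set V, S ⊆ posRoots Φ x ∧ posRoots Φ x ⊆ cone S ∧ S.ncard = n :=
    ⟨_, posRoots Φ x, subset_rfl, Submodule.subset_span, rfl⟩
  obtain ⟨S, hS1, hS2, hS3⟩ := Nat.find_spec hex
  refine ⟨S, hS1, hS2, fun a ha hmem => ?_⟩
  have hfin : S.Finite := hΦ.finite.subset (hS1.trans fun _ h => h.1)
  have hlt : (S \ {a}).ncard < Nat.find hex := by
    rw [← hS3]
    exact Set.ncard_sdiff_singleton_lt_of_mem ha hfin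
  refine Nat.find_min hex hlt ⟨S \ {a}, Set.sdiff_subset.trans hS1, hS2.trans ?_, rfl⟩
  refine Submodule.span_le.2 fun b hb => ?_
  by_cases hba : b = a
  · rw [hba]
    exact hmem
  · exact Submodule.subset_span ⟨hb, hba⟩

section Simple

variable {Φ : Set V} {x : V} {S : Set V}

/-- A simple reflection permutes the other positive roots. If both `b` and `-refl a b` were
positive, the sum of their parts `d`, `d'` in the cone of the remaining simple roots would be a
multiple of `a`. A positive multiple contradicts minimality; otherwise `d = 0`, so `b` is a multiple
of `a`. -/
theorem IsSimpleSystem.refl_mem_posRoots (hS : IsSimpleSystem Φ x S) (hΦ : IsRootSystem Φ)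
    (hx : IsRegular Φ x) {a b : V} (ha : a ∈ S) (hb : b ∈ posRoots Φ x) (hba : b ≠ a) :
    refl a b ∈ posRoots Φ x := by
  have haΦ := (hS.subset ha).1
  have hdecomp : ∀ c ∈ posRoots Φ x, ∃ k : ℝ, 0 ≤ k ∧ ∃ d ∈ cone (S \ {a}), c = k • a + d := by
    intro c hc
    have h := hS.generates hc
    rw [← Set.insert_sdiff_self_of_mem ha, SetLike.mem_coe, Submodule.mem_span_insert] at h
    obtain ⟨k, d, hd, h⟩ := h
    exact ⟨k, k.2, d, hd, h⟩
  rcases hΦ.mem_or_neg_mem_posRoots hx (hΦ.refl_mem a haΦ b hb.1) with h | h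
  · exact h
  exfalso
  obtain ⟨k, hk, d, hd, hbd⟩ := hdecomp b hb
  obtain ⟨k', hk', d', hd', hbd'⟩ := hdecomp _ h
  rw [refl_apply (hΦ.norm a haΦ)] at hbd'
  set c := 2 * inner ℝ a b
  have hsum : d + d' = (c - k - k') • a := by
    have h1 : d' = -(b - c • a) - k' • a := by rw [hbd']; abel
    rw [h1, hbd, sub_smul, sub_smul]
    abel
  have hpos : ∀ e ∈ S \ {a}, 0 < inner ℝ e x := fun e he => (hS.subset he.1).2
  rcases lt_or_ge 0 (c - k - k') with hm | hm
  · refine hS.minimal a ha ?_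
    have h2 : a = (c - k - k')⁻¹ • (d + d') := by
      rw [hsum, smul_smul, inv_mul_cancel₀ hm.ne', one_smul]
    have h3 : (Real.toNNReal (c - k - k')⁻¹) • (d + d') ∈ cone (S \ {a}) :=
      Submodule.smul_mem _ _ (Submodule.add_mem _ hd hd')
    rwa [NNReal.smul_def, Real.coe_toNNReal _ (inv_pos.2 hm).le, ← h2] at h3
  · have h3 : inner ℝ d x + inner ℝ d' x ≤ 0 := by
      rw [← inner_add_left, hsum, real_inner_smul_left]
      exact mul_nonpos_of_nonpos_of_nonneg hm (hS.subset ha).2.le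
    have hd0 : d = 0 := by
      rcases cone_pos hpos hd with h | h
      · exact h
      · rcases cone_pos hpos hd' with h' | h'
        · rw [h', inner_zero_left] at h3
          linarith
        · linarith
    -- Now `b = k • a` with `k ≥ 0`, and all roots have norm one.
    rw [hd0, add_zero] at hbd
    have hn := hΦ.norm b hb.1
    rw [hbd, norm_smul, hΦ.norm a haΦ, mul_one, Real.norm_eq_abs, abs_of_nonneg hk] at hn
    rw [hn, one_smul] at hbd
    exact hba hbd

theorem IsSimpleSystem.eq_of_refl_neg (hS : IsSimpleSystem Φ x S) (hΦ : IsRootSystem Φ)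
    (hx : IsRegular Φ x) {a b : V} (ha : a ∈ S) (hb : b ∈ posRoots Φ x)
    (hn : -refl a b ∈ posRoots Φ x) : b = a := by
  by_contra h
  exact neg_notMem_posRoots (hS.refl_mem_posRoots hΦ hx ha hb h) hn

/-- Every root is, up to sign, conjugate to a simple root. -/
theorem IsSimpleSystem.exists_conj (hS : IsSimpleSystem Φ x S) (hΦ : IsRootSystem Φ)
    (hx : IsRegular Φ x) {b : V} (hb : b ∈ posRoots Φ x) :
    ∃ L : List V, (∀ a ∈ L, a ∈ S) ∧ ∃ a ∈ S, b = (L.map refl).prod a := by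
  let O : Set V := {c ∈ posRoots Φ x | ∃ L : List V, (∀ a ∈ L, a ∈ S) ∧ b = (L.map refl).prod c}
  have hO : O.Finite := hΦ.finite.subset fun _ h => h.1.1
  -- Take the conjugate closest to the wall at height zero. If it is not simple, reflecting it in a
  -- simple root with which it has positive inner product keeps it positive and lowers it further.
  obtain ⟨c, ⟨hc, L, hL, hbc⟩, hmin⟩ := Set.exists_min_image O (fun c => inner ℝ c x) hO
    ⟨b, hb, [], by simp, by simp⟩
  -- Otherwise `c`, which lies in the cone of `S`, would satisfy `⟨c, c⟩ ≤ 0`.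
  obtain ⟨a, ha, hac⟩ : ∃ a ∈ S, 0 < inner ℝ c a := by
    by_contra! h
    have h1 : ∀ v ∈ cone S, inner ℝ c v ≤ 0 := by
      intro v hv
      induction hv using Submodule.span_induction with
      | mem v hv => exact h v hv
      | zero => simp
      | add v w _ _ hv hw => rw [inner_add_right]; linarith
      | smul k v _ hv =>
        rw [NNReal.smul_def, real_inner_smul_right]
        exact mul_nonpos_of_nonneg_of_nonpos k.2 hv
    have h2 := h1 c (hS.generates hc)
    rw [real_inner_self_eq_norm_sq, hΦ.norm c hc.1] at h2
    norm_num at h2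
  have haΦ := hS.subset ha
  by_cases hca : c = a
  · exact ⟨L, hL, a, ha, hca ▸ hbc⟩
  exfalso
  have hmem : refl a c ∈ O := by
    refine ⟨hS.refl_mem_posRoots hΦ hx ha hc hca, L ++ [a], ?_, ?_⟩
    · intro e he
      rcases List.mem_append.1 he with he | he
      · exact hL e he
      · rw [List.mem_singleton.1 he]
        exact ha
    · rw [List.map_append, List.prod_append, List.map_singleton, List.prod_singleton]
      change b = (L.map refl).prod ((refl a * refl a) c)
      rw [refl_mul_self]
      exact hbc
  have h := hmin _ hmem
  rw [refl_apply (hΦ.norm a haΦ.1), inner_sub_left, real_inner_smul_left, real_inner_comm c a] at h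
  have := mul_pos (mul_pos two_pos hac) haΦ.2
  linarith

variable {Q : Type*} [Group Q]

/-- A map on roots that is compatible with the relations between reflections. -/
structure IsCompatible (Φ : Set V) (φ : V → Q) : Prop where
  neg : ∀ a ∈ Φ, φ (-a) = φ a
  mul_self : ∀ a ∈ Φ, φ a * φ a = 1
  conj : ∀ a ∈ Φ, ∀ b ∈ Φ, φ (refl a b) = φ a * φ b * φ a

theorem IsRootSystem.list_prod_mem (hΦ : IsRootSystem Φ) {L : List V} (hL : ∀ a ∈ L, a ∈ Φ)
    {b : V} (hb : b ∈ Φ) : (L.map refl).prod b ∈ Φ := by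
  induction L with
  | nil => exact hb
  | cons a L ih =>
    rw [List.forall_mem_cons] at hL
    rw [List.map_cons, List.prod_cons]
    exact hΦ.refl_mem a hL.1 _ (ih hL.2)

theorem IsCompatible.list_prod {φ : V → Q} (hφ : IsCompatible Φ φ) (hΦ : IsRootSystem Φ)
    {L : List V} (hL : ∀ a ∈ L, a ∈ Φ) {b : V} (hb : b ∈ Φ) :
    φ ((L.map refl).prod b) = (L.map φ).prod * φ b * (L.map φ).prod⁻¹ := by
  induction L with
  | nil => simp
  | cons a L ih =>
    rw [List.forall_mem_cons] at hL
    rw [List.map_cons, List.prod_cons, List.map_cons, List.prod_cons]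
    change φ (refl a ((L.map refl).prod b)) = _
    rw [hφ.conj a hL.1 _ (hΦ.list_prod_mem hL.2 hb), ih hL.2, mul_inv_rev,
      inv_eq_of_mul_eq_one_left (hφ.mul_self a hL.1)]
    simp only [mul_assoc]

/-- The exchange condition, together with the effect of a compatible map. -/
theorem IsSimpleSystem.exchange (hS : IsSimpleSystem Φ x S) (hΦ : IsRootSystem Φ)
    (hx : IsRegular Φ x) {φ : V → Q} (hφ : IsCompatible Φ φ) {a : V} (ha : a ∈ S)
    (L : List V) (hL : ∀ b ∈ L, b ∈ S) (hneg : -(L.map refl).prod a ∈ posRoots Φ x) :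
    ∃ L' : List V, (∀ b ∈ L', b ∈ S) ∧ L'.length + 1 = L.length ∧
      (L'.map refl).prod = (L.map refl).prod * refl a ∧
      (L'.map φ).prod = (L.map φ).prod * φ a := by
  induction L with
  | nil => exact (neg_notMem_posRoots (hS.subset ha) hneg).elim
  | cons b L ih =>
    rw [List.forall_mem_cons] at hL
    obtain ⟨hb, hL⟩ := hL
    have hLΦ : ∀ c ∈ L, c ∈ Φ := fun c hc => (hS.subset (hL c hc)).1
    have haΦ := (hS.subset ha).1
    rcases hΦ.mem_or_neg_mem_posRoots hx (hΦ.list_prod_mem hLΦ haΦ) with h | h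
    -- Here `b` is the letter at which the image of `a` becomes negative, so that image equals `b`
    -- and conjugation turns multiplication by `refl a` into deletion of `b`.
    · have heq := hS.eq_of_refl_neg hΦ hx hb h hneg
      refine ⟨L, hL, rfl, ?_, ?_⟩
      · rw [List.map_cons, List.prod_cons, ← heq, refl_map _ (hΦ.norm a haΦ)]
        simp only [mul_assoc, inv_mul_cancel_left, refl_mul_self, mul_one]
      · rw [List.map_cons, List.prod_cons, ← heq, hφ.list_prod hΦ hLΦ haΦ]
        simp only [mul_assoc, inv_mul_cancel_left, hφ.mul_self a haΦ, mul_one]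
    · obtain ⟨L', h1, h2, h3, h4⟩ := ih hL h
      refine ⟨b :: L', List.forall_mem_cons.2 ⟨hb, h1⟩, by simp [h2], ?_, ?_⟩
      · simp [h3, mul_assoc]
      · simp [h4, mul_assoc]

/-- The last letter `a` is made negative by its own reflection, so the letters before it must map
`a` to a negative root. Exchange then shortens the word without changing either product. -/
theorem IsSimpleSystem.list_prod_eq_one (hS : IsSimpleSystem Φ x S) (hΦ : IsRootSystem Φ)
    (hx : IsRegular Φ x) {φ : V → Q} (hφ : IsCompatible Φ φ) (n : ℕ) (L : List V)
    (hn : L.length = n) (hL : ∀ b ∈ L, b ∈ S)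
    (hpos : ∀ b ∈ posRoots Φ x, (L.map refl).prod b ∈ posRoots Φ x) : (L.map φ).prod = 1 := by
  induction n using Nat.strong_induction_on generalizing L with
  | _ n ih =>
    rcases L.eq_nil_or_concat' with rfl | ⟨L, a, rfl⟩
    · rfl
    have ha : a ∈ S := hL a (by simp)
    have hL' : ∀ b ∈ L, b ∈ S := fun b hb => hL b (by simp [hb])
    have hprod : ((L ++ [a]).map refl).prod = (L.map refl).prod * refl a := by simp
    have hneg : -(L.map refl).prod a ∈ posRoots Φ x := by
      have h := hpos a (hS.subset ha)
      rw [hprod] at h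
      change (L.map refl).prod (refl a a) ∈ _ at h
      rwa [refl_self, map_neg] at h
    obtain ⟨L', h1, h2, h3, h4⟩ := hS.exchange hΦ hx hφ ha L hL' hneg
    have h5 := ih L'.length (by simp at hn; omega) L' rfl h1 (by rw [h3, ← hprod]; exact hpos)
    rw [← h5, h4]
    simp

/-- Every root is up to sign conjugate to a simple one, so each letter can be replaced by a
palindrome in simple roots, with the same effect under `φ`. -/
theorem IsSimpleSystem.exists_simple_list (hS : IsSimpleSystem Φ x S) (hΦ : IsRootSystem Φ)
    (hx : IsRegular Φ x) {φ : V → Q} (hφ : IsCompatible Φ φ) (L : List V)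
    (hL : ∀ b ∈ L, b ∈ Φ) : ∃ L' : List V, (∀ b ∈ L', b ∈ S) ∧
      (L'.map refl).prod = (L.map refl).prod ∧ (L'.map φ).prod = (L.map φ).prod := by
  induction L with
  | nil => exact ⟨[], by simp, rfl, rfl⟩
  | cons b L ih =>
    rw [List.forall_mem_cons] at hL
    obtain ⟨L1, h1, h2, h3⟩ := ih hL.2
    obtain ⟨L2, hL2, h4, h5⟩ : ∃ L' : List V, (∀ b ∈ L', b ∈ S) ∧
      (L'.map refl).prod = refl b ∧ (L'.map φ).prod = φ b := by
      have key : ∀ c ∈ posRoots Φ x, ∃ L' : List V, (∀ b ∈ L', b ∈ S) ∧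
          (L'.map refl).prod = refl c ∧ (L'.map φ).prod = φ c := by
        intro c hc
        obtain ⟨M, hM, a, ha, rfl⟩ := hS.exists_conj hΦ hx hc
        have hMΦ : ∀ c ∈ M, c ∈ Φ := fun c hc => (hS.subset (hM c hc)).1
        have haΦ := (hS.subset ha).1
        refine ⟨M ++ [a] ++ M.reverse, ?_, ?_, ?_⟩
        · intro e he
          simp only [List.mem_append, List.mem_singleton, List.mem_reverse] at he
          rcases he with (he | rfl) | he
          · exact hM e he
          · exact ha
          · exact hM e he
        · rw [refl_map _ (hΦ.norm a haΦ), List.map_append, List.prod_append,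
            list_map_reverse_prod fun c _ => refl_mul_self c]
          simp
        · rw [hφ.list_prod hΦ hMΦ haΦ, List.map_append, List.prod_append,
            list_map_reverse_prod fun c hc => hφ.mul_self c (hMΦ c hc)]
          simp
      rcases hΦ.mem_or_neg_mem_posRoots hx hL.1 with h | h
      · exact key b h
      · obtain ⟨L', h1, h2, h3⟩ := key _ h
        exact ⟨L', h1, by rw [h2, refl_neg], by rw [h3, hφ.neg b hL.1]⟩
    refine ⟨L2 ++ L1, ?_, ?_, ?_⟩
    · intro e he
      rcases List.mem_append.1 he with he | he
      · exact hL2 e he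
      · exact h1 e he
    · simp [h4, h2]
    · simp [h5, h3]

end Simple

variable {Φ : Set V} {x : V} {Q : Type*} [Group Q]

/-- A word in reflections that preserves the positive roots is a consequence of the relations
`s * s = 1` and `s * t * s = (s * t * s)`. -/
theorem IsRootSystem.list_prod_eq_one (hΦ : IsRootSystem Φ) (hx : IsRegular Φ x) {φ : V → Q}
    (hφ : IsCompatible Φ φ) (L : List V) (hL : ∀ b ∈ L, b ∈ Φ)
    (hpos : ∀ b ∈ posRoots Φ x, (L.map refl).prod b ∈ posRoots Φ x) : (L.map φ).prod = 1 := by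
  obtain ⟨S, hS⟩ := hΦ.exists_isSimpleSystem x
  obtain ⟨L', h1, h2, h3⟩ := hS.exists_simple_list hΦ hx hφ L hL
  rw [← h3]
  exact hS.list_prod_eq_one hΦ hx hφ _ L' rfl h1 (by rw [h2]; exact hpos)

theorem IsRootSystem.isCompatible_refl (hΦ : IsRootSystem Φ) : IsCompatible Φ (refl : V → _) where
  neg a _ := refl_neg a
  mul_self a _ := refl_mul_self a
  conj a _ b hb := by rw [refl_map _ (hΦ.norm b hb), refl_inv]

/-- The group generated by the reflections in the roots. -/
def weylGroup (Φ : Set V) : Subgroup (V ≃ₗᵢ[ℝ] V) := Subgroup.closure (refl '' Φ)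

theorem exists_list_of_mem_weylGroup {w : V ≃ₗᵢ[ℝ] V} (hw : w ∈ weylGroup Φ) :
    ∃ L : List V, (∀ b ∈ L, b ∈ Φ) ∧ (L.map refl).prod = w := by
  induction hw using Subgroup.closure_induction_left with
  | one => exact ⟨[], by simp, rfl⟩
  | mul_left y hy w _ ih =>
    obtain ⟨a, ha, rfl⟩ := hy
    obtain ⟨L, hL, rfl⟩ := ih
    exact ⟨a :: L, List.forall_mem_cons.2 ⟨ha, hL⟩, by simp⟩
  | inv_mul_cancel y hy w _ ih =>
    obtain ⟨a, ha, rfl⟩ := hy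
    obtain ⟨L, hL, rfl⟩ := ih
    exact ⟨a :: L, List.forall_mem_cons.2 ⟨ha, hL⟩, by simp [refl_inv]⟩

theorem IsRootSystem.eq_one_of_mem_weylGroup (hΦ : IsRootSystem Φ) (hx : IsRegular Φ x)
    {w : V ≃ₗᵢ[ℝ] V} (hw : w ∈ weylGroup Φ)
    (hpos : ∀ b ∈ posRoots Φ x, w b ∈ posRoots Φ x) : w = 1 := by
  obtain ⟨L, hL, rfl⟩ := exists_list_of_mem_weylGroup hw
  exact hΦ.list_prod_eq_one hx hΦ.isCompatible_refl L hL hpos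

theorem IsRootSystem.list_prod_eq_of_eq (hΦ : IsRootSystem Φ) (hx : IsRegular Φ x) {φ : V → Q}
    (hφ : IsCompatible Φ φ) {L M : List V} (hL : ∀ b ∈ L, b ∈ Φ) (hM : ∀ b ∈ M, b ∈ Φ)
    (h : (L.map refl).prod = (M.map refl).prod) : (L.map φ).prod = (M.map φ).prod := by
  have h1 : ((L ++ M.reverse).map refl).prod = 1 := by
    rw [List.map_append, List.prod_append, list_map_reverse_prod fun c _ => refl_mul_self c, h, mul_inv_cancel]
  have h2 := hΦ.list_prod_eq_one hx hφ (L ++ M.reverse) (by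
    intro b hb
    rcases List.mem_append.1 hb with hb | hb
    · exact hL b hb
    · exact hM b (List.mem_reverse.1 hb)) (by
    rw [h1]
    exact fun b hb => hb)
  rw [List.map_append, List.prod_append, list_map_reverse_prod fun c hc => hφ.mul_self c (hM c hc)] at h2
  exact mul_inv_eq_one.1 h2

/-- A compatible map on the roots extends to a map that is multiplicative on the Weyl group. -/
theorem IsRootSystem.exists_extension (hΦ : IsRootSystem Φ) (hx : IsRegular Φ x) {φ : V → Q}
    (hφ : IsCompatible Φ φ) : ∃ f : (V ≃ₗᵢ[ℝ] V) → Q,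
      (∀ v ∈ weylGroup Φ, ∀ w ∈ weylGroup Φ, f (v * w) = f v * f w) ∧
      ∀ a ∈ Φ, f (refl a) = φ a := by
  classical
  choose! L hL hprod using fun (w : V ≃ₗᵢ[ℝ] V) (hw : w ∈ weylGroup Φ) =>
    exists_list_of_mem_weylGroup hw
  refine ⟨fun w => ((L w).map φ).prod, fun v hv w hw => ?_, fun a ha => ?_⟩
  · rw [← List.prod_append, ← List.map_append]
    refine hΦ.list_prod_eq_of_eq hx hφ (hL _ (mul_mem hv hw)) ?_ ?_
    · intro b hb
      rcases List.mem_append.1 hb with hb | hb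
      · exact hL _ hv b hb
      · exact hL _ hw b hb
    · rw [List.map_append, List.prod_append, hprod v hv, hprod w hw, hprod _ (mul_mem hv hw)]
  · have hmem : refl a ∈ weylGroup Φ := Subgroup.subset_closure ⟨a, ha, rfl⟩
    have := hΦ.list_prod_eq_of_eq hx hφ (L := L (refl a)) (M := [a]) (hL _ hmem)
      (by simpa using ha) (by rw [hprod _ hmem]; simp)
    simpa using this

/-- Every regular point is conjugate to a point in the chamber of `x`. -/
theorem IsRootSystem.exists_mem_chamber (hΦ : IsRootSystem Φ) (hx : IsRegular Φ x)
    (hfin : Finite (weylGroup Φ)) {y : V} (hy : IsRegular Φ y) :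
    ∃ w ∈ weylGroup Φ, posRoots Φ (w y) = posRoots Φ x := by
  have hstable : ∀ w ∈ weylGroup Φ, ∀ a ∈ Φ, w a ∈ Φ := by
    intro w hw a ha
    obtain ⟨L, hL, rfl⟩ := exists_list_of_mem_weylGroup hw
    exact hΦ.list_prod_mem hL ha
  -- The translate of `y` with the largest inner product with `x` is on the same side of every
  -- mirror as `x`; otherwise reflecting it would increase the product.
  obtain ⟨⟨w, hw⟩, hmax⟩ := Finite.exists_max fun w : weylGroup Φ => inner ℝ x (w.1 y)
  have hreg : IsRegular Φ (w y) := by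
    intro a ha h0
    refine hy _ (hstable w⁻¹ (inv_mem hw) a ha) ?_
    have : w (w⁻¹ a) = a := w.apply_symm_apply a
    rw [← w.inner_map_map, this, h0]
  refine ⟨w, hw, ?_⟩
  have key : ∀ a ∈ Φ, 0 < inner ℝ a x → 0 < inner ℝ a (w y) := by
    intro a ha hax
    have h := hmax ⟨refl a * w, mul_mem (Subgroup.subset_closure ⟨a, ha, rfl⟩) hw⟩
    change inner ℝ x (refl a (w y)) ≤ inner ℝ x (w y) at h
    rw [refl_apply (hΦ.norm a ha), inner_sub_right, real_inner_smul_right, real_inner_comm a x] at h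
    rcases lt_or_gt_of_ne (hreg a ha) with h0 | h0
    · have := mul_pos_of_neg_of_neg (by linarith : 2 * inner ℝ a (w y) < 0)
        (by linarith : -inner ℝ a x < 0)
      linarith
    · exact h0
  ext a
  refine ⟨fun h => ?_, fun h => ⟨h.1, key a h.1 h.2⟩⟩
  rcases hΦ.mem_or_neg_mem_posRoots hx h.1 with h1 | h1
  · exact h1
  · have := key _ h1.1 h1.2
    rw [inner_neg_left] at this
    linarith [h.2]

end RootSystem
end ReflRot

namespace ReflRot

open Module

/-! ### Roots of a set of reflections, and regular vectors in a subspace -/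

section RootsOfGroups

set_option linter.unusedSectionVars false

variable {V : Type*} [NormedAddCommGroup V] [InnerProductSpace ℝ V]

/-- The unit normal vectors of the reflections in `R`. -/
def rootsOf (R : Set (V ≃ₗᵢ[ℝ] V)) : Set V := {u | ‖u‖ = 1 ∧ refl u ∈ R}

/-- A finite family of vectors, none of which is orthogonal to `U`, has a regular point in `U`. -/
theorem exists_isRegular_mem {Φ : Set V} (hΦ : Φ.Finite) (U : Submodule ℝ V)
    (h : ∀ a ∈ Φ, ∃ u ∈ U, inner ℝ a u ≠ 0) : ∃ u ∈ U, IsRegular Φ u := by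
  classical
  by_contra! hcon
  -- The mirrors cut out finitely many proper subspaces of `U`, and these do not cover `U` over an
  -- infinite field.
  let p : V → Subspace ℝ U := fun a => LinearMap.ker ((innerₛₗ ℝ a).comp U.subtype)
  have hp : ∀ (a : V) (u : U), u ∈ p a ↔ inner ℝ a (u : V) = 0 := fun a u => by
    simp [p, LinearMap.mem_ker]
  let s : Finset (Subspace ℝ U) := hΦ.toFinset.image p
  have hs : ⊤ ∉ s := by
    intro htop
    obtain ⟨a, ha, hat⟩ := Finset.mem_image.1 htop
    obtain ⟨u, hu, hau⟩ := h a (hΦ.mem_toFinset.1 ha)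
    exact hau ((hp a ⟨u, hu⟩).1 (hat ▸ Submodule.mem_top))
  refine Subspace.biUnion_ne_univ_of_top_notMem hs (Set.eq_univ_of_forall fun u => ?_)
  have := hcon u u.2
  unfold IsRegular at this
  push Not at this
  obtain ⟨a, ha, hau⟩ := this
  exact Set.mem_biUnion (Finset.mem_image_of_mem p (hΦ.mem_toFinset.2 ha)) ((hp a u).2 hau)

theorem IsRootSystem.exists_isRegular {Φ : Set V} (hΦ : IsRootSystem Φ) :
    ∃ x, IsRegular Φ x := by
  obtain ⟨x, -, hx⟩ := exists_isRegular_mem hΦ.finite ⊤ fun a ha =>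
    ⟨a, Submodule.mem_top, by rw [real_inner_self_eq_norm_sq, hΦ.norm a ha]; norm_num⟩
  exact ⟨x, hx⟩

theorem refl_eq_refl_iff {u v : V} (hu : ‖u‖ = 1) (hv : ‖v‖ = 1) (h : refl u = refl v) :
    u = v ∨ u = -v := by
  have h1 : refl v u = -u := by rw [← h, refl_self]
  rw [refl_apply hv] at h1
  have h2 : u = (inner ℝ v u) • v := by
    have h3 : (2 : ℝ) • u = (2 * inner ℝ v u) • v := by
      rw [two_smul, ← sub_eq_zero]
      calc u + u - (2 * inner ℝ v u) • v = (u - (2 * inner ℝ v u) • v) + u := by abel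
        _ = 0 := by rw [h1]; abel
    rw [mul_smul] at h3
    exact smul_right_injective V (two_ne_zero : (2 : ℝ) ≠ 0) h3
  have h3 : |inner ℝ v u| = 1 := by
    have := hu
    rw [h2, norm_smul, hv, mul_one] at this
    simpa using this
  rcases eq_or_eq_neg_of_abs_eq h3 with h4 | h4
  · left; rw [h2, h4, one_smul]
  · right; rw [h2, h4, neg_one_smul]

/-- Finiteness holds because a reflection has at most two unit normals, which are opposite. -/
theorem isRootSystem_rootsOf {R : Set (V ≃ₗᵢ[ℝ] V)} (hR : R.Finite)
    (hconj : ∀ r ∈ R, ∀ s ∈ R, r * s * r⁻¹ ∈ R) : IsRootSystem (rootsOf R) where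
  finite := by
    have hfib : ∀ r ∈ R, {u : V | ‖u‖ = 1 ∧ refl u = r}.Finite := by
      intro r _
      rcases Set.eq_empty_or_nonempty {u : V | ‖u‖ = 1 ∧ refl u = r} with h | ⟨v, hv, rfl⟩
      · rw [h]
        exact Set.finite_empty
      · exact (Set.toFinite {v, -v}).subset fun u hu => refl_eq_refl_iff hu.1 hv hu.2
    exact (hR.biUnion hfib).subset fun u hu => Set.mem_biUnion hu.2 ⟨hu.1, rfl⟩
  norm a ha := ha.1
  refl_mem a ha b hb := ⟨by rw [LinearIsometryEquiv.norm_map, hb.1], by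
    rw [refl_map _ hb.1]
    exact hconj _ ha.2 _ hb.2⟩

variable [FiniteDimensional ℝ V]

theorem weylGroup_rootsOf {R : Set (V ≃ₗᵢ[ℝ] V)} (hR : ∀ r ∈ R, IsReflection r) :
    weylGroup (rootsOf R) = Subgroup.closure R := by
  unfold weylGroup
  congr 1
  ext r
  constructor
  · rintro ⟨u, hu, rfl⟩
    exact hu.2
  · intro hr
    obtain ⟨u, hu, rfl⟩ := (hR r hr).exists_refl
    exact ⟨u, ⟨hu, hr⟩, rfl⟩

/-- The dichotomy behind the analysis of admissible triples: unless the fixed space lies in a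
mirror, it contains a vector off all mirrors. -/
theorem exists_regular_fixed_or {Φ : Set V} (hΦ : IsRootSystem Φ) (g : V ≃ₗᵢ[ℝ] V) :
    (∃ y, g y = y ∧ IsRegular Φ y) ∨ ∃ a ∈ Φ, fixed g ≤ fixed (refl a) := by
  by_cases h : ∀ a ∈ Φ, ∃ u ∈ fixed g, inner ℝ a u ≠ 0
  · obtain ⟨y, hy, hreg⟩ := exists_isRegular_mem hΦ.finite _ h
    exact Or.inl ⟨y, mem_fixed.1 hy, hreg⟩
  · push Not at h
    obtain ⟨a, ha, h⟩ := h
    exact Or.inr ⟨a, ha, fun u hu => mem_fixed.2 ((refl_eq_self_iff a u).2 (h u hu))⟩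

theorem IsReflection.eq_of_fixed_le {r s : V ≃ₗᵢ[ℝ] V} (hr : IsReflection r) (hs : IsReflection s)
    (h : fixed r ≤ fixed s) : r = s := by
  have hr' : finrank ℝ (fixed r) + 1 = finrank ℝ V := hr
  have hs' : finrank ℝ (fixed s) + 1 = finrank ℝ V := hs
  have heq := Submodule.eq_of_le_of_finrank_eq h (by omega)
  obtain ⟨u, hu, rfl⟩ := hr.exists_refl
  obtain ⟨v, hv, rfl⟩ := hs.exists_refl
  rw [fixed_refl, fixed_refl] at heq
  unfold refl
  congr 1

/-- The reflections in a finite group generated by a set `R` of reflections belong to `R`, if `R` is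
stable under conjugation by its elements. -/
theorem IsReflection.mem_of_mem_closure {R : Set (V ≃ₗᵢ[ℝ] V)} (hR : ∀ r ∈ R, IsReflection r)
    (hconj : ∀ r ∈ R, ∀ s ∈ R, r * s * r⁻¹ ∈ R) (hfin : Finite (Subgroup.closure R))
    {r : V ≃ₗᵢ[ℝ] V} (hr : IsReflection r) (hrR : r ∈ Subgroup.closure R) : r ∈ R := by
  have hRfin : R.Finite := (Set.toFinite (Subgroup.closure R : Set _)).subset
    Subgroup.subset_closure
  have hΦ := isRootSystem_rootsOf hRfin hconj
  rcases exists_regular_fixed_or hΦ r with ⟨y, hy, hreg⟩ | ⟨a, ha, hle⟩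
  -- An element of the Weyl group with a regular fixed vector preserves the positive roots, hence is
  -- trivial.
  · refine (hr.ne_one (hΦ.eq_one_of_mem_weylGroup hreg (w := r) ?_ fun b hb => ⟨?_, ?_⟩)).elim
    · rwa [weylGroup_rootsOf hR]
    · have : r ∈ weylGroup (rootsOf R) := by rwa [weylGroup_rootsOf hR]
      obtain ⟨L, hL, rfl⟩ := exists_list_of_mem_weylGroup this
      exact hΦ.list_prod_mem hL hb.1
    · rw [← hy, r.inner_map_map]
      exact hb.2
  · rw [hr.eq_of_fixed_le (isReflection_refl ha.1) hle]
    exact ha.2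

end RootsOfGroups

/-! ### Admissible triples: the intersection of `H` and `F`, and the reflections of `G` -/

namespace AdmissibleTriple

set_option linter.unusedSectionVars false

variable {V : Type*} [NormedAddCommGroup V] [InnerProductSpace ℝ V] (T : AdmissibleTriple V)

theorem conj_mem_H {g h : V ≃ₗᵢ[ℝ] V} (hg : g ∈ T.G) (hh : h ∈ T.H) : g * h * g⁻¹ ∈ T.H :=
  T.H_normal.conj_mem ⟨h, T.H_le hh⟩ hh ⟨g, hg⟩

theorem conj_mem_F {g h : V ≃ₗᵢ[ℝ] V} (hg : g ∈ T.G) (hh : h ∈ T.F) : g * h * g⁻¹ ∈ T.F :=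
  T.F_normal.conj_mem ⟨h, T.F_le hh⟩ hh ⟨g, hg⟩

theorem exists_mul {g : V ≃ₗᵢ[ℝ] V} (hg : g ∈ T.G) : ∃ h ∈ T.H, ∃ f ∈ T.F, g = h * f := by
  rw [← T.generated, Subgroup.sup_eq_closure] at hg
  have key : ∀ y ∈ (T.H : Set (V ≃ₗᵢ[ℝ] V)) ∪ T.F, ∀ g, (∃ h ∈ T.H, ∃ f ∈ T.F, g = h * f) →
      ∃ h ∈ T.H, ∃ f ∈ T.F, y * g = h * f := by
    rintro y (hy | hy) _ ⟨h, hh, f, hf, rfl⟩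
    · exact ⟨y * h, mul_mem hy hh, f, hf, by group⟩
    · exact ⟨y * h * y⁻¹, T.conj_mem_H (T.F_le hy) hh, y * f, mul_mem hy hf, by group⟩
  induction hg using Subgroup.closure_induction_left with
  | one => exact ⟨1, one_mem _, 1, one_mem _, by simp⟩
  | mul_left y hy g _ ih => exact key y hy g ih
  | inv_mul_cancel y hy g _ ih =>
    refine key y⁻¹ ?_ g ih
    rcases hy with hy | hy
    · exact Or.inl (inv_mem hy)
    · exact Or.inr (inv_mem hy)

/-- The reflections in `F`. -/
def refls : Set (V ≃ₗᵢ[ℝ] V) := {s | s ∈ T.F ∧ IsReflection s}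

/-- The coset in `G / H` of an element of `G`. -/
noncomputable def cos (g : V ≃ₗᵢ[ℝ] V) : T.Q := by
  classical
  -- The value outside `G` is arbitrary; a total function avoids membership proofs inside terms.
  exact if h : g ∈ T.G then QuotientGroup.mk ⟨g, h⟩ else 1

theorem cos_eq {g : V ≃ₗᵢ[ℝ] V} (hg : g ∈ T.G) : T.cos g = QuotientGroup.mk ⟨g, hg⟩ := dif_pos hg

theorem coset_eq_cos (s : T.F) : T.coset s = T.cos s := (T.cos_eq (T.F_le s.2)).symm

theorem cos_mul {g h : V ≃ₗᵢ[ℝ] V} (hg : g ∈ T.G) (hh : h ∈ T.G) :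
    T.cos (g * h) = T.cos g * T.cos h := by
  rw [T.cos_eq hg, T.cos_eq hh, T.cos_eq (mul_mem hg hh)]
  rfl

theorem cos_one : T.cos 1 = 1 := T.cos_eq (one_mem _)

theorem cos_inv {g : V ≃ₗᵢ[ℝ] V} (hg : g ∈ T.G) : T.cos g⁻¹ = (T.cos g)⁻¹ := by
  rw [T.cos_eq hg, T.cos_eq (inv_mem hg)]
  rfl

theorem cos_eq_one_iff {g : V ≃ₗᵢ[ℝ] V} (hg : g ∈ T.G) : T.cos g = 1 ↔ g ∈ T.H := by
  rw [T.cos_eq hg, QuotientGroup.eq_one_iff]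
  rfl

theorem cos_eq_cos_iff {g h : V ≃ₗᵢ[ℝ] V} (hg : g ∈ T.G) (hh : h ∈ T.G) :
    T.cos g = T.cos h ↔ g * h⁻¹ ∈ T.H := by
  rw [← T.cos_eq_one_iff (mul_mem hg (inv_mem hh)), T.cos_mul hg (inv_mem hh), T.cos_inv hh,
    mul_inv_eq_one]

theorem exists_cos (q : T.Q) : ∃ g ∈ T.G, T.cos g = q := by
  obtain ⟨⟨g, hg⟩, rfl⟩ := QuotientGroup.mk_surjective q
  exact ⟨g, hg, T.cos_eq hg⟩

theorem mem_reflections_iff {q : T.Q} : q ∈ T.reflections ↔ ∃ s ∈ T.refls, T.cos s = q := by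
  constructor
  · rintro ⟨s, hs, rfl⟩
    exact ⟨s, ⟨s.2, hs⟩, (T.coset_eq_cos s).symm⟩
  · rintro ⟨s, hs, rfl⟩
    exact ⟨⟨s, hs.1⟩, hs.2, T.coset_eq_cos ⟨s, hs.1⟩⟩

theorem cos_mem_reflections {s : V ≃ₗᵢ[ℝ] V} (hs : s ∈ T.refls) : T.cos s ∈ T.reflections :=
  T.mem_reflections_iff.2 ⟨s, hs, rfl⟩

theorem finite_Q : Finite T.Q := by
  have := T.finite
  infer_instance

variable [FiniteDimensional ℝ V]

theorem conj_mem_refls {g s : V ≃ₗᵢ[ℝ] V} (hg : g ∈ T.G) (hs : s ∈ T.refls) :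
    g * s * g⁻¹ ∈ T.refls :=
  ⟨T.conj_mem_F hg hs.1, hs.2.conj g⟩

theorem closure_refls : Subgroup.closure T.refls = T.F := T.F_reflection.generated

/-- The roots of the reflection group `F`. -/
def roots : Set V := rootsOf T.refls

theorem isRootSystem_roots : IsRootSystem T.roots := by
  have := T.F_reflection.finite
  exact isRootSystem_rootsOf ((Set.toFinite (T.F : Set _)).subset fun s hs => hs.1)
    fun r hr s hs => T.conj_mem_refls (T.F_le hr.1) hs

theorem weylGroup_roots : weylGroup T.roots = T.F :=
  (weylGroup_rootsOf fun _ hr => hr.2).trans T.closure_refls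

theorem map_mem_roots {g : V ≃ₗᵢ[ℝ] V} (hg : g ∈ T.G) {a : V} (ha : a ∈ T.roots) :
    g a ∈ T.roots :=
  ⟨by rw [g.norm_map, ha.1], by rw [refl_map g ha.1]; exact T.conj_mem_refls hg ha.2⟩

theorem map_mem_roots_iff {g : V ≃ₗᵢ[ℝ] V} (hg : g ∈ T.G) {a : V} :
    g a ∈ T.roots ↔ a ∈ T.roots := by
  refine ⟨fun h => ?_, T.map_mem_roots hg⟩
  have := T.map_mem_roots (inv_mem hg) h
  rwa [show g⁻¹ (g a) = a from g.symm_apply_apply a] at this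

theorem detHom_H {h : V ≃ₗᵢ[ℝ] V} (hh : h ∈ T.H) : detHom h = 1 := by
  rw [← T.H_rotation.generated] at hh
  induction hh using Subgroup.closure_induction with
  | mem x hx => exact hx.2.detHom_eq
  | one => exact map_one _
  | mul x y _ _ hx hy => rw [map_mul, hx, hy, mul_one]
  | inv x _ hx =>
    have h : detHom (x⁻¹ * x) = 1 := by rw [inv_mul_cancel, map_one]
    rwa [map_mul, hx, mul_one] at h

theorem isReflection_notMem_H {s : V ≃ₗᵢ[ℝ] V} (hs : IsReflection s) : s ∉ T.H := by
  intro h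
  have := T.detHom_H h
  rw [hs.detHom_eq] at this
  norm_num at this

/-- The subgroup generated by the products of two reflections in `F` that lie in `H`. -/
def pairSubgroup : Subgroup (V ≃ₗᵢ[ℝ] V) :=
  Subgroup.closure {g | g ∈ T.H ∧ ∃ r ∈ T.refls, ∃ s ∈ T.refls, g = r * s}

theorem pairSubgroup_le_H : T.pairSubgroup ≤ T.H := (Subgroup.closure_le _).2 fun _ h => h.1

theorem pairSubgroup_le_F : T.pairSubgroup ≤ T.F := by
  refine (Subgroup.closure_le _).2 ?_
  rintro _ ⟨-, r, hr, s, hs, rfl⟩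
  exact mul_mem hr.1 hs.1

theorem conj_mem_pairSubgroup {g n : V ≃ₗᵢ[ℝ] V} (hg : g ∈ T.G) (hn : n ∈ T.pairSubgroup) :
    g * n * g⁻¹ ∈ T.pairSubgroup := by
  induction hn using Subgroup.closure_induction with
  | mem x hx =>
    obtain ⟨hx, r, hr, s, hs, rfl⟩ := hx
    exact Subgroup.subset_closure ⟨T.conj_mem_H hg hx, _, T.conj_mem_refls hg hr, _,
      T.conj_mem_refls hg hs, by group⟩
  | one => simp
  | mul x y _ _ hx hy =>
    have : g * (x * y) * g⁻¹ = (g * x * g⁻¹) * (g * y * g⁻¹) := by group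
    rw [this]
    exact mul_mem hx hy
  | inv x _ hx =>
    have : g * x⁻¹ * g⁻¹ = (g * x * g⁻¹)⁻¹ := by group
    rw [this]
    exact inv_mem hx

/-- For a reflection `s`, the commutator of `h` and `s` is the product of the reflections `h * s *
h⁻¹` and `s`, and it lies in `H` by normality. The general case is an induction on words in
reflections. -/
theorem commutator_mem_pairSubgroup {h w : V ≃ₗᵢ[ℝ] V} (hh : h ∈ T.H) (hw : w ∈ T.F) :
    h * w * h⁻¹ * w⁻¹ ∈ T.pairSubgroup := by
  have hhG := T.H_le hh
  rw [← T.closure_refls] at hw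
  have key : ∀ s ∈ T.refls, ∀ w, h * w * h⁻¹ * w⁻¹ ∈ T.pairSubgroup →
      h * (s * w) * h⁻¹ * (s * w)⁻¹ ∈ T.pairSubgroup := by
    intro s hs w hw
    have hsG := T.F_le hs.1
    have : h * (s * w) * h⁻¹ * (s * w)⁻¹ =
        (h * s * h⁻¹ * s) * (s⁻¹ * s⁻¹) * (s * (h * w * h⁻¹ * w⁻¹) * s⁻¹) := by group
    rw [this, hs.2.inv_eq, hs.2.mul_self, mul_one]
    refine mul_mem (Subgroup.subset_closure ⟨?_, _, T.conj_mem_refls hhG hs, _, hs, rfl⟩) ?_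
    · have h1 := mul_mem hh (T.conj_mem_H hsG (inv_mem hh))
      rw [hs.2.inv_eq] at h1
      simpa only [mul_assoc] using h1
    · have h1 := T.conj_mem_pairSubgroup hsG hw
      rwa [hs.2.inv_eq] at h1
  induction hw using Subgroup.closure_induction_left with
  | one => simp
  | mul_left s hs w _ ih => exact key s hs w ih
  | inv_mul_cancel s hs w _ ih =>
    rw [hs.2.inv_eq]
    exact key s hs w ih

/-- The stabilizer of the chamber of `x`. -/
def chamberStabilizer (x : V) : Subgroup (V ≃ₗᵢ[ℝ] V) where
  carrier := {g | ∀ b, g b ∈ posRoots T.roots x ↔ b ∈ posRoots T.roots x}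
  one_mem' _ := Iff.rfl
  mul_mem' {g h} hg hh b := (hg (h b)).trans (hh b)
  inv_mem' {g} hg b := by
    rw [← hg (g⁻¹ b)]
    exact iff_of_eq (congrArg (· ∈ posRoots T.roots x) (g.apply_symm_apply b))

/-- Positivity can be tested on the fixed vector `y`, and `G` permutes the roots of `F` because `F`
is normal. -/
theorem mem_chamberStabilizer {x y : V} {g : V ≃ₗᵢ[ℝ] V} (hg : g ∈ T.G) (hgy : g y = y)
    (hxy : posRoots T.roots y = posRoots T.roots x) : g ∈ T.chamberStabilizer x := by
  intro b
  rw [← hxy]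
  refine and_congr (T.map_mem_roots_iff hg) ?_
  nth_rewrite 1 [← hgy]
  rw [g.inner_map_map]

theorem eq_one_of_mem_chamberStabilizer {x : V} (hx : IsRegular T.roots x) {f : V ≃ₗᵢ[ℝ] V}
    (hf : f ∈ T.F) (hfx : f ∈ T.chamberStabilizer x) : f = 1 :=
  T.isRootSystem_roots.eq_one_of_mem_weylGroup hx (T.weylGroup_roots ▸ hf) fun b hb => (hfx b).2 hb

theorem exists_conj_mem_chamberStabilizer {x : V} (hx : IsRegular T.roots x) {g : V ≃ₗᵢ[ℝ] V}
    (hg : g ∈ T.G) {y : V} (hgy : g y = y) (hy : IsRegular T.roots y) :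
    ∃ w ∈ T.F, w * g * w⁻¹ ∈ T.chamberStabilizer x := by
  have hfin := T.F_reflection.finite
  obtain ⟨w, hw, hwy⟩ := T.isRootSystem_roots.exists_mem_chamber hx
    (by rw [T.weylGroup_roots]; exact hfin) hy
  rw [T.weylGroup_roots] at hw
  refine ⟨w, hw, T.mem_chamberStabilizer (mul_mem (mul_mem (T.F_le hw) hg) (inv_mem (T.F_le hw)))
    (y := w y) ?_ hwy⟩
  change w (g (w.symm (w y))) = w y
  rw [w.symm_apply_apply, hgy]

/-- It suffices to treat a rotation. With a regular fixed vector, it stabilizes the chamber after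
conjugation by some `w` in `F`, and the error is a commutator of `H` with `F`. If its fixed space
lies in the mirror of `s`, then `h * s` is a reflection, which is in `F` by admissibility, and `h =
(h * s) * s`. -/
theorem exists_mul_chamberStabilizer {x : V} (hx : IsRegular T.roots x) {h : V ≃ₗᵢ[ℝ] V}
    (hh : h ∈ T.H) : ∃ n ∈ T.pairSubgroup, ∃ c ∈ T.chamberStabilizer x, h = n * c := by
  rw [← T.H_rotation.generated] at hh
  induction hh using Subgroup.closure_induction with
  | mem h hh =>
    obtain ⟨hh, hrot⟩ := hh
    rcases exists_regular_fixed_or T.isRootSystem_roots h with ⟨y, hy, hreg⟩ | ⟨a, ha, hle⟩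
    · obtain ⟨w, hw, hc⟩ := T.exists_conj_mem_chamberStabilizer hx (T.H_le hh) hy hreg
      refine ⟨h * w * h⁻¹ * w⁻¹, T.commutator_mem_pairSubgroup hh hw, _, hc, by group⟩
    · have hs := ha.2
      have hr := hrot.mul_isReflection hs.2 hle
      refine ⟨h, Subgroup.subset_closure ⟨hh, _, ⟨T.mem_F h hh _ hs.1 hs.2 hr, hr⟩, _, hs, ?_⟩, 1,
        one_mem _, by simp⟩
      rw [mul_assoc, refl_mul_self, mul_one]
  | one => exact ⟨1, one_mem _, 1, one_mem _, by simp⟩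
  | mul g h hg hh ihg ihh =>
    rw [T.H_rotation.generated] at hg hh
    obtain ⟨n, hn, c, hc, rfl⟩ := ihg
    obtain ⟨m, hm, d, hd, rfl⟩ := ihh
    have hcG : c ∈ T.G := by
      have := mul_mem (inv_mem (T.H_le (T.pairSubgroup_le_H hn))) (T.H_le hg)
      rwa [inv_mul_cancel_left] at this
    exact ⟨n * (c * m * c⁻¹), mul_mem hn (T.conj_mem_pairSubgroup hcG hm), c * d, mul_mem hc hd,
      by group⟩
  | inv g hg ih =>
    rw [T.H_rotation.generated] at hg
    obtain ⟨n, hn, c, hc, rfl⟩ := ih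
    have hcG : c ∈ T.G := by
      have := mul_mem (inv_mem (T.H_le (T.pairSubgroup_le_H hn))) (T.H_le hg)
      rwa [inv_mul_cancel_left] at this
    have := T.conj_mem_pairSubgroup (inv_mem hcG) (inv_mem hn)
    rw [inv_inv] at this
    exact ⟨_, this, c⁻¹, inv_mem hc, by group⟩

/-- In the decomposition of `f`, the factor that stabilizes the chamber lies in `F`, so it is
trivial. Thus the kernel of `F → G / H` is generated by the coincidences between cosets of
reflections, and no further relations arise in the quotient. -/
theorem mem_pairSubgroup {f : V ≃ₗᵢ[ℝ] V} (hH : f ∈ T.H) (hF : f ∈ T.F) : f ∈ T.pairSubgroup := by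
  obtain ⟨x, hx⟩ := T.isRootSystem_roots.exists_isRegular
  obtain ⟨n, hn, c, hc, rfl⟩ := T.exists_mul_chamberStabilizer hx hH
  have hcF : c ∈ T.F := by
    have := mul_mem (inv_mem (T.pairSubgroup_le_F hn)) hF
    rwa [inv_mul_cancel_left] at this
  rwa [T.eq_one_of_mem_chamberStabilizer hx hcF hc, mul_one]

/-- All reflections in `G` belong to `F`. -/
theorem mem_refls {r : V ≃ₗᵢ[ℝ] V} (hr : r ∈ T.G) (hrefl : IsReflection r) : r ∈ T.refls := by
  refine ⟨?_, hrefl⟩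
  rcases exists_regular_fixed_or T.isRootSystem_roots r with ⟨y, hy, hreg⟩ | ⟨a, ha, hle⟩
  · exfalso
    obtain ⟨x, hx⟩ := T.isRootSystem_roots.exists_isRegular
    obtain ⟨w, hw, hc⟩ := T.exists_conj_mem_chamberStabilizer hx hr hy hreg
    have hG := mul_mem (mul_mem (T.F_le hw) hr) (inv_mem (T.F_le hw))
    obtain ⟨h, hh, f, hf, hwf⟩ := T.exists_mul hG
    obtain ⟨n, hn, c, hcs, rfl⟩ := T.exists_mul_chamberStabilizer hx hh
    have hcH : c ∈ T.H := by
      have := mul_mem (inv_mem (T.pairSubgroup_le_H hn)) hh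
      rwa [inv_mul_cancel_left] at this
    -- This element of `F` stabilizes the chamber, so the conjugate of `r` equals `c`, an element of
    -- `H` with determinant one.
    have h1 : c⁻¹ * (w * r * w⁻¹) = (c⁻¹ * n * c⁻¹⁻¹) * f := by rw [hwf]; group
    have h2 : c⁻¹ * (w * r * w⁻¹) ∈ T.F := by
      rw [h1]
      exact mul_mem (T.conj_mem_F (inv_mem (T.H_le hcH)) (T.pairSubgroup_le_F hn)) hf
    have h3 := T.eq_one_of_mem_chamberStabilizer hx h2 (mul_mem (inv_mem hcs) hc)
    rw [inv_mul_eq_one] at h3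
    exact T.isReflection_notMem_H (hrefl.conj w) (h3 ▸ hcH)
  · rw [hrefl.eq_of_fixed_le (isReflection_refl ha.1) hle]
    exact ha.2.1

/-! The quotient `G / H` is a Coxeter group: it is defined by the relations between its reflections
that express their orders and their conjugates. -/

theorem reflections_mul_self {p : T.Q} (hp : p ∈ T.reflections) : p * p = 1 := by
  obtain ⟨s, hs, rfl⟩ := T.mem_reflections_iff.1 hp
  rw [← T.cos_mul (T.F_le hs.1) (T.F_le hs.1), hs.2.mul_self, T.cos_one]

theorem reflections_inv {p : T.Q} (hp : p ∈ T.reflections) : p⁻¹ = p :=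
  inv_eq_of_mul_eq_one_left (T.reflections_mul_self hp)

theorem reflections_ne_one {p : T.Q} (hp : p ∈ T.reflections) : p ≠ 1 := by
  obtain ⟨s, hs, rfl⟩ := T.mem_reflections_iff.1 hp
  rw [Ne, T.cos_eq_one_iff (T.F_le hs.1)]
  exact T.isReflection_notMem_H hs.2

theorem conj_mem_reflections (q : T.Q) {p : T.Q} (hp : p ∈ T.reflections) :
    q * p * q⁻¹ ∈ T.reflections := by
  obtain ⟨s, hs, rfl⟩ := T.mem_reflections_iff.1 hp
  obtain ⟨g, hg, rfl⟩ := T.exists_cos q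
  have hsG := T.F_le hs.1
  rw [← T.cos_inv hg, ← T.cos_mul hg hsG, ← T.cos_mul (mul_mem hg hsG) (inv_mem hg)]
  exact T.cos_mem_reflections (T.conj_mem_refls hg hs)

theorem mul_mul_mem_reflections {q p : T.Q} (hq : q ∈ T.reflections) (hp : p ∈ T.reflections) :
    q * p * q ∈ T.reflections := by
  have := T.conj_mem_reflections q hp
  rwa [T.reflections_inv hq] at this

theorem closure_reflections : Subgroup.closure T.reflections = ⊤ := by
  rw [Subgroup.eq_top_iff']
  intro q
  obtain ⟨g, hg, rfl⟩ := T.exists_cos q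
  obtain ⟨h, hh, f, hf, rfl⟩ := T.exists_mul hg
  rw [T.cos_mul (T.H_le hh) (T.F_le hf), (T.cos_eq_one_iff (T.H_le hh)).2 hh, one_mul]
  have hf' := hf
  rw [← T.closure_refls] at hf'
  clear hg
  induction hf' using Subgroup.closure_induction with
  | mem s hs => exact Subgroup.subset_closure (T.cos_mem_reflections hs)
  | one => rw [T.cos_one]; exact one_mem _
  | mul x y hx hy ihx ihy =>
    rw [T.closure_refls] at hx hy
    rw [T.cos_mul (T.F_le hx) (T.F_le hy)]
    exact mul_mem (ihx hx) (ihy hy)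
  | inv x hx ihx =>
    rw [T.closure_refls] at hx
    rw [T.cos_inv (T.F_le hx)]
    exact inv_mem (ihx hx)

theorem hom_ext {Q' : Type*} [Monoid Q'] {f g : T.Q →* Q'} (h : ∀ p ∈ T.reflections, f p = g p) :
    f = g :=
  MonoidHom.eq_of_eqOn_dense T.closure_reflections h

/-- The map extends to the Weyl group `F` by the presentation of `F`. The extension kills `H ∩ F`,
because a generator `r * s` in `H` has `cos r = cos s`. Writing elements of `G` as products from `H`
and `F` and discarding the factor in `H` gives the homomorphism on the quotient. -/
theorem exists_lift {Q' : Type*} [Group Q'] (φ : T.Q → Q')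
    (h1 : ∀ p ∈ T.reflections, φ p * φ p = 1)
    (h2 : ∀ p ∈ T.reflections, ∀ q ∈ T.reflections, φ (p * q * p) = φ p * φ q * φ p) :
    ∃ f : T.Q →* Q', ∀ p ∈ T.reflections, f p = φ p := by
  obtain ⟨x, hx⟩ := T.isRootSystem_roots.exists_isRegular
  have hcompat : IsCompatible T.roots fun a => φ (T.cos (refl a)) := by
    refine ⟨fun a _ => by simp only [refl_neg], fun a ha => h1 _ (T.cos_mem_reflections ha.2),
      fun a ha b hb => ?_⟩
    have haG := T.F_le ha.2.1
    have hbG := T.F_le hb.2.1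
    rw [refl_map _ hb.1, refl_inv, T.cos_mul (mul_mem haG hbG) haG, T.cos_mul haG hbG]
    exact h2 _ (T.cos_mem_reflections ha.2) _ (T.cos_mem_reflections hb.2)
  obtain ⟨f, hfmul, hf⟩ := T.isRootSystem_roots.exists_extension hx hcompat
  rw [T.weylGroup_roots] at hfmul
  have hfs : ∀ s ∈ T.refls, f s = φ (T.cos s) := by
    intro s hs
    obtain ⟨u, hu, rfl⟩ := hs.2.exists_refl
    exact hf u ⟨hu, hs⟩
  have hf1 : f 1 = 1 := by
    have := hfmul 1 (one_mem _) 1 (one_mem _)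
    rwa [mul_one, left_eq_mul] at this
  have hfN : ∀ n ∈ T.pairSubgroup, f n = 1 := by
    intro n hn
    induction hn using Subgroup.closure_induction with
    | mem n hn =>
      obtain ⟨hn, r, hr, s, hs, rfl⟩ := hn
      have : T.cos r = T.cos s := by
        rw [T.cos_eq_cos_iff (T.F_le hr.1) (T.F_le hs.1), hs.2.inv_eq]
        exact hn
      rw [hfmul r hr.1 s hs.1, hfs r hr, hfs s hs, this]
      exact h1 _ (T.cos_mem_reflections hs)
    | one => exact hf1
    | mul x y hx hy ihx ihy =>
      rw [hfmul x (T.pairSubgroup_le_F hx) y (T.pairSubgroup_le_F hy), ihx, ihy, mul_one]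
    | inv x hx ihx =>
      have hxF := T.pairSubgroup_le_F hx
      have := hfmul x hxF x⁻¹ (inv_mem hxF)
      rwa [mul_inv_cancel, hf1, ihx, one_mul, eq_comm] at this
  choose! a ha b hb hab using fun (g : V ≃ₗᵢ[ℝ] V) (hg : g ∈ T.G) => T.exists_mul hg
  -- The factors in `F` of two decompositions differ by an element of `H ∩ F`.
  have hwd : ∀ h ∈ T.H, ∀ w ∈ T.F, ∀ h' ∈ T.H, ∀ w' ∈ T.F, h * w = h' * w' → f w = f w' := by
    intro h hh w hw h' hh' w' hw' heq
    have h3 : w * w'⁻¹ = h⁻¹ * h' := by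
      rw [mul_inv_eq_iff_eq_mul, mul_assoc, ← heq, inv_mul_cancel_left]
    have h4 : w * w'⁻¹ ∈ T.H := by rw [h3]; exact mul_mem (inv_mem hh) hh'
    have hF := mul_mem hw (inv_mem hw')
    have h5 := hfN _ (T.mem_pairSubgroup h4 hF)
    have h6 := hfmul (w * w'⁻¹) hF w' hw'
    rwa [inv_mul_cancel_right, h5, one_mul] at h6
  have hmul : ∀ g ∈ T.G, ∀ g' ∈ T.G, f (b (g * g')) = f (b g) * f (b g') := by
    intro g hg g' hg'
    rw [← hfmul _ (hb g hg) _ (hb g' hg')]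
    refine hwd _ (ha _ (mul_mem hg hg')) _ (hb _ (mul_mem hg hg'))
      (a g * (b g * a g' * (b g)⁻¹)) (mul_mem (ha g hg) (T.conj_mem_H (T.F_le (hb g hg)) (ha g' hg')))
      _ (mul_mem (hb g hg) (hb g' hg')) ?_
    rw [← hab _ (mul_mem hg hg')]
    nth_rewrite 1 [hab g hg, hab g' hg']
    group
  let F : T.G →* Q' := MonoidHom.mk' (fun g => f (b g)) fun g g' => hmul g g.2 g' g'.2
  have hFH : T.H.subgroupOf T.G ≤ F.ker := by
    intro h hh
    rw [MonoidHom.mem_ker]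
    change f (b h) = 1
    rw [← hf1]
    exact hwd _ (ha _ h.2) _ (hb _ h.2) h hh 1 (one_mem _) (by rw [← hab _ h.2, mul_one])
  refine ⟨QuotientGroup.lift _ F hFH, fun p hp => ?_⟩
  obtain ⟨s, hs, rfl⟩ := T.mem_reflections_iff.1 hp
  have hsG := T.F_le hs.1
  rw [← hfs s hs]
  nth_rewrite 1 [T.cos_eq hsG]
  change f (b s) = f s
  exact hwd _ (ha _ hsG) _ (hb _ hsG) 1 (one_mem _) s hs.1 (by rw [← hab _ hsG, one_mul])

end AdmissibleTriple
end ReflRot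

namespace ReflRot

/-! ### Irreducible components of `G / H`: projections, signs and the direct product decomposition
-/

namespace AdmissibleTriple

set_option linter.unusedSectionVars false

variable {V : Type*} [NormedAddCommGroup V] [InnerProductSpace ℝ V] (T : AdmissibleTriple V)

/-- The irreducible component that contains a given reflection. -/
def compOf (p : T.reflections) : T.Component :=
  ⟨Subgroup.closure ((fun a : T.reflections => (a : T.Q)) ''
    (T.reflectionGraph.connectedComponentMk p).supp), _, rfl⟩

theorem mem_compOf (p : T.reflections) : (p : T.Q) ∈ (T.compOf p).1 :=
  Subgroup.subset_closure ⟨p, rfl, rfl⟩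

variable [FiniteDimensional ℝ V] {T}

/-- Reflections in `X` commute with those outside `X`, so setting the map to `1` outside `X` creates
no conflict with the conjugation relations. -/
theorem exists_lift_on {Q' : Type*} [Group Q'] (X : Set T.Q)
    (hX : ∀ p ∈ T.reflections, ∀ q ∈ T.reflections, ¬ Commute p q → p ∈ X → q ∈ X) (ψ : T.Q → Q')
    (h1 : ∀ p ∈ T.reflections, p ∈ X → ψ p * ψ p = 1)
    (h2 : ∀ p ∈ T.reflections, p ∈ X → ∀ q ∈ T.reflections, q ∈ X →
      ψ (p * q * p) = ψ p * ψ q * ψ p) :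
    ∃ f : T.Q →* Q', (∀ p ∈ T.reflections, p ∈ X → f p = ψ p) ∧
      ∀ p ∈ T.reflections, p ∉ X → f p = 1 := by
  classical
  have hcomm : ∀ p ∈ T.reflections, ∀ q : T.Q, Commute p q → p * q * p = q := by
    intro p hp q hpq
    rw [hpq.eq, mul_assoc, T.reflections_mul_self hp, mul_one]
  have hconj : ∀ p ∈ T.reflections, ∀ q ∈ T.reflections, q ∈ X → p * q * p ∈ X := by
    intro p hp q hq hqX
    by_cases hpq : Commute p q
    · rwa [hcomm p hp q hpq]
    · have hpX := hX q hq p hp (fun h => hpq h.symm) hqX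
      refine hX p hp _ (T.mul_mul_mem_reflections hp hq) (fun h => hpq ?_) hpX
      have h3 : q = p * (p * q * p) * p := by
        simp only [mul_assoc, T.reflections_mul_self hp, mul_one]
        rw [← mul_assoc, T.reflections_mul_self hp, one_mul]
      rw [h3]
      exact ((Commute.refl p).mul_right h).mul_right (Commute.refl p)
  obtain ⟨f, hf⟩ := T.exists_lift (fun p => if p ∈ X then ψ p else 1) (by
    intro p hp
    split_ifs with hpX
    · exact h1 p hp hpX
    · exact one_mul 1) (by
    intro p hp q hq
    by_cases hqX : q ∈ X
    · rw [if_pos hqX, if_pos (hconj p hp q hq hqX)]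
      by_cases hpX : p ∈ X
      · rw [if_pos hpX, h2 p hp hpX q hq hqX]
      · rw [if_neg hpX, one_mul, mul_one, hcomm p hp q]
        by_contra h
        exact hpX (hX q hq p hp (fun h' => h h'.symm) hqX)
    · have hn : p * q * p ∉ X := by
        intro h
        have := hconj p hp _ (T.mul_mul_mem_reflections hp hq) h
        simp only [mul_assoc, T.reflections_mul_self hp, mul_one] at this
        rw [← mul_assoc, T.reflections_mul_self hp, one_mul] at this
        exact hqX this
      rw [if_neg hqX, if_neg hn, mul_one]
      split_ifs with hpX
      · exact (h1 p hp hpX).symm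
      · exact (one_mul 1).symm)
  refine ⟨f, fun p hp hpX => ?_, fun p hp hpX => ?_⟩
  · rw [hf p hp, if_pos hpX]
  · rw [hf p hp, if_neg hpX]

theorem Component.exists_compOf (K : T.Component) : ∃ p : T.reflections, T.compOf p = K := by
  obtain ⟨K, c, rfl⟩ := K
  induction c using SimpleGraph.ConnectedComponent.ind with
  | h p => exact ⟨p, rfl⟩

theorem compOf_eq_of_not_commute {p q : T.reflections} (h : ¬ Commute (p : T.Q) (q : T.Q)) :
    T.compOf p = T.compOf q := by
  have hadj : T.reflectionGraph.Adj p q := h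
  unfold compOf
  simp only [SimpleGraph.ConnectedComponent.sound hadj.reachable]

/-- The homomorphism that fixes the reflections connected to `p` and kills all others is the
identity on the subgroup generated by the former, so this subgroup contains no other reflections. -/
theorem mem_compOf_iff {p q : T.reflections} :
    (q : T.Q) ∈ (T.compOf p).1 ↔ T.compOf q = T.compOf p := by
  refine ⟨fun h => ?_, fun h => h ▸ T.mem_compOf q⟩
  let X : Set T.Q := {a | ∃ h : a ∈ T.reflections, T.reflectionGraph.connectedComponentMk ⟨a, h⟩ =
    T.reflectionGraph.connectedComponentMk p}
  obtain ⟨f, hf1, hf2⟩ := T.exists_lift_on X (by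
    rintro a ha b hb hab ⟨_, h⟩
    refine ⟨hb, ?_⟩
    rw [← h]
    have hadj : T.reflectionGraph.Adj ⟨a, ha⟩ ⟨b, hb⟩ := hab
    exact (SimpleGraph.ConnectedComponent.sound hadj.reachable).symm) id
    (fun a ha _ => T.reflections_mul_self ha) (fun _ _ _ _ _ _ => rfl)
  have hfix : ∀ a ∈ (T.compOf p).1, f a = a := by
    intro a ha
    refine MonoidHom.eqOn_closure (f := f) (g := MonoidHom.id _) ?_ ha
    rintro _ ⟨b, hb, rfl⟩
    exact hf1 b b.2 ⟨b.2, hb⟩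
  by_contra hne
  have hqX : (q : T.Q) ∉ X := by
    rintro ⟨_, h⟩
    apply hne
    unfold compOf
    simp only [← h]
  have := hf2 q q.2 hqX
  rw [hfix q h] at this
  exact T.reflections_ne_one q.2 this

theorem Component.mem_iff {K : T.Component} {p : T.Q} (hp : p ∈ T.reflections) :
    p ∈ K.1 ↔ T.compOf ⟨p, hp⟩ = K := by
  obtain ⟨q, rfl⟩ := K.exists_compOf
  exact mem_compOf_iff (q := ⟨p, hp⟩)

theorem Component.exists_mem (K : T.Component) : ∃ p ∈ T.reflections, p ∈ K.1 := by
  obtain ⟨p, rfl⟩ := K.exists_compOf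
  exact ⟨p, p.2, T.mem_compOf p⟩

theorem Component.eq_of_mem {K L : T.Component} {p : T.Q} (hp : p ∈ T.reflections)
    (hK : p ∈ K.1) (hL : p ∈ L.1) : K = L := by
  rw [Component.mem_iff hp] at hK hL
  rw [← hK, ← hL]

theorem Component.mem_of_not_commute {K : T.Component} {p q : T.Q} (hp : p ∈ T.reflections)
    (hq : q ∈ T.reflections) (hpq : ¬ Commute p q) (hK : p ∈ K.1) : q ∈ K.1 := by
  rw [Component.mem_iff hp] at hK
  rw [Component.mem_iff hq, ← hK]
  exact (compOf_eq_of_not_commute (p := ⟨p, hp⟩) (q := ⟨q, hq⟩) hpq).symm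

theorem Component.closure_eq (K : T.Component) :
    Subgroup.closure {p | p ∈ T.reflections ∧ p ∈ K.1} = K.1 := by
  refine le_antisymm ((Subgroup.closure_le _).2 fun p hp => hp.2) ?_
  obtain ⟨p, rfl⟩ := K.exists_compOf
  refine (Subgroup.closure_le _).2 ?_
  rintro _ ⟨b, hb, rfl⟩
  exact Subgroup.subset_closure ⟨b.2, Subgroup.subset_closure ⟨b, hb, rfl⟩⟩

/-- Two homomorphisms on a component that agree on its reflections are equal. -/
theorem Component.hom_ext {K : T.Component} {Q' : Type*} [Monoid Q'] {f g : K.1 →* Q'}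
    (h : ∀ p : K.1, (p : T.Q) ∈ T.reflections → f p = g p) : f = g := by
  have hcl : Subgroup.closure {p : K.1 | (p : T.Q) ∈ T.reflections} = ⊤ := by
    apply Subgroup.map_injective K.1.subtype_injective
    rw [MonoidHom.map_closure, ← MonoidHom.range_eq_map, Subgroup.range_subtype]
    refine Eq.trans ?_ K.closure_eq
    congr 1
    ext p
    constructor
    · rintro ⟨q, hq, rfl⟩
      exact ⟨hq, q.2⟩
    · rintro ⟨hp, hpK⟩
      exact ⟨⟨p, hpK⟩, hp, rfl⟩
  exact MonoidHom.eq_of_eqOn_dense hcl h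

/-- A property of one reflection of a component that is inherited by the reflections that do not
commute with it holds for all reflections of the component. -/
theorem Component.induction {K : T.Component} {P : T.Q → Prop} {p : T.Q} (hp : p ∈ T.reflections)
    (hpK : p ∈ K.1) (hP : P p)
    (hstep : ∀ a ∈ T.reflections, a ∈ K.1 → ∀ b ∈ T.reflections, b ∈ K.1 → ¬ Commute a b → P a → P b)
    {q : T.Q} (hq : q ∈ T.reflections) (hqK : q ∈ K.1) : P q := by
  obtain ⟨f, hf1, hf2⟩ := T.exists_lift_on {a | a ∈ K.1 ∧ P a}
    (fun a ha b hb hab h =>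
      have hbK := Component.mem_of_not_commute ha hb hab h.1
      ⟨hbK, hstep a ha h.1 b hb hbK hab h.2⟩) id
    (fun a ha _ => T.reflections_mul_self ha) (fun _ _ _ _ _ _ => rfl)
  by_contra hq'
  let C := T.reflectionGraph.connectedComponentMk ⟨p, hp⟩
  have hreach : ∀ a b : T.reflections, T.reflectionGraph.Reachable a b → (a : T.Q) ∈ K.1 → P a →
      (b : T.Q) ∈ K.1 ∧ P b := by
    rintro a b ⟨w⟩ ha hPa
    induction w with
    | nil => exact ⟨ha, hPa⟩
    | cons hadj _ ih =>
      have hb := Component.mem_of_not_commute (Subtype.prop _) (Subtype.prop _) hadj ha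
      exact ih hb (hstep _ (Subtype.prop _) ha _ (Subtype.prop _) hb hadj hPa)
  -- All generators of `K` are reached from `p`, so `f` is the identity on `K`; but `f` kills every
  -- reflection without the property.
  have hsub : K.1 ≤ (f.eqLocus (MonoidHom.id _)) := by
    have hK := (Component.mem_iff hp).1 hpK
    rw [← hK]
    refine (Subgroup.closure_le _).2 ?_
    rintro _ ⟨b, hb, rfl⟩
    have := hreach ⟨p, hp⟩ b (SimpleGraph.ConnectedComponent.exact hb.symm) hpK hP
    exact hf1 b b.2 this
  have h1 : f q = q := hsub hqK
  rw [hf2 q hq fun h => hq' h.2] at h1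
  exact T.reflections_ne_one hq h1.symm

theorem IsTrivial.eq {K : T.Component} (hK : T.IsTrivial K) {p q : T.Q} (hp : p ∈ T.reflections)
    (hpK : p ∈ K.1) (hq : q ∈ T.reflections) (hqK : q ∈ K.1) : p = q := by
  obtain ⟨r, hr, hKr⟩ := hK
  have key : ∀ a ∈ T.reflections, a ∈ K.1 → a = r := by
    intro a ha haK
    rw [hKr] at haK
    obtain ⟨n, rfl⟩ := Subgroup.mem_zpowers_iff.1 haK
    rcases Int.even_or_odd' n with ⟨m, rfl | rfl⟩
    · exact (T.reflections_ne_one ha (by rw [zpow_mul, zpow_two, T.reflections_mul_self hr,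
        one_zpow])).elim
    · rw [zpow_add, zpow_mul, zpow_two, T.reflections_mul_self hr, one_zpow, one_mul, zpow_one]
  rw [key p hp hpK, key q hq hqK]

theorem isTrivial_of_unique {K : T.Component} {p : T.Q} (hp : p ∈ T.reflections)
    (h : ∀ q ∈ T.reflections, q ∈ K.1 → q = p) : T.IsTrivial K := by
  refine ⟨p, hp, ?_⟩
  obtain ⟨q, hq, hqK⟩ := K.exists_mem
  have hpK : p ∈ K.1 := h q hq hqK ▸ hqK
  rw [← K.closure_eq, Subgroup.zpowers_eq_closure]
  congr 1
  ext q
  exact ⟨fun hq => h q hq.1 hq.2, fun hq => by rw [Set.mem_singleton_iff.1 hq]; exact ⟨hp, hpK⟩⟩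

theorem exists_not_commute {K : T.Component} (hK : ¬ T.IsTrivial K) {p : T.Q}
    (hp : p ∈ T.reflections) (hpK : p ∈ K.1) :
    ∃ q ∈ T.reflections, q ∈ K.1 ∧ ¬ Commute p q := by
  by_contra! h
  refine hK (isTrivial_of_unique hp fun q hq hqK => ?_)
  refine Component.induction (P := fun a => a = p) hp hpK rfl ?_ hq hqK
  rintro a _ _ b hb hbK hab rfl
  exact (hab (h b hb hbK)).elim

variable (T) in
theorem exists_proj (K : T.Component) : ∃ f : T.Q →* T.Q,
    (∀ p ∈ T.reflections, p ∈ K.1 → f p = p) ∧ ∀ p ∈ T.reflections, p ∉ K.1 → f p = 1 :=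
  T.exists_lift_on (K.1 : Set T.Q) (fun _ hp _ hq h hK => Component.mem_of_not_commute hp hq h hK) id
    (fun _ ha _ => T.reflections_mul_self ha) (fun _ _ _ _ _ _ => rfl)

/-- The projection of `G / H` onto a component. -/
noncomputable def projComp (K : T.Component) : T.Q →* T.Q := (T.exists_proj K).choose

theorem projComp_of_mem {K : T.Component} {p : T.Q} (hp : p ∈ T.reflections) (hK : p ∈ K.1) :
    projComp K p = p := (T.exists_proj K).choose_spec.1 p hp hK

theorem projComp_of_notMem {K : T.Component} {p : T.Q} (hp : p ∈ T.reflections) (hK : p ∉ K.1) :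
    projComp K p = 1 := (T.exists_proj K).choose_spec.2 p hp hK

theorem projComp_mem (K : T.Component) (q : T.Q) : projComp K q ∈ K.1 := by
  have h : (⊤ : Subgroup T.Q) ≤ K.1.comap (projComp K) := by
    rw [← T.closure_reflections]
    refine (Subgroup.closure_le _).2 fun p hp => ?_
    by_cases hK : p ∈ K.1
    · change projComp K p ∈ K.1
      rwa [projComp_of_mem hp hK]
    · change projComp K p ∈ K.1
      rw [projComp_of_notMem hp hK]
      exact one_mem _
  exact h (Subgroup.mem_top q)

theorem projComp_eq_self {K : T.Component} {q : T.Q} (hq : q ∈ K.1) : projComp K q = q := by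
  rw [← K.closure_eq] at hq
  exact MonoidHom.eqOn_closure (f := projComp K) (g := MonoidHom.id _)
    (fun p hp => projComp_of_mem hp.1 hp.2) hq

variable (T) in
theorem exists_sign (K : T.Component) : ∃ f : T.Q →* ℤˣ,
    (∀ p ∈ T.reflections, p ∈ K.1 → f p = -1) ∧ ∀ p ∈ T.reflections, p ∉ K.1 → f p = 1 :=
  T.exists_lift_on (K.1 : Set T.Q) (fun _ hp _ hq h hK => Component.mem_of_not_commute hp hq h hK)
    (fun _ => -1) (fun _ _ _ => by simp) (fun _ _ _ _ _ _ => by simp)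

/-- The sign character of a component. -/
noncomputable def signComp (K : T.Component) : T.Q →* ℤˣ := (T.exists_sign K).choose

theorem signComp_of_mem {K : T.Component} {p : T.Q} (hp : p ∈ T.reflections) (hK : p ∈ K.1) :
    signComp K p = -1 := (T.exists_sign K).choose_spec.1 p hp hK

theorem Component.commute {K L : T.Component} (hKL : K ≠ L) {a b : T.Q} (ha : a ∈ K.1)
    (hb : b ∈ L.1) : Commute a b := by
  rw [← K.closure_eq] at ha
  rw [← L.closure_eq] at hb
  have h1 : Subgroup.closure {p | p ∈ T.reflections ∧ p ∈ K.1} ≤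
      Subgroup.centralizer {p | p ∈ T.reflections ∧ p ∈ L.1} := by
    refine (Subgroup.closure_le _).2 fun p hp => ?_
    rw [SetLike.mem_coe, Subgroup.mem_centralizer_iff]
    intro q hq
    by_contra h
    exact hKL (Component.eq_of_mem hp.1 hp.2
      (Component.mem_of_not_commute hq.1 hp.1 h hq.2))
  have h2 : Subgroup.closure {p | p ∈ T.reflections ∧ p ∈ L.1} ≤ Subgroup.centralizer {a} := by
    refine (Subgroup.closure_le _).2 fun q hq => ?_
    rw [SetLike.mem_coe, Subgroup.mem_centralizer_singleton_iff]
    exact Subgroup.mem_centralizer_iff.1 (h1 ha) q hq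
  exact (Subgroup.mem_centralizer_singleton_iff.1 (h2 hb)).symm

/-- Different components commute, so an element can be rebuilt by multiplying its projections; this
is clear for reflections, and they generate. -/
theorem eq_of_projComp_eq {a b : T.Q} (h : ∀ K : T.Component, projComp K a = projComp K b) :
    a = b := by
  classical
  have := T.finite_Q
  have := Fintype.ofFinite T.Component
  have hcomm : Pairwise fun K L : T.Component => ∀ x y : T.Q, x ∈ K.1 → y ∈ L.1 → Commute x y :=
    fun K L hKL x y hx hy => Component.commute hKL hx hy
  let P : T.Q →* (∀ K : T.Component, K.1) :=
    MonoidHom.pi fun K => (projComp K).codRestrict K.1 (projComp_mem K)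
  have hid : (Subgroup.noncommPiCoprod hcomm).comp P = MonoidHom.id _ := by
    refine T.hom_ext fun p hp => ?_
    have : P p = Pi.mulSingle (T.compOf ⟨p, hp⟩) ⟨p, T.mem_compOf ⟨p, hp⟩⟩ := by
      ext K
      by_cases hK : K = T.compOf ⟨p, hp⟩
      · subst hK
        rw [Pi.mulSingle_eq_same]
        exact projComp_of_mem hp (T.mem_compOf ⟨p, hp⟩)
      · rw [Pi.mulSingle_eq_of_ne hK]
        exact projComp_of_notMem hp fun h => hK ((Component.mem_iff hp).1 h).symm
    rw [MonoidHom.comp_apply, this, Subgroup.noncommPiCoprod_mulSingle]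
    rfl
  have hP : P a = P b := funext fun K => Subtype.ext (h K)
  have ha := DFunLike.congr_fun hid a
  have hb := DFunLike.congr_fun hid b
  rw [MonoidHom.comp_apply, MonoidHom.id_apply] at ha hb
  rw [← ha, ← hb, hP]

theorem projComp_projComp {K L : T.Component} (hKL : K ≠ L) (q : T.Q) :
    projComp K (projComp L q) = 1 := by
  refine DFunLike.congr_fun (T.hom_ext (f := (projComp K).comp (projComp L)) (g := 1)
    fun p hp => ?_) q
  rw [MonoidHom.comp_apply, MonoidHom.one_apply]
  by_cases hL : p ∈ L.1
  · rw [projComp_of_mem hp hL, projComp_of_notMem hp fun hK => hKL (Component.eq_of_mem hp hK hL)]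
  · rw [projComp_of_notMem hp hL, map_one]

theorem mem_of_projComp_eq_one {K : T.Component} {a : T.Q}
    (h : ∀ L : T.Component, L ≠ K → projComp L a = 1) : a ∈ K.1 := by
  have : a = projComp K a := by
    refine eq_of_projComp_eq fun L => ?_
    by_cases hL : L = K
    · subst hL
      rw [projComp_eq_self (projComp_mem L a)]
    · rw [projComp_projComp hL, h L hL]
  rw [this]
  exact projComp_mem K a

theorem IsTrivial.eq_one_or {K : T.Component} (hK : T.IsTrivial K) {a : T.Q} (ha : a ∈ K.1) :
    a = 1 ∨ a ∈ T.reflections := by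
  obtain ⟨r, hr, hKr⟩ := hK
  rw [hKr] at ha
  obtain ⟨n, rfl⟩ := Subgroup.mem_zpowers_iff.1 ha
  rcases Int.even_or_odd' n with ⟨m, rfl | rfl⟩
  · left
    rw [zpow_mul, zpow_two, T.reflections_mul_self hr, one_zpow]
  · right
    rw [zpow_add, zpow_mul, zpow_two, T.reflections_mul_self hr, one_zpow, one_mul, zpow_one]
    exact hr

end AdmissibleTriple
end ReflRot

namespace ReflRot

open Module

/-! ### Codimension of the fixed space -/

section Codim

variable {V : Type*} [NormedAddCommGroup V] [InnerProductSpace ℝ V] [FiniteDimensional ℝ V]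

/-- The codimension of the fixed point subspace. -/
noncomputable def codim (g : V ≃ₗᵢ[ℝ] V) : ℕ := finrank ℝ V - finrank ℝ (fixed g)

theorem finrank_fixed_add_codim (g : V ≃ₗᵢ[ℝ] V) :
    finrank ℝ (fixed g) + codim g = finrank ℝ V :=
  Nat.add_sub_of_le (Submodule.finrank_le _)

theorem isReflection_iff_codim {g : V ≃ₗᵢ[ℝ] V} : IsReflection g ↔ codim g = 1 := by
  have := finrank_fixed_add_codim g
  change finrank ℝ (fixed g) + 1 = _ ↔ _
  omega

theorem isRotation_iff_codim {g : V ≃ₗᵢ[ℝ] V} : IsRotation g ↔ codim g = 2 := by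
  have := finrank_fixed_add_codim g
  change finrank ℝ (fixed g) + 2 = _ ↔ _
  omega

theorem codim_eq_zero_iff {g : V ≃ₗᵢ[ℝ] V} : codim g = 0 ↔ g = 1 := by
  have := finrank_fixed_add_codim g
  constructor
  · intro h
    exact eq_one_of_finrank_fixed (by omega)
  · rintro rfl
    have h2 : fixed (1 : V ≃ₗᵢ[ℝ] V) = ⊤ := eq_top_iff.2 fun v _ => mem_fixed.2 rfl
    rw [h2, finrank_top] at this
    omega

end Codim

/-! ### Block diagonal transformations -/

namespace OrthogonalDecomposition

set_option linter.unusedSectionVars false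

variable {ι : Type*} [Fintype ι] [DecidableEq ι]
  {E : Type*} [NormedAddCommGroup E] [InnerProductSpace ℝ E] (D : OrthogonalDecomposition ι E)

theorem ext_of_forall_coe {g h : E ≃ₗᵢ[ℝ] E} (H : ∀ i (v : D.V i), g (v : E) = h (v : E)) :
    g = h := by
  have htop : (⨆ i, D.V i) ≤ LinearMap.eqLocus (g.toLinearEquiv : E →ₗ[ℝ] E)
      (h.toLinearEquiv : E →ₗ[ℝ] E) := iSup_le fun i v hv => H i ⟨v, hv⟩
  rw [D.internal.submodule_iSup_eq_top] at htop
  ext v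
  exact htop (Submodule.mem_top (x := v))

theorem blockDiag_mul (a b : ∀ i, D.O i) :
    D.blockDiag (a * b) = D.blockDiag a * D.blockDiag b := by
  refine D.ext_of_forall_coe fun i v => ?_
  rw [blockDiag_apply_coe]
  change _ = D.blockDiag a (D.blockDiag b (v : E))
  rw [blockDiag_apply_coe, blockDiag_apply_coe]
  rfl

theorem blockDiag_one : D.blockDiag 1 = 1 := by
  refine D.ext_of_forall_coe fun i v => ?_
  rw [blockDiag_apply_coe]
  rfl

/-- `blockDiag` as a homomorphism. -/
noncomputable def blockHom : (∀ i, D.O i) →* (E ≃ₗᵢ[ℝ] E) where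
  toFun := D.blockDiag
  map_one' := D.blockDiag_one
  map_mul' := D.blockDiag_mul

theorem blockDiag_inv (a : ∀ i, D.O i) : D.blockDiag a⁻¹ = (D.blockDiag a)⁻¹ :=
  map_inv D.blockHom a

theorem blockDiag_injective : Function.Injective D.blockDiag := by
  intro a b h
  ext i v
  have := DFunLike.congr_fun h (v : E)
  rwa [blockDiag_apply_coe, blockDiag_apply_coe] at this

theorem single_mul (i : ι) (a b : D.O i) : D.single i (a * b) = D.single i a * D.single i b := by
  unfold single
  rw [Pi.mulSingle_mul, blockDiag_mul]

theorem single_one (i : ι) : D.single i 1 = 1 := by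
  unfold single
  rw [Pi.mulSingle_one, blockDiag_one]

theorem single_inv (i : ι) (a : D.O i) : D.single i a⁻¹ = (D.single i a)⁻¹ := by
  unfold single
  rw [Pi.mulSingle_inv, blockDiag_inv]

/-- `single i` as a homomorphism. -/
noncomputable def singleHom (i : ι) : D.O i →* (E ≃ₗᵢ[ℝ] E) where
  toFun := D.single i
  map_one' := D.single_one i
  map_mul' := D.single_mul i

theorem pair_eq (i j : ι) (s : D.O i) (t : D.O j) : D.pair i j s t = D.single i s * D.single j t :=
  D.blockDiag_mul _ _

theorem single_commute {i j : ι} (hij : i ≠ j) (s : D.O i) (t : D.O j) :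
    Commute (D.single i s) (D.single j t) := by
  change D.single i s * D.single j t = D.single j t * D.single i s
  unfold single
  rw [← blockDiag_mul, ← blockDiag_mul, (Pi.mulSingle_commute hij s t).eq]

theorem pair_symm {i j : ι} (hij : i ≠ j) (s : D.O i) (t : D.O j) :
    D.pair i j s t = D.pair j i t s := by
  rw [pair_eq, pair_eq, (D.single_commute hij s t).eq]

theorem pair_mul {i j : ι} (hij : i ≠ j) (s s' : D.O i) (t t' : D.O j) :
    D.pair i j (s * s') (t * t') = D.pair i j s t * D.pair i j s' t' := by
  simp only [pair_eq, single_mul]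
  have := (D.single_commute hij s' t).eq
  calc _ = D.single i s * (D.single i s' * D.single j t) * D.single j t' := by group
    _ = _ := by rw [this]; group

theorem pair_inv {i j : ι} (hij : i ≠ j) (s : D.O i) (t : D.O j) :
    D.pair i j s⁻¹ t⁻¹ = (D.pair i j s t)⁻¹ := by
  rw [pair_eq, pair_eq, mul_inv_rev, single_inv, single_inv, ← single_inv, ← single_inv,
    (D.single_commute hij _ _).eq]

theorem blockDiag_conj_mulSingle (b : ∀ i, D.O i) (i : ι) (a : D.O i) :
    D.blockDiag b * D.single i a * (D.blockDiag b)⁻¹ = D.single i (b i * a * (b i)⁻¹) := by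
  unfold single
  rw [← blockDiag_inv, ← blockDiag_mul, ← blockDiag_mul]
  congr 1
  ext1 j
  by_cases hj : j = i
  · subst hj
    simp
  · simp [Pi.mulSingle_eq_of_ne hj]

theorem blockDiag_conj_pair (b : ∀ i, D.O i) (i j : ι) (s : D.O i) (t : D.O j) :
    D.blockDiag b * D.pair i j s t * (D.blockDiag b)⁻¹ =
      D.pair i j (b i * s * (b i)⁻¹) (b j * t * (b j)⁻¹) := by
  rw [pair_eq, pair_eq, ← blockDiag_conj_mulSingle, ← blockDiag_conj_mulSingle]
  group

/-- The coordinates of a vector in the summands. -/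
noncomputable def coords : E ≃ₗ[ℝ] (∀ i, D.V i) :=
  (D.internal.isometryL2OfOrthogonalFamily D.orthogonal).toLinearEquiv.trans
    (WithLp.linearEquiv 2 ℝ (∀ i, D.V i))

theorem coords_blockDiag (a : ∀ i, D.O i) (v : E) (i : ι) :
    D.coords (D.blockDiag a v) i = a i (D.coords v i) := by
  let Φ := D.internal.isometryL2OfOrthogonalFamily D.orthogonal
  change (Φ (Φ.symm (LinearIsometryEquiv.piLpCongrRight 2 a (Φ v)))).ofLp i = a i ((Φ v).ofLp i)
  rw [Φ.apply_symm_apply]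
  rfl

variable [FiniteDimensional ℝ E]

theorem finrank_eq_sum : finrank ℝ E = ∑ i, finrank ℝ (D.V i) := by
  rw [D.coords.finrank_eq, finrank_pi_fintype]

theorem mem_fixed_blockDiag {a : ∀ i, D.O i} {v : E} :
    v ∈ fixed (D.blockDiag a) ↔ ∀ i, D.coords v i ∈ fixed (a i) := by
  rw [mem_fixed, ← D.coords.injective.eq_iff, funext_iff]
  refine forall_congr' fun i => ?_
  rw [coords_blockDiag, mem_fixed]

theorem finrank_fixed_blockDiag (a : ∀ i, D.O i) :
    finrank ℝ (fixed (D.blockDiag a)) = ∑ i, finrank ℝ (fixed (a i)) := by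
  let f : fixed (D.blockDiag a) →ₗ[ℝ] (∀ i, fixed (a i)) :=
    { toFun := fun v i => ⟨D.coords (v : E) i, D.mem_fixed_blockDiag.1 v.2 i⟩
      map_add' := fun v w => by
        ext i
        simp
      map_smul' := fun c v => by
        ext i
        simp }
  have hf : ∀ v i, (f v i : D.V i) = D.coords (v : E) i := fun v i => rfl
  have hbij : Function.Bijective f := by
    constructor
    · intro v w h
      refine Subtype.ext (D.coords.injective (funext fun i => ?_))
      rw [← hf, ← hf, h]
    · intro w
      have hw : D.coords (D.coords.symm fun i => (w i : D.V i)) = fun i => (w i : D.V i) :=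
        D.coords.apply_symm_apply _
      refine ⟨⟨D.coords.symm fun i => (w i : D.V i), ?_⟩, funext fun i => Subtype.ext ?_⟩
      · rw [mem_fixed_blockDiag, hw]
        exact fun i => (w i).2
      · rw [hf, hw]
  rw [(LinearEquiv.ofBijective f hbij).finrank_eq, finrank_pi_fintype]

/-- The fixed space is the direct sum of the fixed spaces of the blocks. Total codimension one or
two leaves only the patterns `1`, `2` and `1 + 1`. -/
theorem codim_blockDiag (a : ∀ i, D.O i) : codim (D.blockDiag a) = ∑ i, codim (a i) := by
  have h1 := finrank_fixed_add_codim (D.blockDiag a)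
  have h2 : ∑ i, (finrank ℝ (fixed (a i)) + codim (a i)) = ∑ i, finrank ℝ (D.V i) :=
    Finset.sum_congr rfl fun i _ => finrank_fixed_add_codim (a i)
  rw [Finset.sum_add_distrib, ← finrank_eq_sum, ← finrank_fixed_blockDiag] at h2
  omega

theorem codim_single (i : ι) (a : D.O i) : codim (D.single i a) = codim a := by
  unfold single
  rw [codim_blockDiag, Finset.sum_eq_single i, Pi.mulSingle_eq_same]
  · intro j _ hj
    rw [Pi.mulSingle_eq_of_ne hj, codim_eq_zero_iff]
  · simp

theorem codim_pair {i j : ι} (hij : i ≠ j) (s : D.O i) (t : D.O j) :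
    codim (D.pair i j s t) = codim s + codim t := by
  unfold pair
  rw [codim_blockDiag, ← Finset.add_sum_erase _ _ (Finset.mem_univ i),
    ← Finset.add_sum_erase _ _ (Finset.mem_erase.2 ⟨hij.symm, Finset.mem_univ j⟩),
    Finset.sum_eq_zero]
  · simp [Pi.mulSingle_eq_of_ne hij, Pi.mulSingle_eq_of_ne hij.symm]
  · intro k hk
    simp only [Finset.mem_erase, Finset.mem_univ, and_true] at hk
    rw [Pi.mul_apply, Pi.mulSingle_eq_of_ne hk.2, Pi.mulSingle_eq_of_ne hk.1, mul_one,
      codim_eq_zero_iff]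

theorem isReflection_single {i : ι} {s : D.O i} : IsReflection (D.single i s) ↔ IsReflection s := by
  rw [isReflection_iff_codim, isReflection_iff_codim, codim_single]

theorem isRotation_single {i : ι} {s : D.O i} : IsRotation (D.single i s) ↔ IsRotation s := by
  rw [isRotation_iff_codim, isRotation_iff_codim, codim_single]

theorem isRotation_pair {i j : ι} (hij : i ≠ j) {s : D.O i} {t : D.O j} (hs : IsReflection s)
    (ht : IsReflection t) : IsRotation (D.pair i j s t) := by
  rw [isReflection_iff_codim] at hs ht
  rw [isRotation_iff_codim, codim_pair D hij, hs, ht]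

theorem single_eq_of_codim {a : ∀ i, D.O i} {i : ι} (h : ∀ j ≠ i, codim (a j) = 0) :
    D.blockDiag a = D.single i (a i) := by
  unfold single
  congr 1
  ext1 j
  by_cases hj : j = i
  · subst hj
    rw [Pi.mulSingle_eq_same]
  · rw [Pi.mulSingle_eq_of_ne hj, codim_eq_zero_iff.1 (h j hj)]

theorem pair_eq_of_codim {a : ∀ i, D.O i} {i j : ι} (hij : i ≠ j)
    (h : ∀ k, k ≠ i → k ≠ j → codim (a k) = 0) : D.blockDiag a = D.pair i j (a i) (a j) := by
  unfold pair
  congr 1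
  ext1 k
  by_cases hki : k = i
  · subst hki
    simp [Pi.mulSingle_eq_of_ne hij]
  · by_cases hkj : k = j
    · subst hkj
      simp [Pi.mulSingle_eq_of_ne hij.symm]
    · rw [Pi.mul_apply, Pi.mulSingle_eq_of_ne hki, Pi.mulSingle_eq_of_ne hkj, mul_one,
        codim_eq_zero_iff.1 (h k hki hkj)]

theorem exists_of_isReflection {a : ∀ i, D.O i} (h : IsReflection (D.blockDiag a)) :
    ∃ i, IsReflection (a i) ∧ D.blockDiag a = D.single i (a i) := by
  rw [isReflection_iff_codim, codim_blockDiag] at h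
  obtain ⟨i, hi⟩ : ∃ i, codim (a i) ≠ 0 := by
    by_contra! h0
    rw [Finset.sum_eq_zero fun i _ => h0 i] at h
    omega
  rw [← Finset.add_sum_erase _ _ (Finset.mem_univ i)] at h
  have h0 : ∑ j ∈ Finset.univ.erase i, codim (a j) = 0 := by omega
  rw [Finset.sum_eq_zero_iff] at h0
  refine ⟨i, isReflection_iff_codim.2 (by omega), D.single_eq_of_codim fun j hj => ?_⟩
  exact h0 j (Finset.mem_erase.2 ⟨hj, Finset.mem_univ j⟩)

theorem exists_of_isRotation {a : ∀ i, D.O i} (h : IsRotation (D.blockDiag a)) :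
    (∃ i, IsRotation (a i) ∧ D.blockDiag a = D.single i (a i)) ∨
    ∃ i j, i ≠ j ∧ IsReflection (a i) ∧ IsReflection (a j) ∧
      D.blockDiag a = D.pair i j (a i) (a j) := by
  rw [isRotation_iff_codim, codim_blockDiag] at h
  obtain ⟨i, hi⟩ : ∃ i, codim (a i) ≠ 0 := by
    by_contra! h0
    rw [Finset.sum_eq_zero fun i _ => h0 i] at h
    omega
  rw [← Finset.add_sum_erase _ _ (Finset.mem_univ i)] at h
  by_cases h1 : codim (a i) = 1
  · right
    have h0 : ∑ j ∈ Finset.univ.erase i, codim (a j) = 1 := by omega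
    obtain ⟨j, hj, hjc⟩ : ∃ j ∈ Finset.univ.erase i, codim (a j) ≠ 0 := by
      by_contra! h2
      rw [Finset.sum_eq_zero fun i hi => h2 i hi] at h0
      omega
    rw [← Finset.add_sum_erase _ _ hj] at h0
    have h3 : ∑ j ∈ (Finset.univ.erase i).erase j, codim (a j) = 0 := by omega
    rw [Finset.sum_eq_zero_iff] at h3
    have hij := (Finset.mem_erase.1 hj).1.symm
    refine ⟨i, j, hij, isReflection_iff_codim.2 h1, isReflection_iff_codim.2 (by omega),
      D.pair_eq_of_codim hij fun k hki hkj => h3 k ?_⟩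
    simp [hki, hkj]
  · left
    have h0 : ∑ j ∈ Finset.univ.erase i, codim (a j) = 0 := by omega
    rw [Finset.sum_eq_zero_iff] at h0
    refine ⟨i, isRotation_iff_codim.2 (by omega), D.single_eq_of_codim fun j hj => ?_⟩
    exact h0 j (Finset.mem_erase.2 ⟨hj, Finset.mem_univ j⟩)

theorem exists_blockDiag {g : E ≃ₗᵢ[ℝ] E} (hg : ∀ i, ∀ v ∈ D.V i, g v ∈ D.V i) :
    ∃ a, g = D.blockDiag a := by
  let f : ∀ i, D.V i →ₗᵢ[ℝ] D.V i := fun i =>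
    ⟨(g.toLinearEquiv : E →ₗ[ℝ] E).restrict (hg i), fun v => g.norm_map v⟩
  refine ⟨fun i => (f i).toLinearIsometryEquiv rfl, D.ext_of_forall_coe fun i v => ?_⟩
  rw [blockDiag_apply_coe]
  rfl

theorem blockDiag_mem (a : ∀ i, D.O i) (i : ι) {v : E} (hv : v ∈ D.V i) :
    D.blockDiag a v ∈ D.V i := by
  rw [D.blockDiag_apply_coe a i ⟨v, hv⟩]
  exact Subtype.prop _

theorem mem_proj_iff {G : Subgroup (E ≃ₗᵢ[ℝ] E)} (hG : ∀ i, IsInvariant G (D.V i)) {i : ι}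
    {a : D.O i} : a ∈ D.proj G i ↔ ∃ b, D.blockDiag b ∈ G ∧ b i = a := by
  constructor
  · rintro ⟨g, hg, hga⟩
    obtain ⟨b, rfl⟩ := D.exists_blockDiag fun i v hv => hG i g hg v hv
    refine ⟨b, hg, ?_⟩
    ext v
    rw [← hga, blockDiag_apply_coe]
  · rintro ⟨b, hb, rfl⟩
    exact ⟨_, hb, fun v => D.blockDiag_apply_coe b i v⟩

theorem apply_mem_proj {G : Subgroup (E ≃ₗᵢ[ℝ] E)} {b : ∀ i, D.O i} (hb : D.blockDiag b ∈ G)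
    (i : ι) : b i ∈ D.proj G i :=
  ⟨_, hb, fun v => D.blockDiag_apply_coe b i v⟩

theorem mem_proj_of_single_mem {G : Subgroup (E ≃ₗᵢ[ℝ] E)} {i : ι} {a : D.O i}
    (h : D.single i a ∈ G) : a ∈ D.proj G i := by
  have := D.apply_mem_proj h i
  rwa [Pi.mulSingle_eq_same] at this

theorem left_mem_proj_of_pair_mem {G : Subgroup (E ≃ₗᵢ[ℝ] E)} {i j : ι} (hij : i ≠ j) {s : D.O i}
    {t : D.O j} (h : D.pair i j s t ∈ G) : s ∈ D.proj G i := by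
  have := D.apply_mem_proj h i
  rwa [Pi.mul_apply, Pi.mulSingle_eq_same, Pi.mulSingle_eq_of_ne hij, mul_one] at this

/-- The image of a group generated by block diagonal transformations is generated by their
blocks. -/
theorem proj_closure (X : Set (∀ i, D.O i)) (i : ι) :
    D.proj (Subgroup.closure (D.blockDiag '' X)) i = Subgroup.closure ((fun a => a i) '' X) := by
  have hmap : Subgroup.closure (D.blockDiag '' X) = (Subgroup.closure X).map D.blockHom :=
    (MonoidHom.map_closure D.blockHom X).symm
  have hmap' : Subgroup.closure ((fun a : ∀ i, D.O i => a i) '' X) =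
      (Subgroup.closure X).map (Pi.evalMonoidHom (fun i => D.O i) i) :=
    (MonoidHom.map_closure (Pi.evalMonoidHom (fun i => D.O i) i) X).symm
  rw [hmap, hmap']
  ext a
  constructor
  · rintro ⟨_, ⟨b, hb, rfl⟩, h⟩
    refine Subgroup.mem_map.2 ⟨b, hb, LinearIsometryEquiv.ext fun v => Subtype.ext ?_⟩
    rw [← h]
    exact (D.blockDiag_apply_coe b i v).symm
  · intro h
    obtain ⟨b, hb, hba⟩ := Subgroup.mem_map.1 h
    have hba' : b i = a := hba
    rw [← hba']
    have hmem : D.blockDiag b ∈ (Subgroup.closure X).map D.blockHom :=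
      Subgroup.mem_map_of_mem D.blockHom hb
    exact D.apply_mem_proj hmem i

end OrthogonalDecomposition
end ReflRot

namespace ReflRot

open Module

/-! ### Generators of the images of the two normal subgroups in a block -/

namespace OrthogonalDecomposition

set_option linter.unusedSectionVars false

variable {ι : Type*} [Fintype ι] [DecidableEq ι]
  {E : Type*} [NormedAddCommGroup E] [InnerProductSpace ℝ E] [FiniteDimensional ℝ E]
  (D : OrthogonalDecomposition ι E)

theorem proj_firstKindSubgroup (G : Subgroup (E ≃ₗᵢ[ℝ] E)) (i : ι) :
    D.proj (D.firstKindSubgroup G) i = Subgroup.closure {a | IsRotation a ∧ D.single i a ∈ G} := by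
  let X : Set (∀ i, D.O i) :=
    {b | ∃ (i : ι) (a : D.O i), IsRotation a ∧ D.single i a ∈ G ∧ b = Pi.mulSingle i a}
  have hX : D.firstKindSubgroup G = Subgroup.closure (D.blockDiag '' X) := by
    unfold firstKindSubgroup
    congr 1
    ext g
    constructor
    · rintro ⟨hg, i, a, ha, rfl⟩
      exact ⟨_, ⟨i, a, ha, hg, rfl⟩, rfl⟩
    · rintro ⟨_, ⟨i, a, ha, hg, rfl⟩, rfl⟩
      exact ⟨hg, i, a, ha, rfl⟩
  rw [hX, proj_closure]
  refine le_antisymm ((Subgroup.closure_le _).2 ?_) ((Subgroup.closure_le _).2 ?_)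
  · rintro _ ⟨_, ⟨j, a, ha, hg, rfl⟩, rfl⟩
    by_cases hij : i = j
    · subst hij
      dsimp only
      rw [Pi.mulSingle_eq_same]
      exact Subgroup.subset_closure ⟨ha, hg⟩
    · dsimp only
      rw [Pi.mulSingle_eq_of_ne hij]
      exact one_mem _
  · rintro a ⟨ha, hg⟩
    exact Subgroup.subset_closure ⟨Pi.mulSingle i a, ⟨i, a, ha, hg, rfl⟩,
      Pi.mulSingle_eq_same (M := fun i => D.O i) i a⟩

/-- The reflections in a summand that are blocks of reflections or of rotations of the second kind
in `G`. -/
def blockReflections (G : Subgroup (E ≃ₗᵢ[ℝ] E)) (i : ι) : Set (D.O i) :=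
  {s | IsReflection s ∧ (D.single i s ∈ G ∨
    ∃ (j : ι) (t : D.O j), i ≠ j ∧ IsReflection t ∧ D.pair i j s t ∈ G)}

theorem proj_secondKindSubgroup {G : Subgroup (E ≃ₗᵢ[ℝ] E)} (hG : ∀ i, IsInvariant G (D.V i))
    (i : ι) : D.proj (D.secondKindSubgroup G) i = Subgroup.closure (D.blockReflections G i) := by
  let X : Set (∀ i, D.O i) := {b | D.blockDiag b ∈ G ∧ (IsReflection (D.blockDiag b) ∨
    D.IsSecondKind (D.blockDiag b))}
  have hX : D.secondKindSubgroup G = Subgroup.closure (D.blockDiag '' X) := by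
    unfold secondKindSubgroup
    congr 1
    ext g
    constructor
    · rintro ⟨hg, h⟩
      obtain ⟨b, rfl⟩ := D.exists_blockDiag fun i v hv => hG i g hg v hv
      exact ⟨b, ⟨hg, h⟩, rfl⟩
    · rintro ⟨b, hb, rfl⟩
      exact hb
  rw [hX, proj_closure]
  refine le_antisymm ((Subgroup.closure_le _).2 ?_) ((Subgroup.closure_le _).2 ?_)
  · rintro _ ⟨b, ⟨hb, h | ⟨j, k, s, t, hjk, hs, ht, hst⟩⟩, rfl⟩
    · obtain ⟨j, hj, hbj⟩ := D.exists_of_isReflection h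
      have hbj' : b = Pi.mulSingle j (b j) := D.blockDiag_injective hbj
      dsimp only
      by_cases hij : i = j
      · subst hij
        exact Subgroup.subset_closure ⟨hj, Or.inl (hbj ▸ hb)⟩
      · rw [hbj', Pi.mulSingle_eq_of_ne hij]
        exact one_mem _
    · have hb' : b = Pi.mulSingle j s * Pi.mulSingle k t := D.blockDiag_injective hst
      rw [hst] at hb
      subst hb'
      dsimp only [Pi.mul_apply]
      by_cases hij : i = j
      · subst hij
        rw [Pi.mulSingle_eq_same, Pi.mulSingle_eq_of_ne hjk, mul_one]
        exact Subgroup.subset_closure ⟨hs, Or.inr ⟨k, t, hjk, ht, hb⟩⟩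
      · by_cases hik : i = k
        · subst hik
          rw [Pi.mulSingle_eq_same, Pi.mulSingle_eq_of_ne hij, one_mul]
          rw [D.pair_symm hjk] at hb
          exact Subgroup.subset_closure ⟨ht, Or.inr ⟨j, s, hjk.symm, hs, hb⟩⟩
        · rw [Pi.mulSingle_eq_of_ne hij, Pi.mulSingle_eq_of_ne hik, one_mul]
          exact one_mem _
  · rintro s ⟨hs, h | ⟨j, t, hij, ht, h⟩⟩
    · exact Subgroup.subset_closure ⟨_, ⟨h, Or.inl (D.isReflection_single.2 hs)⟩,
        Pi.mulSingle_eq_same i s⟩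
    · refine Subgroup.subset_closure ⟨_, ⟨h, Or.inr ⟨i, j, s, t, hij, hs, ht, rfl⟩⟩, ?_⟩
      dsimp only [Pi.mul_apply]
      rw [Pi.mulSingle_eq_same, Pi.mulSingle_eq_of_ne hij, mul_one]

end OrthogonalDecomposition

/-! ### Invariants satisfied by the group of a datum -/

namespace Datum

open AdmissibleTriple

set_option linter.unusedSectionVars false

variable {ι : Type*} [Fintype ι] [DecidableEq ι]
  {E : Type*} [NormedAddCommGroup E] [InnerProductSpace ℝ E] [FiniteDimensional ℝ E]
  {D : OrthogonalDecomposition ι E} (A : Datum D)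

variable {A} in
theorem ne_factor {x y : Σ i, (A.triple i).Component} (h : A.rel x y) (hne : x ≠ y) : x.1 ≠ y.1 :=
  fun h' => hne (A.rel_factor x y h h')

variable {A} in
-- A nontrivial component has two distinct reflections, and the isomorphism would send both to the
-- only reflection of the trivial one.
theorem isTrivial_of_rel {x y : Σ i, (A.triple i).Component} (h : A.rel x y)
    (hx : (A.triple x.1).IsTrivial x.2) : (A.triple y.1).IsTrivial y.2 := by
  by_cases hne : y = x
  · rwa [hne]
  by_contra hy
  obtain ⟨p, hp, hpy⟩ := y.2.exists_mem
  obtain ⟨q, hq, hqy, hpq⟩ := exists_not_commute hy hp hpy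
  let e := A.iso y x (A.rel.symm h) hne hy
  have h1 := (A.iso_reflections y x (A.rel.symm h) hne hy ⟨p, hpy⟩).1 hp
  have h2 := (A.iso_reflections y x (A.rel.symm h) hne hy ⟨q, hqy⟩).1 hq
  have h3 : e ⟨p, hpy⟩ = e ⟨q, hqy⟩ :=
    Subtype.ext (hx.eq h1 (Subtype.prop _) h2 (Subtype.prop _))
  have h4 : p = q := congrArg Subtype.val (e.injective h3)
  exact hpq (h4 ▸ Commute.refl p)

variable {A} in
theorem exists_partner {x : Σ i, (A.triple i).Component} (hx : ¬ (A.triple x.1).IsTrivial x.2) :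
    ∃ y, A.rel x y ∧ y ≠ x := by
  obtain ⟨a, b, hab, h⟩ := Set.ncard_eq_two.1 (A.paired x hx)
  have ha : A.rel x a := by
    have : a ∈ ({a, b} : Set _) := by simp
    rwa [← h] at this
  have hb : A.rel x b := by
    have : b ∈ ({a, b} : Set _) := by simp
    rwa [← h] at this
  by_cases hax : a = x
  · exact ⟨b, hb, fun hbx => hab (hax.trans hbx.symm)⟩
  · exact ⟨a, ha, hax⟩

variable {A} in
theorem partner_unique {x y z : Σ i, (A.triple i).Component}
    (hx : ¬ (A.triple x.1).IsTrivial x.2) (hy : A.rel x y) (hyx : y ≠ x) (hz : A.rel x z)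
    (hzx : z ≠ x) : y = z := by
  obtain ⟨a, b, hab, h⟩ := Set.ncard_eq_two.1 (A.paired x hx)
  have key : ∀ w, A.rel x w → w = a ∨ w = b := by
    intro w hw
    have : w ∈ {y | A.rel x y} := hw
    rw [h] at this
    simpa using this
  rcases key x (A.rel.refl x) with h1 | h1 <;> rcases key y hy with h2 | h2 <;>
    rcases key z hz with h3 | h3 <;> simp_all

/-- For trivial components any reflection will do, as no isomorphism is prescribed; for nontrivial
ones its image is taken. -/
theorem exists_equivalent {x y : Σ i, (A.triple i).Component} (h : A.rel x y) (hne : x ≠ y)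
    {p : (A.triple x.1).Q} (hp : p ∈ (A.triple x.1).reflections) (hpx : p ∈ x.2.1) :
    ∃ q ∈ (A.triple y.1).reflections, q ∈ y.2.1 ∧ A.Equivalent x.1 y.1 p q := by
  by_cases hx : (A.triple x.1).IsTrivial x.2
  · obtain ⟨q, hq, hqy⟩ := y.2.exists_mem
    exact ⟨q, hq, hqy, x.2, y.2, hpx, hqy, h, hne, fun hK => (hK hx).elim⟩
  · exact ⟨_, (A.iso_reflections x y h hne hx ⟨p, hpx⟩).1 hp, Subtype.prop _, x.2, y.2, hpx,
      Subtype.prop _, h, hne, fun _ => rfl⟩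

/-- The component at `x` of a block diagonal transformation. -/
noncomputable def blockComp (x : Σ i, (A.triple i).Component) (a : ∀ i, D.O i) : x.2.1 :=
  ⟨projComp x.2 ((A.triple x.1).cos (a x.1)), projComp_mem _ _⟩

variable {A} in
theorem blockComp_mul (x : Σ i, (A.triple i).Component) {a b : ∀ i, D.O i}
    (ha : ∀ i, a i ∈ (A.triple i).G) (hb : ∀ i, b i ∈ (A.triple i).G) :
    A.blockComp x (a * b) = A.blockComp x a * A.blockComp x b := by
  refine Subtype.ext ?_
  change projComp x.2 ((A.triple x.1).cos (a x.1 * b x.1)) = _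
  rw [cos_mul _ (ha _) (hb _), map_mul]
  rfl

theorem blockComp_one (x : Σ i, (A.triple i).Component) : A.blockComp x 1 = 1 := by
  refine Subtype.ext ?_
  change projComp x.2 ((A.triple x.1).cos 1) = 1
  rw [cos_one, map_one]

variable {A} in
theorem blockComp_inv (x : Σ i, (A.triple i).Component) {a : ∀ i, D.O i}
    (ha : ∀ i, a i ∈ (A.triple i).G) : A.blockComp x a⁻¹ = (A.blockComp x a)⁻¹ := by
  have h := blockComp_mul (b := a⁻¹) x ha fun i => inv_mem (ha i)
  rw [mul_inv_cancel, blockComp_one] at h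
  exact eq_inv_of_mul_eq_one_right h.symm

/-- The sign at `x` of a block diagonal transformation. -/
noncomputable def blockSign (x : Σ i, (A.triple i).Component) (a : ∀ i, D.O i) : ℤˣ :=
  signComp x.2 (A.blockComp x a)

variable {A} in
theorem blockSign_eq_one {x : Σ i, (A.triple i).Component} {a : ∀ i, D.O i}
    (h : A.blockComp x a = 1) : A.blockSign x a = 1 := by
  unfold blockSign
  rw [h]
  exact map_one _

variable {A} in
theorem blockSign_mul (x : Σ i, (A.triple i).Component) {a b : ∀ i, D.O i}
    (ha : ∀ i, a i ∈ (A.triple i).G) (hb : ∀ i, b i ∈ (A.triple i).G) :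
    A.blockSign x (a * b) = A.blockSign x a * A.blockSign x b := by
  unfold blockSign
  rw [blockComp_mul x ha hb]
  exact map_mul _ _ _

variable {A} in
theorem blockSign_inv (x : Σ i, (A.triple i).Component) {a : ∀ i, D.O i}
    (ha : ∀ i, a i ∈ (A.triple i).G) : A.blockSign x a⁻¹ = (A.blockSign x a)⁻¹ := by
  have h := blockSign_mul (b := a⁻¹) x ha fun i => inv_mem (ha i)
  rw [mul_inv_cancel, blockSign_eq_one (A.blockComp_one x)] at h
  exact eq_inv_of_mul_eq_one_right h.symm

theorem finite_index : Finite (Σ i, (A.triple i).Component) := by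
  have : ∀ i, Finite (A.triple i).Q := fun i => (A.triple i).finite_Q
  infer_instance

/-- The equivalence class of a component. -/
noncomputable def cls (x : Σ i, (A.triple i).Component) : Finset (Σ i, (A.triple i).Component) :=
  have := A.finite_index
  (Set.toFinite {y | A.rel x y}).toFinset

theorem mem_cls {x y : Σ i, (A.triple i).Component} : y ∈ A.cls x ↔ A.rel x y := by
  simp [cls]

/-- The components of a block diagonal transformation are compatible with the datum. -/
structure Respects (a : ∀ i, D.O i) : Prop where
  mem_G : ∀ i, a i ∈ (A.triple i).G
  iso_eq : ∀ x y hxy hne hx, A.iso x y hxy hne hx (A.blockComp x a) = A.blockComp y a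
  -- The element `y` only witnesses that the class has a second member; the sign on a singleton
  -- class is free, as reflections are allowed there.
  prod_eq_one : ∀ x y, A.rel x y → y ≠ x → ∏ z ∈ A.cls x, A.blockSign z a = 1

variable {A} in
theorem Respects.one : A.Respects 1 where
  mem_G i := one_mem _
  iso_eq x y hxy hne hx := by rw [blockComp_one, blockComp_one, map_one]
  prod_eq_one x y _ _ := Finset.prod_eq_one fun z _ => blockSign_eq_one (A.blockComp_one z)

variable {A} in
theorem Respects.mul {a b : ∀ i, D.O i} (ha : A.Respects a) (hb : A.Respects b) :
    A.Respects (a * b) where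
  mem_G i := mul_mem (ha.mem_G i) (hb.mem_G i)
  iso_eq x y hxy hne hx := by
    rw [blockComp_mul x ha.mem_G hb.mem_G, blockComp_mul y ha.mem_G hb.mem_G, map_mul, ha.iso_eq,
      hb.iso_eq]
  prod_eq_one x y hxy hne := by
    rw [Finset.prod_congr rfl fun z _ => blockSign_mul z ha.mem_G hb.mem_G,
      Finset.prod_mul_distrib, ha.prod_eq_one x y hxy hne, hb.prod_eq_one x y hxy hne, one_mul]

variable {A} in
theorem Respects.inv {a : ∀ i, D.O i} (ha : A.Respects a) : A.Respects a⁻¹ where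
  mem_G i := (A.triple i).G.inv_mem (ha.mem_G i)
  iso_eq x y hxy hne hx := by
    rw [blockComp_inv x ha.mem_G, blockComp_inv y ha.mem_G, map_inv, ha.iso_eq]
  prod_eq_one x y hxy hne := by
    rw [Finset.prod_congr rfl fun z _ => blockSign_inv z ha.mem_G, Finset.prod_inv_distrib,
      ha.prod_eq_one x y hxy hne, inv_one]

/-- The group of the block diagonal transformations whose components are compatible with the
datum. -/
def constraints : Subgroup (∀ i, D.O i) where
  carrier := {a | A.Respects a}
  one_mem' := Respects.one
  mul_mem' := Respects.mul
  inv_mem' := Respects.inv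

variable {A} in
theorem mem_constraints_of_blockComp_eq_one {a : ∀ i, D.O i} (ha : ∀ i, a i ∈ (A.triple i).G)
    (h : ∀ x y, A.rel x y → y ≠ x → A.blockComp x a = 1) : a ∈ A.constraints := by
  refine ⟨ha, fun x y hxy hne hx => ?_, fun x y hxy hne => ?_⟩
  · rw [h x y hxy hne.symm, h y x (A.rel.symm hxy) hne, map_one]
  · refine Finset.prod_eq_one fun z hz => ?_
    rw [mem_cls] at hz
    have : A.blockComp z a = 1 := by
      by_cases hzx : z = x
      · rw [hzx]
        exact h x y hxy hne
      · exact h z x (A.rel.symm hz) (Ne.symm hzx)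
    exact blockSign_eq_one this

theorem mulSingle_mem_G {i : ι} {a : D.O i} (ha : a ∈ (A.triple i).G) (k : ι) :
    Pi.mulSingle (M := fun i => D.O i) i a k ∈ (A.triple k).G := by
  by_cases hk : k = i
  · subst hk
    rwa [Pi.mulSingle_eq_same]
  · rw [Pi.mulSingle_eq_of_ne hk]
    exact one_mem _

theorem coe_blockComp_mulSingle (i : ι) (K : (A.triple i).Component) (a : D.O i) :
    (A.blockComp ⟨i, K⟩ (Pi.mulSingle i a) : (A.triple i).Q) =
      projComp K ((A.triple i).cos a) := by
  unfold blockComp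
  dsimp only
  rw [Pi.mulSingle_eq_same]

theorem blockComp_mulSingle_of_ne {x : Σ i, (A.triple i).Component} {i : ι} (h : x.1 ≠ i)
    (a : D.O i) : A.blockComp x (Pi.mulSingle i a) = 1 := by
  refine Subtype.ext ?_
  unfold blockComp
  dsimp only
  rw [Pi.mulSingle_eq_of_ne h, cos_one, map_one]
  rfl

theorem blockComp_mulSingle_of_cos {x : Σ i, (A.triple i).Component} {i : ι} {a : D.O i}
    (h : ∀ K, x = ⟨i, K⟩ → projComp K ((A.triple i).cos a) = 1) :
    A.blockComp x (Pi.mulSingle i a) = 1 := by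
  by_cases hx : x.1 = i
  · obtain ⟨k, K⟩ := x
    dsimp only at hx
    subst hx
    refine Subtype.ext ?_
    rw [coe_blockComp_mulSingle, h K rfl]
    rfl
  · exact A.blockComp_mulSingle_of_ne hx a

theorem cos_eq_one_of_mem_H {i : ι} {h : D.O i} (hh : h ∈ (A.triple i).H) :
    (A.triple i).cos h = 1 :=
  ((A.triple i).cos_eq_one_iff ((A.triple i).H_le hh)).2 hh

theorem single_mem_constraints_of_mem_H {i : ι} {h : D.O i} (hh : h ∈ (A.triple i).H) :
    Pi.mulSingle i h ∈ A.constraints := by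
  refine mem_constraints_of_blockComp_eq_one (A.mulSingle_mem_G ((A.triple i).H_le hh))
    fun x _ _ _ => A.blockComp_mulSingle_of_cos fun K _ => ?_
  rw [A.cos_eq_one_of_mem_H hh, map_one]

variable {A} in
/-- A reflection that is not equivalent to any other reflection belongs to a component that is not
equivalent to any other component. -/
theorem unpaired_of_not_equivalent {x : Σ i, (A.triple i).Component} {p : (A.triple x.1).Q}
    (hp : p ∈ (A.triple x.1).reflections) (hpx : p ∈ x.2.1)
    (h : ∀ (j : ι) (t : (A.triple j).F), x.1 ≠ j → IsReflection (t : D.O j) →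
      ¬ A.Equivalent x.1 j p ((A.triple j).coset t)) (y) (hxy : A.rel x y) : y = x := by
  by_contra hne
  obtain ⟨q, ⟨t, ht, rfl⟩, hqy, heq⟩ := A.exists_equivalent hxy (Ne.symm hne) hp hpx
  exact h y.1 t (ne_factor hxy (Ne.symm hne)) ht heq

theorem blockComp_mulSingle_eq {i : ι} {K : (A.triple i).Component} {s : D.O i}
    (hs : s ∈ (A.triple i).refls) (hK : (A.triple i).cos s ∈ K.1) :
    A.blockComp ⟨i, K⟩ (Pi.mulSingle i s) = ⟨_, hK⟩ :=
  Subtype.ext ((A.coe_blockComp_mulSingle i K s).trans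
    (projComp_of_mem (cos_mem_reflections _ hs) hK))

theorem blockComp_mulSingle_eq_one {i : ι} {K : (A.triple i).Component} {s : D.O i}
    (hs : s ∈ (A.triple i).refls) (hK : (A.triple i).cos s ∈ K.1) {z} (hz : z ≠ ⟨i, K⟩) :
    A.blockComp z (Pi.mulSingle i s) = 1 := by
  refine A.blockComp_mulSingle_of_cos ?_
  rintro L rfl
  refine projComp_of_notMem (cos_mem_reflections _ hs) fun hL => hz ?_
  rw [Component.eq_of_mem (cos_mem_reflections _ hs) hK hL]

theorem single_mem_constraints {i : ι} {K : (A.triple i).Component} {s : D.O i}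
    (hs : s ∈ (A.triple i).refls) (hK : (A.triple i).cos s ∈ K.1)
    (h : ∀ y, A.rel ⟨i, K⟩ y → y = ⟨i, K⟩) : Pi.mulSingle i s ∈ A.constraints := by
  refine mem_constraints_of_blockComp_eq_one (A.mulSingle_mem_G ((A.triple i).F_le hs.1))
    fun x y hxy hne => A.blockComp_mulSingle_eq_one hs hK ?_
  rintro rfl
  exact hne (h y hxy)

variable {A} in
-- The two reflections contribute two signs `-1` to the same class. If `x` and `y` are nontrivial,
-- they are each other's only partners, so no isomorphism leads from them to a third component.
theorem respects_of_pair {x y : Σ i, (A.triple i).Component} (hxy : A.rel x y) (hne : x ≠ y)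
    {a : ∀ i, D.O i} (haG : ∀ i, a i ∈ (A.triple i).G) {p : x.2.1} {q : y.2.1}
    (hp : (p : (A.triple x.1).Q) ∈ (A.triple x.1).reflections)
    (hq : (q : (A.triple y.1).Q) ∈ (A.triple y.1).reflections)
    (hiso : ∀ hx, A.iso x y hxy hne hx p = q)
    (hax : A.blockComp x a = p) (hay : A.blockComp y a = q)
    (haz : ∀ z, z ≠ x → z ≠ y → A.blockComp z a = 1) : A.Respects a where
  mem_G := haG
  iso_eq z w hzw hzwne hz := by
    by_cases hzx : z = x
    · subst hzx
      have := partner_unique hz hzw hzwne.symm hxy hne.symm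
      subst this
      rw [hax, hay]
      exact hiso hz
    by_cases hzy : z = y
    · subst hzy
      have := partner_unique hz hzw hzwne.symm (A.rel.symm hxy) hne
      subst this
      have hx : ¬ (A.triple w.1).IsTrivial w.2 := fun h => hz (isTrivial_of_rel hxy h)
      rw [hax, hay, A.iso_symm w z hxy hne hx hz, MulEquiv.symm_apply_eq]
      exact (hiso hx).symm
    have hw : ¬ (A.triple w.1).IsTrivial w.2 := fun h =>
      hz (isTrivial_of_rel (A.rel.symm hzw) h)
    have hwx : w ≠ x := by
      rintro rfl
      exact hzy (partner_unique hw (A.rel.symm hzw) hzwne hxy hne.symm)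
    have hwy : w ≠ y := by
      rintro rfl
      exact hzx (partner_unique hw (A.rel.symm hzw) hzwne (A.rel.symm hxy) hne)
    rw [haz z hzx hzy, haz w hwx hwy, map_one]
  prod_eq_one z w hzw hzwne := by
    classical
    have hsz : ∀ z, z ≠ x → z ≠ y → A.blockSign z a = 1 := fun z hzx hzy =>
      blockSign_eq_one (haz z hzx hzy)
    have hsx' : A.blockSign x a = -1 := by
      rw [blockSign, hax]
      exact signComp_of_mem hp p.2
    have hsy' : A.blockSign y a = -1 := by
      rw [blockSign, hay]
      exact signComp_of_mem hq q.2
    by_cases hzx : A.rel z x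
    · have hxm := A.mem_cls.2 hzx
      have hym := A.mem_cls.2 (A.rel.trans hzx hxy)
      rw [← Finset.mul_prod_erase _ _ hxm,
        ← Finset.mul_prod_erase _ _ (Finset.mem_erase.2 ⟨hne.symm, hym⟩), hsx', hsy',
        Finset.prod_eq_one]
      · simp
      · intro v hv
        simp only [Finset.mem_erase] at hv
        exact hsz v hv.2.1 hv.1
    · refine Finset.prod_eq_one fun v hv => ?_
      rw [mem_cls] at hv
      refine hsz v ?_ ?_
      · rintro rfl
        exact hzx hv
      · rintro rfl
        exact hzx (A.rel.trans hv (A.rel.symm hxy))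

theorem pair_mem_constraints {i j : ι} {K : (A.triple i).Component} {L : (A.triple j).Component}
    (hxy : A.rel ⟨i, K⟩ ⟨j, L⟩) (hne : (⟨i, K⟩ : Σ i, (A.triple i).Component) ≠ ⟨j, L⟩)
    {s : D.O i} {t : D.O j} (hs : s ∈ (A.triple i).refls) (ht : t ∈ (A.triple j).refls)
    (hsx : (A.triple i).cos s ∈ K.1) (hty : (A.triple j).cos t ∈ L.1)
    (hiso : ∀ hx, A.iso ⟨i, K⟩ ⟨j, L⟩ hxy hne hx ⟨_, hsx⟩ = ⟨_, hty⟩) :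
    (Pi.mulSingle i s * Pi.mulSingle j t : ∀ i, D.O i) ∈ A.constraints := by
  have hfac : i ≠ j := ne_factor hxy hne
  have hG1 := A.mulSingle_mem_G ((A.triple i).F_le hs.1)
  have hG2 := A.mulSingle_mem_G ((A.triple j).F_le ht.1)
  refine respects_of_pair hxy hne (fun k => (A.triple k).G.mul_mem (hG1 k) (hG2 k))
    (cos_mem_reflections _ hs) (cos_mem_reflections _ ht) hiso ?_ ?_ fun z hzx hzy => ?_
  · rw [blockComp_mul _ hG1 hG2, A.blockComp_mulSingle_of_ne (x := ⟨i, K⟩) hfac t, mul_one,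
      A.blockComp_mulSingle_eq hs hsx]
  · rw [blockComp_mul _ hG1 hG2, A.blockComp_mulSingle_of_ne (x := ⟨j, L⟩) hfac.symm s, one_mul,
      A.blockComp_mulSingle_eq ht hty]
  · rw [blockComp_mul _ hG1 hG2, A.blockComp_mulSingle_eq_one hs hsx hzx,
      A.blockComp_mulSingle_eq_one ht hty hzy, mul_one]

/-- The upper bound for the group: each of the three kinds of generators satisfies the constraints.
-/
theorem group_le : A.group ≤ A.constraints.map D.blockHom := by
  refine (Subgroup.closure_le _).2 ?_
  rintro _ ((⟨i, h, hh, rfl⟩ | ⟨i, j, s, t, hij, hs, ht, ⟨K, L, hK, hL, hKL, hne, hiso⟩, rfl⟩) |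
    ⟨i, s, hs, h, rfl⟩)
  · exact Subgroup.mem_map_of_mem D.blockHom (A.single_mem_constraints_of_mem_H hh)
  · have key : ∀ (p : (A.triple i).Q) (hp : p ∈ K.1) (q : (A.triple j).Q) (hq : q ∈ L.1),
        (A.triple i).coset s = p → (A.triple j).coset t = q →
        ∀ hx, A.iso ⟨i, K⟩ ⟨j, L⟩ hKL hne hx ⟨p, hp⟩ = ⟨q, hq⟩ := by
      rintro p hp q hq rfl rfl hx
      exact Subtype.ext (hiso hx)
    have hK' := hK
    have hL' := hL
    rw [coset_eq_cos] at hK' hL'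
    exact Subgroup.mem_map_of_mem D.blockHom (A.pair_mem_constraints hKL hne ⟨s.2, hs⟩ ⟨t.2, ht⟩
      hK' hL' (key _ _ _ _ ((A.triple i).coset_eq_cos s) ((A.triple j).coset_eq_cos t)))
  · have hs' : (s : D.O i) ∈ (A.triple i).refls := ⟨s.2, hs⟩
    have hr := cos_mem_reflections _ hs'
    let K := (A.triple i).compOf ⟨_, hr⟩
    have hK : (A.triple i).cos (s : D.O i) ∈ K.1 := (A.triple i).mem_compOf ⟨_, hr⟩
    refine Subgroup.mem_map_of_mem D.blockHom (A.single_mem_constraints hs' hK ?_)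
    rw [coset_eq_cos] at h
    exact unpaired_of_not_equivalent (x := ⟨i, K⟩) hr hK h

end Datum
end ReflRot

namespace ReflRot

open Module

/-! ### The group of a datum induces this datum -/

namespace Datum

open AdmissibleTriple

set_option linter.unusedSectionVars false

variable {ι : Type*} [Fintype ι] [DecidableEq ι]
  {E : Type*} [NormedAddCommGroup E] [InnerProductSpace ℝ E] [FiniteDimensional ℝ E]
  {D : OrthogonalDecomposition ι E} (A : Datum D)

variable {A}

theorem respects_of_mem_group {a : ∀ i, D.O i} (h : D.blockDiag a ∈ A.group) : A.Respects a := by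
  obtain ⟨b, hb, hba⟩ := Subgroup.mem_map.1 (A.group_le h)
  rw [← D.blockDiag_injective hba]
  exact hb

theorem single_mem_group_of_mem_H {i : ι} {h : D.O i} (hh : h ∈ (A.triple i).H) :
    D.single i h ∈ A.group :=
  Subgroup.subset_closure (Or.inl (Or.inl ⟨i, h, hh, rfl⟩))

theorem pair_mem_group_of_equivalent {i j : ι} (hij : i ≠ j) {s : D.O i} {t : D.O j}
    (hs : s ∈ (A.triple i).refls) (ht : t ∈ (A.triple j).refls)
    (h : A.Equivalent i j ((A.triple i).cos s) ((A.triple j).cos t)) :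
    D.pair i j s t ∈ A.group := by
  refine Subgroup.subset_closure (Or.inl (Or.inr ⟨i, j, ⟨s, hs.1⟩, ⟨t, ht.1⟩, hij, hs.2, ht.2, ?_,
    rfl⟩))
  rwa [coset_eq_cos, coset_eq_cos]

theorem single_mem_group_of_unpaired {i : ι} {K : (A.triple i).Component} {s : D.O i}
    (hs : s ∈ (A.triple i).refls) (hK : (A.triple i).cos s ∈ K.1)
    (h : ∀ y, A.rel ⟨i, K⟩ y → y = ⟨i, K⟩) : D.single i s ∈ A.group := by
  refine Subgroup.subset_closure (Or.inr ⟨i, ⟨s, hs.1⟩, hs.2, ?_, rfl⟩)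
  rintro j t hij ht ⟨K', L, hK', hL, hKL, hne, -⟩
  rw [coset_eq_cos] at hK'
  have := Component.eq_of_mem (cos_mem_reflections _ hs) hK hK'
  subst this
  exact hne (h _ hKL).symm

/-- The equivalent components lie in other factors, where the element is trivial. If `K` is
nontrivial, injectivity of the isomorphism applies; if `K` is trivial, the product of signs reduces
to the sign on `K`, which excludes a reflection. -/
theorem projComp_eq_one_of_single_mem {i : ι} {a : D.O i} (h : D.single i a ∈ A.group)
    {K : (A.triple i).Component} {y : Σ i, (A.triple i).Component} (hy : A.rel ⟨i, K⟩ y)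
    (hne : y ≠ ⟨i, K⟩) : projComp K ((A.triple i).cos a) = 1 := by
  have hr := respects_of_mem_group h
  rw [← coe_blockComp_mulSingle]
  by_cases hK : (A.triple i).IsTrivial K
  · have h1 := hr.prod_eq_one ⟨i, K⟩ y hy hne
    rw [Finset.prod_eq_single_of_mem (⟨i, K⟩ : Σ i, (A.triple i).Component)
      (A.mem_cls.2 (A.rel.refl _))] at h1
    · rcases hK.eq_one_or (A.blockComp ⟨i, K⟩ (Pi.mulSingle i a)).2 with h2 | h2
      · exact h2
      · have h3 : A.blockSign ⟨i, K⟩ (Pi.mulSingle i a) = -1 := signComp_of_mem h2 (Subtype.prop _)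
        rw [h3] at h1
        exact absurd h1 (by decide)
    · intro z hz hzne
      exact blockSign_eq_one (A.blockComp_mulSingle_of_ne
        (ne_factor (A.mem_cls.1 hz) hzne.symm).symm a)
  · have h1 := hr.iso_eq ⟨i, K⟩ y hy hne.symm hK
    rw [A.blockComp_mulSingle_of_ne (ne_factor hy hne.symm).symm, MulEquiv.map_eq_one_iff] at h1
    rw [h1]
    rfl

theorem single_notMem_group {i : ι} {s : D.O i} (hs : s ∈ (A.triple i).refls)
    {K : (A.triple i).Component} (hK : (A.triple i).cos s ∈ K.1)
    {y : Σ i, (A.triple i).Component} (hy : A.rel ⟨i, K⟩ y) (hne : y ≠ ⟨i, K⟩) :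
    D.single i s ∉ A.group := by
  intro h
  have h1 := projComp_eq_one_of_single_mem h hy hne
  have hr := cos_mem_reflections _ hs
  rw [projComp_of_mem hr hK] at h1
  exact (A.triple i).reflections_ne_one hr h1

theorem isTrivial_of_unpaired {x : Σ i, (A.triple i).Component} (h : ∀ y, A.rel x y → y = x) :
    (A.triple x.1).IsTrivial x.2 := by
  by_contra hx
  obtain ⟨y, hy, hne⟩ := exists_partner hx
  exact hne (h y hy)

/-- The projections to components with partners vanish, and by the second condition on data at most
one component is left, which is trivial. So the coset is `1` or a single reflection. -/
theorem cos_of_single_mem {i : ι} {a : D.O i} (h : D.single i a ∈ A.group) :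
    (A.triple i).cos a = 1 ∨ ((A.triple i).cos a ∈ (A.triple i).reflections ∧
      ∃ K : (A.triple i).Component, (A.triple i).IsTrivial K ∧
        ∀ y, A.rel ⟨i, K⟩ y → y = ⟨i, K⟩) := by
  by_cases hex : ∃ K : (A.triple i).Component, ∀ y, A.rel ⟨i, K⟩ y → y = ⟨i, K⟩
  · obtain ⟨K, hK⟩ := hex
    have hKt := isTrivial_of_unpaired hK
    have hmem : (A.triple i).cos a ∈ K.1 := by
      refine mem_of_projComp_eq_one fun L hL => ?_
      by_cases hL' : ∀ y, A.rel ⟨i, L⟩ y → y = ⟨i, L⟩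
      · exact (hL (A.unpaired i L K (isTrivial_of_unpaired hL') hL' hKt hK)).elim
      · push Not at hL'
        obtain ⟨y, hy, hne⟩ := hL'
        exact projComp_eq_one_of_single_mem h hy hne
    rcases IsTrivial.eq_one_or hKt hmem with h1 | h1
    · exact Or.inl h1
    · exact Or.inr ⟨h1, K, hKt, hK⟩
  · left
    push Not at hex
    refine eq_of_projComp_eq fun L => ?_
    obtain ⟨y, hy, hne⟩ := hex L
    rw [projComp_eq_one_of_single_mem h hy hne, map_one]

theorem apply_mem_G {a : ∀ i, D.O i} (h : D.blockDiag a ∈ A.group) (i : ι) :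
    a i ∈ (A.triple i).G := (respects_of_mem_group h).mem_G i

theorem mem_G_of_single_mem {i : ι} {a : D.O i} (h : D.single i a ∈ A.group) :
    a ∈ (A.triple i).G := by
  have := apply_mem_G h i
  rwa [Pi.mulSingle_eq_same] at this

/-- The coset cannot be a reflection, since elements of `H` have determinant one and hence the
determinant is constant on cosets. -/
theorem mem_H_of_single_mem {i : ι} {a : D.O i} (h : D.single i a ∈ A.group) (ha : IsRotation a) :
    a ∈ (A.triple i).H := by
  have haG := mem_G_of_single_mem h
  rcases cos_of_single_mem h with h1 | ⟨h1, -⟩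
  · exact ((A.triple i).cos_eq_one_iff haG).1 h1
  · exfalso
    obtain ⟨s, hs, hsa⟩ := (A.triple i).mem_reflections_iff.1 h1
    have h2 := (A.triple i).detHom_H
      (((A.triple i).cos_eq_cos_iff ((A.triple i).F_le hs.1) haG).1 hsa)
    have h3 : detHom (s * a⁻¹) * detHom a = detHom s := by rw [← map_mul, inv_mul_cancel_right]
    rw [h2, ha.detHom_eq, hs.2.detHom_eq] at h3
    norm_num at h3

theorem mem_G_of_pair_mem {i j : ι} (hij : i ≠ j) {s : D.O i} {t : D.O j}
    (h : D.pair i j s t ∈ A.group) : s ∈ (A.triple i).G ∧ t ∈ (A.triple j).G := by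
  have h1 := apply_mem_G h i
  have h2 := apply_mem_G h j
  rw [Pi.mul_apply, Pi.mulSingle_eq_same, Pi.mulSingle_eq_of_ne hij, mul_one] at h1
  rw [Pi.mul_apply, Pi.mulSingle_eq_same, Pi.mulSingle_eq_of_ne hij.symm, one_mul] at h2
  exact ⟨h1, h2⟩

theorem blockComp_pair_left {i j : ι} (hij : i ≠ j) (K : (A.triple i).Component) (s : D.O i)
    (t : D.O j) : (A.blockComp ⟨i, K⟩ (Pi.mulSingle i s * Pi.mulSingle j t) : (A.triple i).Q) =
      projComp K ((A.triple i).cos s) := by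
  unfold blockComp
  dsimp only [Pi.mul_apply]
  rw [Pi.mulSingle_eq_same, Pi.mulSingle_eq_of_ne hij, mul_one]

theorem blockComp_pair_right {i j : ι} (hij : i ≠ j) (L : (A.triple j).Component) (s : D.O i)
    (t : D.O j) : (A.blockComp ⟨j, L⟩ (Pi.mulSingle i s * Pi.mulSingle j t) : (A.triple j).Q) =
      projComp L ((A.triple j).cos t) := by
  unfold blockComp
  dsimp only [Pi.mul_apply]
  rw [Pi.mulSingle_eq_same, Pi.mulSingle_eq_of_ne hij.symm, one_mul]

theorem blockComp_pair_of_ne {i j : ι} {x : Σ i, (A.triple i).Component} (hi : x.1 ≠ i)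
    (hj : x.1 ≠ j) (s : D.O i) (t : D.O j) :
    A.blockComp x (Pi.mulSingle i s * Pi.mulSingle j t) = 1 := by
  refine Subtype.ext ?_
  unfold blockComp
  dsimp only [Pi.mul_apply]
  rw [Pi.mulSingle_eq_of_ne hi, Pi.mulSingle_eq_of_ne hj, mul_one, cos_one, map_one]
  rfl

theorem mem_of_projComp_ne_one {i : ι} {K : (A.triple i).Component} {s : D.O i}
    (hs : s ∈ (A.triple i).refls) (h : projComp K ((A.triple i).cos s) ≠ 1) :
    (A.triple i).cos s ∈ K.1 := by
  by_contra h'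
  exact h (projComp_of_notMem (cos_mem_reflections _ hs) h')

/-- If a rotation of the second kind in the group has a block that is not in the group, then its
blocks correspond to each other. -/
theorem exists_rel_of_pair_mem {i j : ι} (hij : i ≠ j) {s : D.O i} {t : D.O j}
    (hs : s ∈ (A.triple i).refls) (ht : t ∈ (A.triple j).refls) (h : D.pair i j s t ∈ A.group)
    (hn : D.single i s ∉ A.group) {K : (A.triple i).Component} (hK : (A.triple i).cos s ∈ K.1) :
    ∃ L : (A.triple j).Component, (A.triple j).cos t ∈ L.1 ∧ A.rel ⟨i, K⟩ ⟨j, L⟩ := by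
  have hr := respects_of_mem_group h
  have hsr := cos_mem_reflections _ hs
  obtain ⟨y, hy, hne⟩ : ∃ y, A.rel ⟨i, K⟩ y ∧ y ≠ ⟨i, K⟩ := by
    by_contra! hcon
    exact hn (single_mem_group_of_unpaired hs hK hcon)
  -- Some equivalent component must respond to the reflection in `K`: otherwise the product of signs
  -- would be `-1`, or an isomorphism would kill a reflection. It lies in the only other block
  -- involved, the `j`-th.
  obtain ⟨z, hz, hzne, hz1⟩ : ∃ z, A.rel ⟨i, K⟩ z ∧ z ≠ ⟨i, K⟩ ∧
      A.blockComp z (Pi.mulSingle i s * Pi.mulSingle j t) ≠ 1 := by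
    have hx : A.blockComp ⟨i, K⟩ (Pi.mulSingle i s * Pi.mulSingle j t) = ⟨_, hK⟩ :=
      Subtype.ext ((blockComp_pair_left hij K s t).trans (projComp_of_mem hsr hK))
    by_cases hKt : (A.triple i).IsTrivial K
    · by_contra! hcon
      have h1 := hr.prod_eq_one ⟨i, K⟩ y hy hne
      rw [Finset.prod_eq_single_of_mem (⟨i, K⟩ : Σ i, (A.triple i).Component)
        (A.mem_cls.2 (A.rel.refl _)) fun z hz hzne =>
          blockSign_eq_one (hcon z (A.mem_cls.1 hz) hzne)] at h1
      have h3 : A.blockSign ⟨i, K⟩ (Pi.mulSingle i s * Pi.mulSingle j t) = -1 := by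
        rw [blockSign, hx]
        exact signComp_of_mem hsr hK
      rw [h3] at h1
      exact absurd h1 (by decide)
    · refine ⟨y, hy, hne, fun h1 => ?_⟩
      have h2 := hr.iso_eq ⟨i, K⟩ y hy hne.symm hKt
      rw [h1, hx, MulEquiv.map_eq_one_iff] at h2
      exact (A.triple i).reflections_ne_one hsr (congrArg Subtype.val h2)
  obtain ⟨k, L⟩ := z
  have hki : k ≠ i := (ne_factor hz hzne.symm).symm
  have hkj : k = j := by
    by_contra hkj
    exact hz1 (blockComp_pair_of_ne (x := ⟨k, L⟩) hki hkj s t)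
  subst hkj
  refine ⟨L, mem_of_projComp_ne_one ht fun h1 => hz1 (Subtype.ext ?_), hz⟩
  exact (blockComp_pair_right hij L s t).trans h1

theorem iso_eq_of_pair_mem {i j : ι} (hij : i ≠ j) {s : D.O i} {t : D.O j}
    (hs : s ∈ (A.triple i).refls) (ht : t ∈ (A.triple j).refls) (h : D.pair i j s t ∈ A.group)
    {K : (A.triple i).Component} (hK : (A.triple i).cos s ∈ K.1) {L : (A.triple j).Component}
    (hKL : A.rel ⟨i, K⟩ ⟨j, L⟩) (hne) (hx : ¬ (A.triple i).IsTrivial K) :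
    (A.iso ⟨i, K⟩ ⟨j, L⟩ hKL hne hx ⟨_, hK⟩ : (A.triple j).Q) = (A.triple j).cos t := by
  have hsr := cos_mem_reflections _ hs
  have h1 := (respects_of_mem_group h).iso_eq ⟨i, K⟩ ⟨j, L⟩ hKL hne hx
  have hx : A.blockComp ⟨i, K⟩ (Pi.mulSingle i s * Pi.mulSingle j t) = ⟨_, hK⟩ :=
    Subtype.ext ((blockComp_pair_left hij K s t).trans (projComp_of_mem hsr hK))
  rw [hx] at h1
  have h2 := (congrArg Subtype.val h1).trans (blockComp_pair_right hij L s t)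
  rw [projComp_of_mem (cos_mem_reflections _ ht)] at h2
  · exact h2
  · refine mem_of_projComp_ne_one ht fun h3 => ?_
    have h4 : A.blockComp ⟨j, L⟩ (Pi.mulSingle i s * Pi.mulSingle j t) = 1 :=
      Subtype.ext ((blockComp_pair_right hij L s t).trans h3)
    rw [h4, MulEquiv.map_eq_one_iff] at h1
    exact (A.triple i).reflections_ne_one hsr (congrArg Subtype.val h1)

theorem single_or_pair_mem_group {i : ι} {s : D.O i} (hs : s ∈ (A.triple i).refls) :
    D.single i s ∈ A.group ∨ ∃ (j : ι) (t : D.O j), i ≠ j ∧ t ∈ (A.triple j).refls ∧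
      D.pair i j s t ∈ A.group := by
  have hr := cos_mem_reflections _ hs
  have hK := (A.triple i).mem_compOf ⟨_, hr⟩
  by_cases h : ∀ y, A.rel ⟨i, (A.triple i).compOf ⟨_, hr⟩⟩ y →
    y = ⟨i, (A.triple i).compOf ⟨_, hr⟩⟩
  · exact Or.inl (single_mem_group_of_unpaired hs hK h)
  · push Not at h
    obtain ⟨y, hy, hne⟩ := h
    obtain ⟨q, hq, -, heq⟩ := A.exists_equivalent hy hne.symm hr hK
    obtain ⟨t, ht, rfl⟩ := (A.triple y.1).mem_reflections_iff.1 hq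
    have hij : i ≠ y.1 := ne_factor hy hne.symm
    exact Or.inr ⟨y.1, t, hij, ht, pair_mem_group_of_equivalent hij hs ht heq⟩

theorem group_isInvariant (i : ι) : IsInvariant A.group (D.V i) := by
  intro g hg v hv
  obtain ⟨a, -, rfl⟩ := Subgroup.mem_map.1 (A.group_le hg)
  exact D.blockDiag_mem a i hv

variable (A) in
theorem finite_group : Finite A.group := by
  have hfin : {a : ∀ i, D.O i | ∀ i, a i ∈ (A.triple i).G}.Finite := by
    refine Set.Finite.pi' fun i => ?_
    have := (A.triple i).finite
    exact Set.toFinite ((A.triple i).G : Set (D.O i))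
  refine Set.finite_coe_iff.2 ((hfin.image D.blockDiag).subset fun g hg => ?_)
  obtain ⟨a, ha, rfl⟩ := Subgroup.mem_map.1 (A.group_le hg)
  exact ⟨a, ha.mem_G, rfl⟩

theorem proj_group (i : ι) : D.proj A.group i = (A.triple i).G := by
  refine le_antisymm ?_ ?_
  · intro a ha
    obtain ⟨b, hb, rfl⟩ := (D.mem_proj_iff group_isInvariant).1 ha
    exact apply_mem_G hb i
  · rw [← (A.triple i).generated]
    refine sup_le (fun h hh => D.mem_proj_of_single_mem (single_mem_group_of_mem_H hh)) ?_
    rw [← (A.triple i).closure_refls]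
    refine (Subgroup.closure_le _).2 fun s hs => ?_
    rcases single_or_pair_mem_group hs with h | ⟨j, t, hij, -, h⟩
    · exact D.mem_proj_of_single_mem h
    · exact D.left_mem_proj_of_pair_mem hij h

variable (A) in
theorem group_isGroupWithComponents : D.IsGroupWithComponents A.group where
  invariant := group_isInvariant
  irreducible i := by
    rw [proj_group]
    exact (A.triple i).irreducible
  reflectionRotation := by
    refine ⟨A.finite_group, le_antisymm ((Subgroup.closure_le _).2 fun g hg => hg.1) ?_⟩
    refine (Subgroup.closure_le _).2 ?_
    rintro g hg
    have hgG : g ∈ A.group := Subgroup.subset_closure hg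
    rcases hg with (⟨i, h, hh, rfl⟩ | ⟨i, j, s, t, hij, hs, ht, -, rfl⟩) | ⟨i, s, hs, -, rfl⟩
    · have hh' := hh
      rw [← (A.triple i).H_rotation.generated] at hh'
      have hle : Subgroup.closure {a | a ∈ (A.triple i).H ∧ IsRotation a} ≤
          (Subgroup.closure {g | g ∈ A.group ∧ (IsReflection g ∨ IsRotation g)}).comap
            (D.singleHom i) := by
        refine (Subgroup.closure_le _).2 fun a ha => ?_
        exact Subgroup.subset_closure ⟨single_mem_group_of_mem_H ha.1,
          Or.inr (D.isRotation_single.2 ha.2)⟩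
      exact hle hh'
    · exact Subgroup.subset_closure ⟨hgG, Or.inr (D.isRotation_pair hij hs ht)⟩
    · exact Subgroup.subset_closure ⟨hgG, Or.inl (D.isReflection_single.2 hs)⟩

variable (A) in
theorem isInducedBy_group : A.IsInducedBy A.group where
  G_eq i := (proj_group i).symm
  H_eq i := by
    rw [D.proj_firstKindSubgroup, ← (A.triple i).H_rotation.generated]
    congr 1
    ext a
    exact ⟨fun h => ⟨h.2, single_mem_group_of_mem_H h.1⟩,
      fun h => ⟨mem_H_of_single_mem h.2 h.1, h.1⟩⟩
  F_eq i := by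
    rw [D.proj_secondKindSubgroup group_isInvariant, ← (A.triple i).closure_refls]
    congr 1
    ext s
    constructor
    · intro hs
      refine ⟨hs.2, ?_⟩
      rcases single_or_pair_mem_group hs with h | ⟨j, t, hij, ht, h⟩
      · exact Or.inl h
      · exact Or.inr ⟨j, t, hij, ht.2, h⟩
    · rintro ⟨hs, h | ⟨j, t, hij, -, h⟩⟩
      -- The constraints only place the block in `G i`; that it lies in `F i` is the theorem that
      -- `F` contains all reflections of `G`.
      · exact (A.triple i).mem_refls (mem_G_of_single_mem h) hs
      · exact (A.triple i).mem_refls (mem_G_of_pair_mem hij h).1 hs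
  rel_iff x y := by
    constructor
    · intro hxy
      by_cases hne : x = y
      · exact Or.inl hne
      have hfac := ne_factor hxy hne
      obtain ⟨p, hp, hpx⟩ := x.2.exists_mem
      obtain ⟨q, hq, hqy, heq⟩ := A.exists_equivalent hxy hne hp hpx
      obtain ⟨s, hs, rfl⟩ := (A.triple x.1).mem_reflections_iff.1 hp
      obtain ⟨t, ht, rfl⟩ := (A.triple y.1).mem_reflections_iff.1 hq
      refine Or.inr ⟨hfac, ⟨s, hs.1⟩, ⟨t, ht.1⟩, hs.2, ht.2, ?_, ?_, ?_, ?_⟩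
      · rwa [coset_eq_cos]
      · rwa [coset_eq_cos]
      · exact single_notMem_group hs hpx hxy (Ne.symm hne)
      · exact pair_mem_group_of_equivalent hfac hs ht heq
    · rintro (rfl | ⟨hfac, s, t, hs, ht, hsx, hty, hn, hpair⟩)
      · exact A.rel.refl _
      · rw [coset_eq_cos] at hsx hty
        obtain ⟨L, hL, hrel⟩ := exists_rel_of_pair_mem hfac ⟨s.2, hs⟩ ⟨t.2, ht⟩ hpair hn hsx
        rw [Component.eq_of_mem (cos_mem_reflections (T := A.triple y.1) ⟨t.2, ht⟩) hL hty] at hrel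
        exact hrel
  iso_iff x y hxy hne hx s t hs ht hsx := by
    have hfac := ne_factor hxy hne
    have hsx' := hsx
    rw [coset_eq_cos] at hsx'
    constructor
    · intro h
      refine ⟨single_notMem_group ⟨s.2, hs⟩ hsx' hxy (Ne.symm hne),
        pair_mem_group_of_equivalent hfac ⟨s.2, hs⟩ ⟨t.2, ht⟩ ?_⟩
      rw [← coset_eq_cos, ← coset_eq_cos]
      exact ⟨x.2, y.2, hsx, h ▸ Subtype.prop _, hxy, hne, fun _ => h⟩
    · rintro ⟨-, h⟩
      have key : ∀ (p : (A.triple x.1).Q) (hp : p ∈ x.2.1), (A.triple x.1).cos s = p →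
          (A.iso x y hxy hne hx ⟨p, hp⟩ : (A.triple y.1).Q) = (A.triple y.1).cos t := by
        rintro p hp rfl
        exact iso_eq_of_pair_mem hfac ⟨s.2, hs⟩ ⟨t.2, ht⟩ h hp hxy hne hx
      rw [coset_eq_cos _ t]
      exact key _ hsx ((A.triple x.1).coset_eq_cos s).symm

variable (A) in
theorem exists_isReflection_iff :
    (∃ g ∈ A.group, IsReflection g) ↔ A.HasUnpairedTrivialComponent := by
  constructor
  · rintro ⟨g, hg, hrefl⟩
    obtain ⟨a, -, rfl⟩ := Subgroup.mem_map.1 (A.group_le hg)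
    obtain ⟨i, hi, hai⟩ := D.exists_of_isReflection hrefl
    have hmem : D.single i (a i) ∈ A.group := hai ▸ hg
    rcases cos_of_single_mem hmem with h | ⟨-, K, hK, hun⟩
    · rw [(A.triple i).cos_eq_one_iff (mem_G_of_single_mem hmem)] at h
      exact ((A.triple i).isReflection_notMem_H hi h).elim
    · exact ⟨⟨i, K⟩, hK, hun⟩
  · rintro ⟨x, -, hun⟩
    obtain ⟨p, hp, hpx⟩ := x.2.exists_mem
    obtain ⟨s, hs, rfl⟩ := (A.triple x.1).mem_reflections_iff.1 hp
    exact ⟨_, single_mem_group_of_unpaired hs hpx hun, D.isReflection_single.2 hs.2⟩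

end Datum
end ReflRot

namespace ReflRot

open Module

theorem conj_mem_closure {Q : Type*} [Group Q] {S : Set Q} {g : Q} (hS : ∀ s ∈ S, g * s * g⁻¹ ∈ S)
    {h : Q} (hh : h ∈ Subgroup.closure S) : g * h * g⁻¹ ∈ Subgroup.closure S := by
  have hle : Subgroup.closure S ≤ (Subgroup.closure S).comap (MulAut.conj g).toMonoidHom :=
    (Subgroup.closure_le _).2 fun s hs => Subgroup.subset_closure (hS s hs)
  exact hle hh

/-! ### The admissible triples and the relation between reflections induced by a group -/

namespace OrthogonalDecomposition

namespace IsGroupWithComponents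

open AdmissibleTriple

set_option linter.unusedSectionVars false

variable {ι : Type*} [Fintype ι] [DecidableEq ι]
  {E : Type*} [NormedAddCommGroup E] [InnerProductSpace ℝ E] [FiniteDimensional ℝ E]
  {D : OrthogonalDecomposition ι E} {G : Subgroup (E ≃ₗᵢ[ℝ] E)}

theorem proj_firstKindSubgroup_le (G : Subgroup (E ≃ₗᵢ[ℝ] E)) {i : ι} {h : D.O i}
    (hh : h ∈ D.proj (D.firstKindSubgroup G) i) : D.single i h ∈ G := by
  rw [D.proj_firstKindSubgroup] at hh
  have hle : Subgroup.closure {a | IsRotation a ∧ D.single i a ∈ G} ≤ G.comap (D.singleHom i) :=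
    (Subgroup.closure_le _).2 fun a ha => ha.2
  exact hle hh

theorem conj_mem_blockReflections {i : ι} {b : ∀ i, D.O i} (hb : D.blockDiag b ∈ G) {s : D.O i}
    (hs : s ∈ D.blockReflections G i) : b i * s * (b i)⁻¹ ∈ D.blockReflections G i := by
  obtain ⟨hs, h | ⟨j, t, hij, ht, h⟩⟩ := hs
  · refine ⟨hs.conj _, Or.inl ?_⟩
    rw [← D.blockDiag_conj_mulSingle]
    exact mul_mem (mul_mem hb h) (inv_mem hb)
  · refine ⟨hs.conj _, Or.inr ⟨j, b j * t * (b j)⁻¹, hij, ht.conj _, ?_⟩⟩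
    rw [← D.blockDiag_conj_pair]
    exact mul_mem (mul_mem hb h) (inv_mem hb)

theorem blockReflections_subset_proj (G : Subgroup (E ≃ₗᵢ[ℝ] E)) (i : ι) :
    D.blockReflections G i ⊆ D.proj G i := by
  rintro s ⟨-, h | ⟨j, t, hij, -, h⟩⟩
  · exact D.mem_proj_of_single_mem h
  · exact D.left_mem_proj_of_pair_mem hij h

variable (hG : D.IsGroupWithComponents G)
include hG

theorem finite_proj (i : ι) : Finite (D.proj G i) := by
  have := hG.reflectionRotation.finite
  have h1 : {b | D.blockDiag b ∈ G}.Finite :=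
    Set.Finite.preimage D.blockDiag_injective.injOn (Set.toFinite (G : Set (E ≃ₗᵢ[ℝ] E)))
  refine Set.finite_coe_iff.2 ((h1.image fun b => b i).subset fun a ha => ?_)
  obtain ⟨b, hb, rfl⟩ := (D.mem_proj_iff hG.invariant).1 ha
  exact ⟨b, hb, rfl⟩

/-- The generating reflections are stable under conjugation, so the group they generate has no
further reflections. -/
theorem mem_blockReflections {i : ι} {s : D.O i} (hs : IsReflection s)
    (hsF : s ∈ D.proj (D.secondKindSubgroup G) i) : s ∈ D.blockReflections G i := by
  rw [D.proj_secondKindSubgroup hG.invariant] at hsF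
  refine IsReflection.mem_of_mem_closure (fun r hr => hr.1) (fun r hr s hs => ?_) ?_ hs hsF
  · obtain ⟨b, hb, rfl⟩ :=
      (D.mem_proj_iff hG.invariant).1 (blockReflections_subset_proj G i hr)
    exact conj_mem_blockReflections hb hs
  · have := hG.finite_proj i
    have hle : Subgroup.closure (D.blockReflections G i) ≤ D.proj G i :=
      (Subgroup.closure_le _).2 (blockReflections_subset_proj G i)
    exact Finite.of_injective _ (Subgroup.inclusion_injective hle)

theorem exists_blockDiag_set : ∃ X : Set (∀ i, D.O i),
    (∀ b ∈ X, D.blockDiag b ∈ G ∧ (IsReflection (D.blockDiag b) ∨ IsRotation (D.blockDiag b))) ∧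
    G = Subgroup.closure (D.blockDiag '' X) := by
  refine ⟨{b | D.blockDiag b ∈ G ∧ (IsReflection (D.blockDiag b) ∨ IsRotation (D.blockDiag b))},
    fun b hb => hb, ?_⟩
  nth_rewrite 1 [← hG.reflectionRotation.generated]
  congr 1
  ext g
  constructor
  · rintro ⟨hg, h⟩
    obtain ⟨b, rfl⟩ := D.exists_blockDiag fun i v hv => hG.invariant i g hg v hv
    exact ⟨b, ⟨hg, h⟩, rfl⟩
  · rintro ⟨b, hb, rfl⟩
    exact hb

/-- The admissible triple on a summand that is induced by a group. -/
def triple (i : ι) : AdmissibleTriple (D.V i) where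
  G := D.proj G i
  H := D.proj (D.firstKindSubgroup G) i
  F := D.proj (D.secondKindSubgroup G) i
  finite := hG.finite_proj i
  irreducible := hG.irreducible i
  H_le _ hh := D.mem_proj_of_single_mem (proj_firstKindSubgroup_le G hh)
  F_le := by
    rw [D.proj_secondKindSubgroup hG.invariant, Subgroup.closure_le]
    exact blockReflections_subset_proj G i
  H_rotation := by
    have hle : D.proj (D.firstKindSubgroup G) i ≤ D.proj G i :=
      fun _ hh => D.mem_proj_of_single_mem (proj_firstKindSubgroup_le G hh)
    have := hG.finite_proj i
    refine ⟨Finite.of_injective _ (Subgroup.inclusion_injective hle),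
      le_antisymm ((Subgroup.closure_le _).2 fun g hg => hg.1) ?_⟩
    nth_rewrite 1 [D.proj_firstKindSubgroup]
    refine (Subgroup.closure_le _).2 fun a ha => Subgroup.subset_closure ⟨?_, ha.1⟩
    rw [D.proj_firstKindSubgroup]
    exact Subgroup.subset_closure ha
  F_reflection := by
    have hle : D.proj (D.secondKindSubgroup G) i ≤ D.proj G i := by
      rw [D.proj_secondKindSubgroup hG.invariant, Subgroup.closure_le]
      exact blockReflections_subset_proj G i
    have := hG.finite_proj i
    refine ⟨Finite.of_injective _ (Subgroup.inclusion_injective hle),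
      le_antisymm ((Subgroup.closure_le _).2 fun g hg => hg.1) ?_⟩
    nth_rewrite 1 [D.proj_secondKindSubgroup hG.invariant]
    refine (Subgroup.closure_le _).2 fun a ha => Subgroup.subset_closure ⟨?_, ha.1⟩
    rw [D.proj_secondKindSubgroup hG.invariant]
    exact Subgroup.subset_closure ha
  H_normal := by
    refine ⟨fun h hh g => ?_⟩
    have hh' : (h : D.O i) ∈ D.proj (D.firstKindSubgroup G) i := hh
    obtain ⟨b, hb, hbg⟩ := (D.mem_proj_iff hG.invariant).1 g.2
    change (g : D.O i) * h * (g : D.O i)⁻¹ ∈ D.proj (D.firstKindSubgroup G) i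
    rw [D.proj_firstKindSubgroup] at hh' ⊢
    rw [← hbg]
    refine conj_mem_closure (fun a ha => ?_) hh'
    refine ⟨ha.1.conj _, ?_⟩
    rw [← D.blockDiag_conj_mulSingle]
    exact mul_mem (mul_mem hb ha.2) (inv_mem hb)
  F_normal := by
    refine ⟨fun h hh g => ?_⟩
    have hh' : (h : D.O i) ∈ D.proj (D.secondKindSubgroup G) i := hh
    obtain ⟨b, hb, hbg⟩ := (D.mem_proj_iff hG.invariant).1 g.2
    change (g : D.O i) * h * (g : D.O i)⁻¹ ∈ D.proj (D.secondKindSubgroup G) i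
    rw [D.proj_secondKindSubgroup hG.invariant] at hh' ⊢
    rw [← hbg]
    exact conj_mem_closure (fun a ha => conj_mem_blockReflections hb ha) hh'
  generated := by
    rw [D.proj_firstKindSubgroup, D.proj_secondKindSubgroup hG.invariant]
    refine le_antisymm (sup_le ?_ ?_) ?_
    · exact (Subgroup.closure_le _).2 fun a ha => D.mem_proj_of_single_mem ha.2
    · exact (Subgroup.closure_le _).2 (blockReflections_subset_proj G i)
    · obtain ⟨X, hX, hGX⟩ := hG.exists_blockDiag_set
      have hproj : D.proj G i = Subgroup.closure ((fun a => a i) '' X) := by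
        rw [← D.proj_closure, ← hGX]
      rw [hproj]
      refine (Subgroup.closure_le _).2 ?_
      rintro _ ⟨b, hb, rfl⟩
      obtain ⟨hbG, hb⟩ := hX b hb
      dsimp only
      have hsingle : ∀ j, D.blockDiag b = D.single j (b j) → i ≠ j → b i = 1 := by
        intro j hbj hij
        have : b = Pi.mulSingle j (b j) := D.blockDiag_injective hbj
        rw [this, Pi.mulSingle_eq_of_ne hij]
      have hH : D.single i (b i) ∈ G → IsRotation (b i) →
          b i ∈ Subgroup.closure {a | IsRotation a ∧ D.single i a ∈ G} ⊔
            Subgroup.closure (D.blockReflections G i) := fun h h' =>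
        (le_sup_left : _ ≤ Subgroup.closure {a | IsRotation a ∧ D.single i a ∈ G} ⊔
            Subgroup.closure (D.blockReflections G i)) (Subgroup.subset_closure ⟨h', h⟩)
      have hF : b i ∈ D.blockReflections G i →
          b i ∈ Subgroup.closure {a | IsRotation a ∧ D.single i a ∈ G} ⊔
            Subgroup.closure (D.blockReflections G i) := fun h =>
        (le_sup_right : _ ≤ Subgroup.closure {a | IsRotation a ∧ D.single i a ∈ G} ⊔
            Subgroup.closure (D.blockReflections G i)) (Subgroup.subset_closure h)
      rcases hb with hb | hb
      · obtain ⟨j, hj, hbj⟩ := D.exists_of_isReflection hb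
        by_cases hij : i = j
        · subst hij
          exact hF ⟨hj, Or.inl (hbj ▸ hbG)⟩
        · rw [hsingle j hbj hij]
          exact one_mem _
      · rcases D.exists_of_isRotation hb with ⟨j, hj, hbj⟩ | ⟨j, k, hjk, hj, hk, hbj⟩
        · by_cases hij : i = j
          · subst hij
            exact hH (hbj ▸ hbG) hj
          · rw [hsingle j hbj hij]
            exact one_mem _
        · have hb' : b = Pi.mulSingle j (b j) * Pi.mulSingle k (b k) := D.blockDiag_injective hbj
          by_cases hij : i = j
          · subst hij
            exact hF ⟨hj, Or.inr ⟨k, b k, hjk, hk, hbj ▸ hbG⟩⟩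
          · by_cases hik : i = k
            · subst hik
              refine hF ⟨hk, Or.inr ⟨j, b j, hij, hj, ?_⟩⟩
              rw [D.pair_symm hij, ← hbj]
              exact hbG
            · rw [hb', Pi.mul_apply, Pi.mulSingle_eq_of_ne hij, Pi.mulSingle_eq_of_ne hik, mul_one]
              exact one_mem _
  -- Extended by the identity, `h` lies in the group, so it can be multiplied onto the reflection or
  -- the pair that has `s` as a block.
  mem_F h hh s hs hrefl hrefl' := by
    have hhG := proj_firstKindSubgroup_le G hh
    rw [D.proj_secondKindSubgroup hG.invariant]
    refine Subgroup.subset_closure ⟨hrefl', ?_⟩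
    rcases (hG.mem_blockReflections hrefl hs).2 with h1 | ⟨j, t, hij, ht, h1⟩
    · left
      rw [D.single_mul]
      exact mul_mem hhG h1
    · refine Or.inr ⟨j, t, hij, ht, ?_⟩
      rw [D.pair_eq, D.single_mul, mul_assoc, ← D.pair_eq]
      exact mul_mem hhG h1

theorem refls_triple (i : ι) : (hG.triple i).refls = D.blockReflections G i := by
  ext s
  constructor
  · exact fun hs => hG.mem_blockReflections hs.2 hs.1
  · intro hs
    refine ⟨?_, hs.1⟩
    change s ∈ D.proj (D.secondKindSubgroup G) i
    rw [D.proj_secondKindSubgroup hG.invariant]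
    exact Subgroup.subset_closure hs

theorem single_mem_of_mem_H {i : ι} {h : D.O i} (hh : h ∈ (hG.triple i).H) : D.single i h ∈ G :=
  proj_firstKindSubgroup_le G hh

theorem mem_H_of_single_mem {i : ι} {a : D.O i} (h : D.single i a ∈ G)
    (ha : a = 1 ∨ IsRotation a) : a ∈ (hG.triple i).H := by
  rcases ha with rfl | ha
  · exact one_mem _
  · change a ∈ D.proj (D.firstKindSubgroup G) i
    rw [D.proj_firstKindSubgroup]
    exact Subgroup.subset_closure ⟨ha, h⟩

theorem single_mem_iff_of_cos_eq {i : ι} {s s' : D.O i} (hs : s ∈ (hG.triple i).G)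
    (hs' : s' ∈ (hG.triple i).G) (h : (hG.triple i).cos s = (hG.triple i).cos s') :
    D.single i s ∈ G ↔ D.single i s' ∈ G := by
  have h1 := hG.single_mem_of_mem_H (((hG.triple i).cos_eq_cos_iff hs hs').1 h)
  rw [← Subgroup.mul_mem_cancel_left G h1 (y := D.single i s'), ← D.single_mul,
    inv_mul_cancel_right]

theorem pair_mem_iff_of_cos_eq {i j : ι} {s s' : D.O i} {t : D.O j} (hs : s ∈ (hG.triple i).G)
    (hs' : s' ∈ (hG.triple i).G) (h : (hG.triple i).cos s = (hG.triple i).cos s') :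
    D.pair i j s t ∈ G ↔ D.pair i j s' t ∈ G := by
  have h1 := hG.single_mem_of_mem_H (((hG.triple i).cos_eq_cos_iff hs hs').1 h)
  rw [← Subgroup.mul_mem_cancel_left G h1 (y := D.pair i j s' t), D.pair_eq i j s' t, ← mul_assoc,
    ← D.single_mul, inv_mul_cancel_right, D.pair_eq]

/-- A product of two reflections is trivial or a rotation, so in a single block it is trivial or of
the first kind. -/
theorem cos_eq_of_mul_mem {i : ι} {s u : D.O i} (hs : s ∈ (hG.triple i).refls)
    (hu : u ∈ (hG.triple i).refls) (h : D.single i (s * u) ∈ G) :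
    (hG.triple i).cos s = (hG.triple i).cos u := by
  rw [cos_eq_cos_iff _ ((hG.triple i).F_le hs.1) ((hG.triple i).F_le hu.1), hu.2.inv_eq]
  exact hG.mem_H_of_single_mem h (hs.2.mul_eq_one_or_isRotation hu.2)

/-- The commutator is itself a product of two reflections, `s * u * s⁻¹` and `u`. -/
theorem commute_of_commutator_mem {i : ι} {s u : D.O i} (hs : s ∈ (hG.triple i).refls)
    (hu : u ∈ (hG.triple i).refls) (h : D.single i (s * u * s⁻¹ * u⁻¹) ∈ G) :
    Commute ((hG.triple i).cos s) ((hG.triple i).cos u) := by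
  have hsG := (hG.triple i).F_le hs.1
  have huG := (hG.triple i).F_le hu.1
  have h1 := hG.cos_eq_of_mul_mem ((hG.triple i).conj_mem_refls hsG hu) hu
    (by rwa [hu.2.inv_eq] at h)
  rw [cos_mul _ (mul_mem hsG huG) (inv_mem hsG), cos_mul _ hsG huG, cos_inv _ hsG,
    mul_inv_eq_iff_eq_mul] at h1
  exact h1

omit hG in
theorem commutator_pair_single {i j : ι} (hij : i ≠ j) (s : D.O i) (t t' : D.O j) :
    D.pair i j s t * D.single j t' * (D.pair i j s t)⁻¹ * (D.single j t')⁻¹ =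
      D.single j (t * t' * t⁻¹ * t'⁻¹) := by
  unfold pair
  rw [D.blockDiag_conj_mulSingle, Pi.mul_apply, Pi.mulSingle_eq_same, Pi.mulSingle_eq_of_ne hij.symm,
    one_mul, ← D.single_inv, ← D.single_mul]

omit hG in
theorem commutator_pair_pair {i j k : ι} (hij : i ≠ j) (hik : i ≠ k) (hjk : j ≠ k) (s : D.O i)
    (t t' : D.O j) (v : D.O k) :
    D.pair i j s t * D.pair j k t' v * (D.pair i j s t)⁻¹ * (D.pair j k t' v)⁻¹ =
      D.single j (t * t' * t⁻¹ * t'⁻¹) := by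
  have h := D.blockDiag_conj_pair (Pi.mulSingle i s * Pi.mulSingle j t) j k t' v
  change D.pair i j s t * D.pair j k t' v * (D.pair i j s t)⁻¹ = _ at h
  rw [h, Pi.mul_apply, Pi.mul_apply, Pi.mulSingle_eq_same,
    Pi.mulSingle_eq_of_ne hij.symm, Pi.mulSingle_eq_of_ne hjk.symm, Pi.mulSingle_eq_of_ne hik.symm,
    ← D.pair_inv hjk, ← D.pair_mul hjk, D.pair_eq]
  simp [D.single_one]

omit hG in
theorem commutator_pair_pair_symm {i j : ι} (hij : i ≠ j) (s v : D.O i) (t t' : D.O j) :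
    D.pair i j s t * D.pair i j v t' * (D.pair i j s t)⁻¹ * (D.pair i j v t')⁻¹ =
      D.pair i j (s * v * s⁻¹ * v⁻¹) (t * t' * t⁻¹ * t'⁻¹) := by
  rw [← D.pair_inv hij, ← D.pair_inv hij, ← D.pair_mul hij, ← D.pair_mul hij, ← D.pair_mul hij]

/-- A rotation of the second kind in `G` and one that meets it in one summand only have commuting
blocks in this summand. -/
theorem commute_of_pair_mem {i j k : ι} (hij : i ≠ j) (hik : i ≠ k) (hjk : j ≠ k) {s : D.O i}
    {t t' : D.O j} {v : D.O k} (ht : t ∈ (hG.triple j).refls) (ht' : t' ∈ (hG.triple j).refls)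
    (h : D.pair i j s t ∈ G) (h' : D.pair j k t' v ∈ G) :
    Commute ((hG.triple j).cos t) ((hG.triple j).cos t') := by
  refine hG.commute_of_commutator_mem ht ht' ?_
  rw [← commutator_pair_pair hij hik hjk s t t' v]
  exact mul_mem (mul_mem (mul_mem h h') (inv_mem h)) (inv_mem h')

theorem single_mem_or_related {i : ι} {s : D.O i} (hs : s ∈ (hG.triple i).refls) :
    D.single i s ∈ G ∨ ∃ (j : ι) (t : D.O j), i ≠ j ∧ t ∈ (hG.triple j).refls ∧
      D.Related G i j s t := by
  have hs' := hs
  rw [hG.refls_triple] at hs'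
  by_cases h0 : D.single i s ∈ G
  · exact Or.inl h0
  rcases hs'.2 with h | ⟨j, t, hij, ht, h⟩
  · exact Or.inl h
  · refine Or.inr ⟨j, t, hij, ?_, h0, h⟩
    rw [hG.refls_triple]
    refine ⟨ht, Or.inr ⟨i, s, hij.symm, hs.2, ?_⟩⟩
    rwa [D.pair_symm hij.symm]

omit hG in
theorem related_symm {i j : ι} (hij : i ≠ j) {s : D.O i} {t : D.O j} (h : D.Related G i j s t) :
    D.Related G j i t s := by
  refine ⟨fun ht => h.1 ?_, by rw [D.pair_symm hij.symm]; exact h.2⟩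
  have := h.2
  rwa [D.pair_eq, Subgroup.mul_mem_cancel_right G ht] at this

theorem related_congr_left {i j : ι} {s s' : D.O i} {t : D.O j} (hs : s ∈ (hG.triple i).refls)
    (hs' : s' ∈ (hG.triple i).refls) (h : (hG.triple i).cos s = (hG.triple i).cos s') :
    D.Related G i j s t ↔ D.Related G i j s' t := by
  have h1 := (hG.triple i).F_le hs.1
  have h2 := (hG.triple i).F_le hs'.1
  unfold Related
  rw [hG.single_mem_iff_of_cos_eq h1 h2 h, hG.pair_mem_iff_of_cos_eq h1 h2 h]

theorem related_congr_right {i j : ι} (hij : i ≠ j) {s : D.O i} {t t' : D.O j}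
    (ht : t ∈ (hG.triple j).refls) (ht' : t' ∈ (hG.triple j).refls)
    (h : (hG.triple j).cos t = (hG.triple j).cos t') :
    D.Related G i j s t ↔ D.Related G i j s t' :=
  ⟨fun h' => related_symm hij.symm ((hG.related_congr_left ht ht' h).1 (related_symm hij h')),
    fun h' => related_symm hij.symm ((hG.related_congr_left ht ht' h).2 (related_symm hij h'))⟩

theorem cos_eq_of_related {i j : ι} (hij : i ≠ j) {s u : D.O i} {t : D.O j}
    (hs : s ∈ (hG.triple i).refls) (hu : u ∈ (hG.triple i).refls)
    (h : D.Related G i j s t) (h' : D.Related G i j u t) :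
    (hG.triple i).cos s = (hG.triple i).cos u := by
  refine hG.cos_eq_of_mul_mem hs hu ?_
  have h1 := mul_mem h.2 (inv_mem h'.2)
  rwa [← D.pair_inv hij, ← D.pair_mul hij, mul_inv_cancel, hu.2.inv_eq, D.pair_eq, D.single_one,
    mul_one] at h1

omit hG in
theorem related_trans {i j k : ι} {s : D.O i} {t : D.O j} {u : D.O k} (ht : IsReflection t)
    (h : D.Related G i j s t) (h' : D.Related G j k t u) : D.Related G i k s u := by
  refine ⟨h.1, ?_⟩
  have h1 := mul_mem h.2 h'.2
  have h2 : D.single j t * D.single j t = 1 := by rw [← D.single_mul, ht.mul_self, D.single_one]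
  rwa [D.pair_eq, D.pair_eq, mul_assoc, ← mul_assoc (D.single j t), h2, one_mul, ← D.pair_eq] at h1

/-- If `t'` were in the group or glued to a third factor, the commutator with the pair `s`, `t`
would be supported on the `j`-th block, and the cosets would commute. So `t'` is glued to some `v`
in the `i`-th factor; if `s` and `v` commuted modulo `H`, the commutator of the two pairs could
again be reduced to the `j`-th block. -/
theorem exists_related_of_not_commute {i j : ι} (hij : i ≠ j) {s : D.O i} {t t' : D.O j}
    (hs : s ∈ (hG.triple i).refls) (ht : t ∈ (hG.triple j).refls) (ht' : t' ∈ (hG.triple j).refls)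
    (h : D.Related G i j s t)
    (hn : ¬ Commute ((hG.triple j).cos t) ((hG.triple j).cos t')) :
    ∃ v ∈ (hG.triple i).refls, D.Related G i j v t' ∧
      ¬ Commute ((hG.triple i).cos s) ((hG.triple i).cos v) := by
  rcases hG.single_mem_or_related ht' with h1 | ⟨k, v, hjk, hv, h1⟩
  · refine (hn (hG.commute_of_commutator_mem ht ht' ?_)).elim
    rw [← commutator_pair_single hij s]
    exact mul_mem (mul_mem (mul_mem h.2 h1) (inv_mem h.2)) (inv_mem h1)
  · by_cases hik : i = k
    · subst hik
      refine ⟨v, hv, related_symm hjk h1, fun hc => hn (hG.commute_of_commutator_mem ht ht' ?_)⟩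
      have h2 := (related_symm hjk h1).2
      have h3 := mul_mem (mul_mem (mul_mem h.2 h2) (inv_mem h.2)) (inv_mem h2)
      rw [commutator_pair_pair_symm hij, D.pair_eq] at h3
      have hsG := (hG.triple i).F_le hs.1
      have hvG := (hG.triple i).F_le hv.1
      have h4 : s * v * s⁻¹ * v⁻¹ ∈ (hG.triple i).H := by
        rw [← cos_eq_cos_iff _ (mul_mem (mul_mem hsG hvG) (inv_mem hsG)) hvG,
          cos_mul _ (mul_mem hsG hvG) (inv_mem hsG), cos_mul _ hsG hvG, cos_inv _ hsG, hc.eq,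
          mul_inv_cancel_right]
      exact (Subgroup.mul_mem_cancel_left G (hG.single_mem_of_mem_H h4)).1 h3
    · exact (hn (hG.commute_of_pair_mem hij hik hjk ht ht' h.2 h1.2)).elim

/-- The relation between the reflections of different factors that is induced by the group. -/
def CosetRelated (i j : ι) (p : (hG.triple i).Q) (q : (hG.triple j).Q) : Prop :=
  ∃ s ∈ (hG.triple i).refls, ∃ t ∈ (hG.triple j).refls,
    (hG.triple i).cos s = p ∧ (hG.triple j).cos t = q ∧ D.Related G i j s t

theorem cosetRelated_cos_iff {i j : ι} (hij : i ≠ j) {s : D.O i} {t : D.O j}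
    (hs : s ∈ (hG.triple i).refls) (ht : t ∈ (hG.triple j).refls) :
    hG.CosetRelated i j ((hG.triple i).cos s) ((hG.triple j).cos t) ↔ D.Related G i j s t := by
  constructor
  · rintro ⟨s', hs', t', ht', hss', htt', h⟩
    rwa [hG.related_congr_left hs hs' hss'.symm, hG.related_congr_right hij ht ht' htt'.symm]
  · exact fun h => ⟨s, hs, t, ht, rfl, rfl, h⟩

variable {hG}

theorem CosetRelated.left_mem {i j : ι} {p : (hG.triple i).Q} {q : (hG.triple j).Q}
    (h : hG.CosetRelated i j p q) : p ∈ (hG.triple i).reflections := by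
  obtain ⟨s, hs, t, ht, rfl, rfl, h⟩ := h
  exact cos_mem_reflections _ hs

theorem CosetRelated.right_mem {i j : ι} {p : (hG.triple i).Q} {q : (hG.triple j).Q}
    (h : hG.CosetRelated i j p q) : q ∈ (hG.triple j).reflections := by
  obtain ⟨s, hs, t, ht, rfl, rfl, h⟩ := h
  exact cos_mem_reflections _ ht

theorem CosetRelated.symm {i j : ι} (hij : i ≠ j) {p : (hG.triple i).Q} {q : (hG.triple j).Q}
    (h : hG.CosetRelated i j p q) : hG.CosetRelated j i q p := by
  obtain ⟨s, hs, t, ht, rfl, rfl, h⟩ := h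
  exact ⟨t, ht, s, hs, rfl, rfl, related_symm hij h⟩

theorem CosetRelated.left_unique {i j : ι} (hij : i ≠ j) {p p' : (hG.triple i).Q}
    {q : (hG.triple j).Q} (h : hG.CosetRelated i j p q) (h' : hG.CosetRelated i j p' q) :
    p = p' := by
  obtain ⟨s, hs, t, ht, rfl, rfl, h⟩ := h
  obtain ⟨s', hs', t', ht', rfl, htt', h'⟩ := h'
  rw [hG.related_congr_right hij ht' ht htt'] at h'
  exact hG.cos_eq_of_related hij hs hs' h h'

theorem CosetRelated.right_unique {i j : ι} (hij : i ≠ j) {p : (hG.triple i).Q}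
    {q q' : (hG.triple j).Q} (h : hG.CosetRelated i j p q) (h' : hG.CosetRelated i j p q') :
    q = q' := (h.symm hij).left_unique hij.symm (h'.symm hij)

theorem CosetRelated.trans {i j k : ι} {p : (hG.triple i).Q}
    {q : (hG.triple j).Q} {r : (hG.triple k).Q} (h : hG.CosetRelated i j p q)
    (h' : hG.CosetRelated j k q r) : hG.CosetRelated i k p r := by
  obtain ⟨s, hs, t, ht, rfl, rfl, h⟩ := h
  obtain ⟨t', ht', u, hu, htt', rfl, h'⟩ := h'
  rw [hG.related_congr_left ht' ht htt'] at h'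
  exact ⟨s, hs, u, hu, rfl, rfl, related_trans ht.2 h h'⟩

theorem CosetRelated.exists_of_not_commute {i j : ι} (hij : i ≠ j) {p : (hG.triple i).Q}
    {q q' : (hG.triple j).Q} (h : hG.CosetRelated i j p q) (hq' : q' ∈ (hG.triple j).reflections)
    (hn : ¬ Commute q q') : ∃ p', hG.CosetRelated i j p' q' ∧ ¬ Commute p p' := by
  obtain ⟨s, hs, t, ht, rfl, rfl, h⟩ := h
  obtain ⟨t', ht', rfl⟩ := (hG.triple j).mem_reflections_iff.1 hq'
  obtain ⟨v, hv, h1, h2⟩ := hG.exists_related_of_not_commute hij hs ht ht' h hn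
  exact ⟨_, ⟨v, hv, t', ht', rfl, rfl, h1⟩, h2⟩

theorem CosetRelated.commute {i j k : ι} (hij : i ≠ j) (hik : i ≠ k) (hjk : j ≠ k)
    {p : (hG.triple i).Q} {q q' : (hG.triple j).Q} {r : (hG.triple k).Q}
    (h : hG.CosetRelated i j p q) (h' : hG.CosetRelated j k q' r) : Commute q q' := by
  obtain ⟨s, hs, t, ht, rfl, rfl, h⟩ := h
  obtain ⟨t', ht', u, hu, rfl, rfl, h'⟩ := h'
  exact hG.commute_of_pair_mem hij hik hjk ht ht' h.2 h'.2

theorem CosetRelated.conj {i j : ι} (hij : i ≠ j) {p p' : (hG.triple i).Q}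
    {q q' : (hG.triple j).Q} (h : hG.CosetRelated i j p q) (h' : hG.CosetRelated i j p' q') :
    hG.CosetRelated i j (p * p' * p) (q * q' * q) := by
  obtain ⟨s, hs, t, ht, rfl, rfl, h⟩ := h
  obtain ⟨s', hs', t', ht', rfl, rfl, h'⟩ := h'
  have hsG := (hG.triple i).F_le hs.1
  have htG := (hG.triple j).F_le ht.1
  have hsG' := (hG.triple i).F_le hs'.1
  have htG' := (hG.triple j).F_le ht'.1
  have key : ∀ {k : ι} {b : ∀ i, D.O i}, D.blockDiag b ∈ G → ∀ a : D.O k,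
      D.single k (b k * a * (b k)⁻¹) ∈ G → D.single k a ∈ G := by
    intro k b hb a ha
    rw [← D.blockDiag_conj_mulSingle] at ha
    have := mul_mem (mul_mem (inv_mem hb) ha) hb
    simpa only [mul_assoc, inv_mul_cancel_left, inv_mul_cancel, mul_one] using this
  refine ⟨s * s' * s⁻¹, (hG.triple i).conj_mem_refls hsG hs', t * t' * t⁻¹,
    (hG.triple j).conj_mem_refls htG ht', ?_, ?_, ?_, ?_⟩
  · rw [cos_mul _ (mul_mem hsG hsG') (inv_mem hsG), cos_mul _ hsG hsG', hs.2.inv_eq]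
  · rw [cos_mul _ (mul_mem htG htG') (inv_mem htG), cos_mul _ htG htG', ht.2.inv_eq]
  · intro h1
    refine h'.1 (key h.2 s' ?_)
    rwa [Pi.mul_apply, Pi.mulSingle_eq_same, Pi.mulSingle_eq_of_ne hij, mul_one]
  · rw [D.pair_mul hij, D.pair_mul hij, D.pair_inv hij]
    exact mul_mem (mul_mem h.2 h'.2) (inv_mem h.2)

/-- Relatedness of two reflections spreads over their components. -/
theorem CosetRelated.exists_left {i j : ι} (hij : i ≠ j) {p : (hG.triple i).Q}
    {q q' : (hG.triple j).Q} (h : hG.CosetRelated i j p q) {K : (hG.triple i).Component}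
    {L : (hG.triple j).Component} (hp : p ∈ K.1) (hq : q ∈ L.1)
    (hq' : q' ∈ (hG.triple j).reflections) (hqL' : q' ∈ L.1) :
    ∃ p' ∈ K.1, hG.CosetRelated i j p' q' := by
  refine Component.induction (P := fun q => ∃ p ∈ K.1, hG.CosetRelated i j p q) h.right_mem hq
    ⟨p, hp, h⟩ ?_ hq' hqL'
  rintro a _ _ b hb _ hab ⟨p, hpK, hpa⟩
  obtain ⟨p', h1, h2⟩ := hpa.exists_of_not_commute hij hb hab
  exact ⟨p', Component.mem_of_not_commute hpa.left_mem h1.left_mem h2 hpK, h1⟩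

theorem CosetRelated.exists_right {i j : ι} (hij : i ≠ j) {p p' : (hG.triple i).Q}
    {q : (hG.triple j).Q} (h : hG.CosetRelated i j p q) {K : (hG.triple i).Component}
    {L : (hG.triple j).Component} (hp : p ∈ K.1) (hq : q ∈ L.1)
    (hp' : p' ∈ (hG.triple i).reflections) (hpK' : p' ∈ K.1) :
    ∃ q' ∈ L.1, hG.CosetRelated i j p' q' := by
  obtain ⟨q', hq', h'⟩ := (h.symm hij).exists_left hij.symm hq hp hp' hpK'
  exact ⟨q', hq', h'.symm hij.symm⟩

end IsGroupWithComponents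
end OrthogonalDecomposition
end ReflRot

namespace ReflRot

open Module

/-! ### The datum induced by a group, and the recovery of the group -/

namespace OrthogonalDecomposition

namespace IsGroupWithComponents

open AdmissibleTriple

set_option linter.unusedSectionVars false

variable {ι : Type*} [Fintype ι] [DecidableEq ι]
  {E : Type*} [NormedAddCommGroup E] [InnerProductSpace ℝ E] [FiniteDimensional ℝ E]
  {D : OrthogonalDecomposition ι E} {G : Subgroup (E ≃ₗᵢ[ℝ] E)} (hG : D.IsGroupWithComponents G)

/-- The relation between the components that is induced by the group. -/
def Rel (x y : Σ i, (hG.triple i).Component) : Prop :=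
  x = y ∨ (x.1 ≠ y.1 ∧ ∃ p ∈ x.2.1, ∃ q ∈ y.2.1, hG.CosetRelated x.1 y.1 p q)

variable {hG}

theorem Rel.symm {x y : Σ i, (hG.triple i).Component} (h : hG.Rel x y) : hG.Rel y x := by
  rcases h with rfl | ⟨hne, p, hp, q, hq, h⟩
  · exact Or.inl rfl
  · exact Or.inr ⟨hne.symm, q, hq, p, hp, h.symm hne⟩

theorem Rel.trans {x y z : Σ i, (hG.triple i).Component} (h : hG.Rel x y) (h' : hG.Rel y z) :
    hG.Rel x z := by
  rcases h with rfl | ⟨hne, p, hp, q, hq, h⟩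
  · exact h'
  rcases h' with rfl | ⟨hne', q', hq', r, hr, h'⟩
  · exact Or.inr ⟨hne, p, hp, q, hq, h⟩
  -- The two relations meet `y` in possibly different reflections; spreading the first over `y`
  -- makes them meet in `q'`. If `x` and `z` are in the same factor, uniqueness then identifies the
  -- outer reflections.
  obtain ⟨p', hp', h1⟩ := h.exists_left hne hp hq h'.left_mem hq'
  by_cases hxz : x.1 = z.1
  · left
    obtain ⟨i, K⟩ := x
    obtain ⟨k, M⟩ := z
    dsimp only at hxz
    subst hxz
    have := h1.left_unique hne (h'.symm hne')
    subst this
    exact congrArg (Sigma.mk i) (Component.eq_of_mem h1.left_mem hp' hr)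
  · exact Or.inr ⟨hxz, p', hp', r, hr, h1.trans h'⟩

theorem CosetRelated.rel {i j : ι} (hij : i ≠ j) {p : (hG.triple i).Q} {q : (hG.triple j).Q}
    (h : hG.CosetRelated i j p q) {K : (hG.triple i).Component} (hp : p ∈ K.1) :
    ∃ L : (hG.triple j).Component, q ∈ L.1 ∧ hG.Rel ⟨i, K⟩ ⟨j, L⟩ :=
  ⟨(hG.triple j).compOf ⟨q, h.right_mem⟩, (hG.triple j).mem_compOf ⟨q, h.right_mem⟩,
    Or.inr ⟨hij, p, hp, q, (hG.triple j).mem_compOf ⟨q, h.right_mem⟩, h⟩⟩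

theorem Rel.exists_right {x y : Σ i, (hG.triple i).Component} (h : hG.Rel x y) (hne : x ≠ y)
    {p : (hG.triple x.1).Q} (hp : p ∈ (hG.triple x.1).reflections) (hpx : p ∈ x.2.1) :
    ∃ q ∈ y.2.1, hG.CosetRelated x.1 y.1 p q := by
  rcases h with rfl | ⟨hxy, p', hp', q', hq', h⟩
  · exact (hne rfl).elim
  · exact h.exists_right hxy hp' hq' hp hpx

theorem single_mem_of_unpaired {x : Σ i, (hG.triple i).Component} (h : ∀ y, hG.Rel x y → y = x)
    {s : D.O x.1} (hs : s ∈ (hG.triple x.1).refls) (hsx : (hG.triple x.1).cos s ∈ x.2.1) :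
    D.single x.1 s ∈ G := by
  rcases hG.single_mem_or_related hs with h1 | ⟨j, t, hij, ht, h1⟩
  · exact h1
  · obtain ⟨L, -, hL⟩ := CosetRelated.rel hij ((hG.cosetRelated_cos_iff hij hs ht).2 h1) hsx
    exact (hij (congrArg Sigma.fst (h _ hL)).symm).elim

/-- A noncommuting reflection in `K` lies in the group or is a block of a pair in it; either way the
commutator with `s` is supported on one block and the cosets would commute. -/
theorem single_notMem_of_nontrivial {i : ι} {K : (hG.triple i).Component}
    (hK : ¬ (hG.triple i).IsTrivial K) {s : D.O i} (hs : s ∈ (hG.triple i).refls)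
    (hsK : (hG.triple i).cos s ∈ K.1) : D.single i s ∉ G := by
  intro h
  obtain ⟨q, hq, hqK, hn⟩ := exists_not_commute hK (cos_mem_reflections _ hs) hsK
  obtain ⟨t, ht, rfl⟩ := (hG.triple i).mem_reflections_iff.1 hq
  rcases hG.single_mem_or_related ht with h1 | ⟨j, v, hij, hv, h1⟩
  · refine hn (hG.commute_of_commutator_mem hs ht ?_)
    rw [D.single_mul, D.single_mul, D.single_mul, D.single_inv, D.single_inv]
    exact mul_mem (mul_mem (mul_mem h h1) (inv_mem h)) (inv_mem h1)
  · refine hn (hG.commute_of_commutator_mem ht hs ?_).symm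
    rw [← commutator_pair_single hij.symm v t s, ← D.pair_symm hij]
    exact mul_mem (mul_mem (mul_mem h1.2 h) (inv_mem h1.2)) (inv_mem h)

theorem exists_partner {x : Σ i, (hG.triple i).Component} (hx : ¬ (hG.triple x.1).IsTrivial x.2) :
    ∃ y, hG.Rel x y ∧ x ≠ y := by
  by_contra! h
  obtain ⟨p, hp, hpx⟩ := x.2.exists_mem
  obtain ⟨s, hs, rfl⟩ := (hG.triple x.1).mem_reflections_iff.1 hp
  exact single_notMem_of_nontrivial hx hs hpx
    (single_mem_of_unpaired (fun y hy => (h y hy).symm) hs hpx)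

theorem Rel.fst_ne {x y : Σ i, (hG.triple i).Component} (h : hG.Rel x y) (hne : x ≠ y) :
    x.1 ≠ y.1 := by
  rcases h with h | h
  · exact (hne h).elim
  · exact h.1

/-- In the same factor, the related reflection is unique. In different factors, reflections of `x`
related to the two partners would always commute, contrary to `x` being nontrivial. -/
theorem partner_unique {x y z : Σ i, (hG.triple i).Component}
    (hx : ¬ (hG.triple x.1).IsTrivial x.2) (hy : hG.Rel x y) (hxy : x ≠ y) (hz : hG.Rel x z)
    (hxz : x ≠ z) : y = z := by
  obtain ⟨p, hp, hpx⟩ := x.2.exists_mem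
  obtain ⟨q, hq, h1⟩ := hy.exists_right hxy hp hpx
  by_cases hyz : y.1 = z.1
  · obtain ⟨r, hr, h2⟩ := hz.exists_right hxz hp hpx
    have hne := hy.fst_ne hxy
    clear hy hxy hz hxz
    obtain ⟨j, L⟩ := y
    obtain ⟨k, M⟩ := z
    dsimp only at hyz
    subst hyz
    have := h1.right_unique hne h2
    subst this
    exact congrArg (Sigma.mk j) (Component.eq_of_mem h1.right_mem hq hr)
  · obtain ⟨p', hp', hpx', hn⟩ := exists_not_commute hx hp hpx
    obtain ⟨r, hr, h2⟩ := hz.exists_right hxz hp' hpx'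
    exact (hn ((h1.symm (hy.fst_ne hxy)).commute (hy.fst_ne hxy).symm hyz (hz.fst_ne hxz) h2)).elim

/-- Related reflections are unique and relatedness is preserved by conjugation, so choosing the
related reflection respects the defining relations of the component. -/
theorem Rel.exists_hom {x y : Σ i, (hG.triple i).Component} (h : hG.Rel x y) (hne : x ≠ y) :
    ∃ f : x.2.1 →* y.2.1, ∀ p : x.2.1, (p : (hG.triple x.1).Q) ∈ (hG.triple x.1).reflections →
      hG.CosetRelated x.1 y.1 p (f p) := by
  have hex : ∀ p, ∃ q, p ∈ (hG.triple x.1).reflections → p ∈ x.2.1 →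
      q ∈ y.2.1 ∧ hG.CosetRelated x.1 y.1 p q := by
    intro p
    by_cases hp : p ∈ (hG.triple x.1).reflections ∧ p ∈ x.2.1
    · obtain ⟨q, hq⟩ := h.exists_right hne hp.1 hp.2
      exact ⟨q, fun _ _ => hq⟩
    · exact ⟨1, fun h1 h2 => (hp ⟨h1, h2⟩).elim⟩
  choose ψ hψ using hex
  have hxy := h.fst_ne hne
  obtain ⟨f, hf, -⟩ := (hG.triple x.1).exists_lift_on (x.2.1 : Set (hG.triple x.1).Q)
    (fun _ hp _ hq h hK => Component.mem_of_not_commute hp hq h hK) ψ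
    (fun p hp hpx => (hG.triple y.1).reflections_mul_self (hψ p hp hpx).2.right_mem)
    (fun p hp hpx q hq hqx => ((hψ (p * q * p) ((hG.triple x.1).mul_mul_mem_reflections hp hq)
      (mul_mem (mul_mem hpx hqx) hpx)).2.right_unique hxy
        ((hψ p hp hpx).2.conj hxy (hψ q hq hqx).2)))
  have hle : x.2.1 ≤ y.2.1.comap f := by
    rw [← x.2.closure_eq, Subgroup.closure_le]
    rintro p ⟨hp, hpx⟩
    change f p ∈ y.2.1
    rw [hf p hp hpx]
    exact (hψ p hp hpx).1
  refine ⟨(f.comp x.2.1.subtype).codRestrict y.2.1 fun p => hle p.2, fun p hp => ?_⟩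
  change hG.CosetRelated x.1 y.1 p (f p)
  rw [hf p hp p.2]
  exact (hψ p hp p.2).2

theorem comp_eq_id {x y : Σ i, (hG.triple i).Component} (hxy : x.1 ≠ y.1) {f : x.2.1 →* y.2.1}
    {g : y.2.1 →* x.2.1}
    (hf : ∀ p : x.2.1, (p : (hG.triple x.1).Q) ∈ (hG.triple x.1).reflections →
      hG.CosetRelated x.1 y.1 p (f p))
    (hg : ∀ p : y.2.1, (p : (hG.triple y.1).Q) ∈ (hG.triple y.1).reflections →
      hG.CosetRelated y.1 x.1 p (g p)) : g.comp f = MonoidHom.id _ :=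
  Component.hom_ext fun p hp => Subtype.ext
    ((hg (f p) (hf p hp).right_mem).right_unique hxy.symm ((hf p hp).symm hxy))

theorem Rel.exists_mulEquiv {x y : Σ i, (hG.triple i).Component} (h : hG.Rel x y) (hne : x ≠ y) :
    ∃ f : x.2.1 ≃* y.2.1, ∀ p : x.2.1, (p : (hG.triple x.1).Q) ∈ (hG.triple x.1).reflections →
      hG.CosetRelated x.1 y.1 p (f p) := by
  obtain ⟨f, hf⟩ := h.exists_hom hne
  obtain ⟨g, hg⟩ := h.symm.exists_hom hne.symm
  exact ⟨f.toMulEquiv g (comp_eq_id (h.fst_ne hne) hf hg)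
    (comp_eq_id (h.fst_ne hne).symm hg hf), hf⟩

/-- The isomorphism between related components that maps reflections to related ones. -/
noncomputable def iso {x y : Σ i, (hG.triple i).Component} (h : hG.Rel x y) (hne : x ≠ y) :
    x.2.1 ≃* y.2.1 := (h.exists_mulEquiv hne).choose

theorem cosetRelated_iso {x y : Σ i, (hG.triple i).Component} (h : hG.Rel x y) (hne : x ≠ y)
    {p : x.2.1} (hp : (p : (hG.triple x.1).Q) ∈ (hG.triple x.1).reflections) :
    hG.CosetRelated x.1 y.1 p (iso h hne p) := (h.exists_mulEquiv hne).choose_spec p hp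

theorem iso_symm {x y : Σ i, (hG.triple i).Component} (h : hG.Rel x y) (hne : x ≠ y) :
    iso h.symm hne.symm = (iso h hne).symm := by
  refine MulEquiv.ext fun q => ((iso h hne).eq_symm_apply).2 ?_
  exact DFunLike.congr_fun (comp_eq_id (f := (iso h.symm hne.symm).toMonoidHom)
    (g := (iso h hne).toMonoidHom) (h.fst_ne hne).symm
    (fun p hp => cosetRelated_iso h.symm hne.symm hp) fun p hp => cosetRelated_iso h hne hp) q

theorem iso_mem_reflections_iff {x y : Σ i, (hG.triple i).Component} (h : hG.Rel x y) (hne : x ≠ y)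
    (p : x.2.1) : (p : (hG.triple x.1).Q) ∈ (hG.triple x.1).reflections ↔
      (iso h hne p : (hG.triple y.1).Q) ∈ (hG.triple y.1).reflections := by
  refine ⟨fun hp => (cosetRelated_iso h hne hp).right_mem, fun hp => ?_⟩
  have := (cosetRelated_iso h.symm hne.symm hp).right_mem
  rwa [iso_symm h hne, MulEquiv.symm_apply_apply] at this

variable (hG)

/-- The datum that is induced by a group. -/
noncomputable def datum : Datum D where
  triple := hG.triple
  rel := ⟨hG.Rel, fun _ => Or.inl rfl, Rel.symm, Rel.trans⟩
  rel_factor x y h hxy := by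
    by_contra hne
    exact h.fst_ne hne hxy
  unpaired i K L hK hK' hL hL' := by
    obtain ⟨p, hp, hpK⟩ := K.exists_mem
    obtain ⟨s, hs, rfl⟩ := (hG.triple i).mem_reflections_iff.1 hp
    obtain ⟨q, hq, hqL⟩ := L.exists_mem
    obtain ⟨t, ht, rfl⟩ := (hG.triple i).mem_reflections_iff.1 hq
    have h1 := single_mem_of_unpaired (x := ⟨i, K⟩) hK' hs hpK
    have h2 := single_mem_of_unpaired (x := ⟨i, L⟩) hL' ht hqL
    -- Two reflections of one block that both lie in the group differ by a rotation of the first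
    -- kind, so they have the same coset.
    have h3 := hG.cos_eq_of_mul_mem hs ht (by rw [D.single_mul]; exact mul_mem h1 h2)
    rw [← h3] at hqL
    exact Component.eq_of_mem hp hpK hqL
  paired x hx := by
    obtain ⟨y, hy, hne⟩ := exists_partner hx
    have : {z | hG.Rel x z} = {x, y} := by
      ext z
      constructor
      · intro hz
        by_cases hxz : x = z
        · exact Or.inl hxz.symm
        · exact Or.inr (partner_unique hx hz hxz hy hne)
      · rintro (rfl | rfl)
        · exact Or.inl rfl
        · exact hy
    exact (congrArg Set.ncard this).trans (Set.ncard_pair hne)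
  iso x y h hne _ := iso h hne
  iso_symm x y h hne _ _ := iso_symm h hne
  iso_reflections x y h hne _ p := iso_mem_reflections_iff h hne p

theorem datum_equivalent_iff {i j : ι} (hij : i ≠ j) {p : (hG.triple i).Q} {q : (hG.triple j).Q}
    (hp : p ∈ (hG.triple i).reflections) (hq : q ∈ (hG.triple j).reflections) :
    hG.datum.Equivalent i j p q ↔ hG.CosetRelated i j p q := by
  constructor
  · rintro ⟨K, L, hpK, hqL, hKL, hne, hiso⟩
    by_cases hK : (hG.triple i).IsTrivial K
    · have hL : (hG.triple j).IsTrivial L := Datum.isTrivial_of_rel hKL hK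
      obtain ⟨q', hq', h⟩ := Rel.exists_right hKL hne hp hpK
      rwa [hL.eq hq hqL h.right_mem hq']
    · have h := cosetRelated_iso hKL hne (p := ⟨p, hpK⟩) hp
      have h' := hiso hK
      rwa [← h']
  · intro h
    have hpK := (hG.triple i).mem_compOf ⟨p, hp⟩
    obtain ⟨L, hL, hrel⟩ := h.rel hij hpK
    have hne : (⟨i, (hG.triple i).compOf ⟨p, hp⟩⟩ : Σ i, (hG.triple i).Component) ≠ ⟨j, L⟩ :=
      fun h => hij (congrArg Sigma.fst h)
    exact ⟨_, L, hpK, hL, hrel, hne, fun _ =>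
      (cosetRelated_iso hrel hne (p := ⟨p, hpK⟩) hp).right_unique hij h⟩

theorem datum_equivalent_cos_iff {i j : ι} (hij : i ≠ j) {s : D.O i} {t : D.O j}
    (hs : s ∈ (hG.triple i).refls) (ht : t ∈ (hG.triple j).refls) :
    hG.datum.Equivalent i j ((hG.triple i).cos s) ((hG.triple j).cos t) ↔ D.Related G i j s t :=
  (hG.datum_equivalent_iff hij (cos_mem_reflections _ hs) (cos_mem_reflections _ ht)).trans
    (hG.cosetRelated_cos_iff hij hs ht)

theorem datum_group_le : hG.datum.group ≤ G := by
  refine (Subgroup.closure_le _).2 ?_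
  rintro _ ((⟨i, h, hh, rfl⟩ | ⟨i, j, s, t, hij, hs, ht, h, rfl⟩) | ⟨i, s, hs, h, rfl⟩)
  · exact hG.single_mem_of_mem_H hh
  · rw [coset_eq_cos, coset_eq_cos] at h
    exact ((hG.datum_equivalent_cos_iff hij ⟨s.2, hs⟩ ⟨t.2, ht⟩).1 h).2
  · rcases hG.single_mem_or_related (s := (s : D.O i)) ⟨s.2, hs⟩ with h1 | ⟨j, t, hij, ht, h1⟩
    · exact h1
    · refine (h j ⟨t, ht.1⟩ hij ht.2 ?_).elim
      rw [coset_eq_cos, coset_eq_cos]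
      exact (hG.datum_equivalent_cos_iff hij ⟨s.2, hs⟩ ht).2 h1

theorem single_mem_datum_group {i : ι} {s : D.O i} (hs : IsReflection s) (h : D.single i s ∈ G) :
    D.single i s ∈ hG.datum.group := by
  have hs' : s ∈ (hG.triple i).refls := by
    rw [hG.refls_triple]
    exact ⟨hs, Or.inl h⟩
  refine Subgroup.subset_closure (Or.inr ⟨i, ⟨s, hs'.1⟩, hs, fun j t hij ht h' => ?_, rfl⟩)
  rw [coset_eq_cos, coset_eq_cos] at h'
  exact ((hG.datum_equivalent_cos_iff hij hs' ⟨t.2, ht⟩).1 h').1 h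

theorem pair_mem_datum_group {i j : ι} (hij : i ≠ j) {s : D.O i} {t : D.O j} (hs : IsReflection s)
    (ht : IsReflection t) (h : D.pair i j s t ∈ G) : D.pair i j s t ∈ hG.datum.group := by
  by_cases h1 : D.single i s ∈ G
  · have h2 := h
    rw [D.pair_eq, Subgroup.mul_mem_cancel_left G h1] at h2
    rw [D.pair_eq]
    exact mul_mem (hG.single_mem_datum_group hs h1) (hG.single_mem_datum_group ht h2)
  · have hs' : s ∈ (hG.triple i).refls := by
      rw [hG.refls_triple]
      exact ⟨hs, Or.inr ⟨j, t, hij, ht, h⟩⟩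
    have ht' : t ∈ (hG.triple j).refls := by
      rw [hG.refls_triple]
      exact ⟨ht, Or.inr ⟨i, s, hij.symm, hs, by rwa [D.pair_symm hij.symm]⟩⟩
    exact Datum.pair_mem_group_of_equivalent (A := hG.datum) hij hs' ht'
      ((hG.datum_equivalent_cos_iff hij hs' ht').2 ⟨h1, h⟩)

/-- By additivity of the codimension, the generating reflections and rotations of `G` are singles
and pairs, and each of these is accounted for by a generator of the group of the datum, or by a
product of two. -/
theorem datum_group : hG.datum.group = G := by
  refine le_antisymm hG.datum_group_le ?_
  obtain ⟨X, hX, hGX⟩ := hG.exists_blockDiag_set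
  nth_rewrite 1 [hGX]
  rw [Subgroup.closure_le]
  rintro _ ⟨b, hb, rfl⟩
  obtain ⟨hbG, h | h⟩ := hX b hb
  · obtain ⟨i, hi, hbi⟩ := D.exists_of_isReflection h
    rw [hbi] at hbG ⊢
    exact hG.single_mem_datum_group hi hbG
  · rcases D.exists_of_isRotation h with ⟨i, hi, hbi⟩ | ⟨i, j, hij, hi, hj, hbij⟩
    · rw [hbi] at hbG ⊢
      exact Datum.single_mem_group_of_mem_H (A := hG.datum)
        (hG.mem_H_of_single_mem hbG (Or.inr hi))
    · rw [hbij] at hbG ⊢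
      exact hG.pair_mem_datum_group hij hi hj hbG

end IsGroupWithComponents
end OrthogonalDecomposition
end ReflRot

namespace ReflRot

open Module

/-! ### A datum is determined by the group that induces it -/

namespace Datum

open AdmissibleTriple

variable {ι : Type*} [Fintype ι] [DecidableEq ι]
  {E : Type*} [NormedAddCommGroup E] [InnerProductSpace ℝ E] [FiniteDimensional ℝ E]
  {D : OrthogonalDecomposition ι E}

/-- A group induces at most one datum. -/
theorem IsInducedBy.unique {A B : Datum D} {G : Subgroup (E ≃ₗᵢ[ℝ] E)} (hA : A.IsInducedBy G)
    (hB : B.IsInducedBy G) : A = B := by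
  have htriple : A.triple = B.triple := funext fun i => AdmissibleTriple.ext
    ((hA.G_eq i).trans (hB.G_eq i).symm) ((hA.H_eq i).trans (hB.H_eq i).symm)
    ((hA.F_eq i).trans (hB.F_eq i).symm)
  obtain ⟨T, R, hR1, hR2, hR3, f, hf1, hf2⟩ := A
  obtain ⟨T', R', hR1', hR2', hR3', f', hf1', hf2'⟩ := B
  dsimp only at htriple
  subst htriple
  have hrel : R = R' := Setoid.ext fun x y => (hA.rel_iff x y).trans (hB.rel_iff x y).symm
  subst hrel
  have hiso : f = f' := by
    funext x y hxy hne hx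
    -- It suffices to compare the isomorphisms on reflections. There the image is again the coset of
    -- a reflection `t`, and relatedness in `G` decides which one.
    refine MulEquiv.toMonoidHom_injective (Component.hom_ext fun p hp => Subtype.ext ?_)
    obtain ⟨p, hpx⟩ := p
    obtain ⟨s, hs, rfl⟩ := hp
    obtain ⟨t, ht, hst⟩ := (hf2 x y hxy hne hx ⟨_, hpx⟩).1 ⟨s, hs, rfl⟩
    have h := (hA.iso_iff x y hxy hne hx s t hs ht hpx).1 hst.symm
    exact hst.symm.trans ((hB.iso_iff x y hxy hne hx s t hs ht hpx).2 h).symm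
  subst hiso
  rfl

theorem isInducedBy_iff {A : Datum D} {G : Subgroup (E ≃ₗᵢ[ℝ] E)} (hG : D.IsGroupWithComponents G) :
    A.IsInducedBy G ↔ A.group = G := by
  constructor
  · intro h
    have h' : hG.datum.IsInducedBy G := by
      have := hG.datum.isInducedBy_group
      rwa [hG.datum_group] at this
    rw [h.unique h', hG.datum_group]
  · rintro rfl
    exact A.isInducedBy_group

end Datum
end ReflRot

theorem theorem3p5 {ι : Type*} [Fintype ι] [DecidableEq ι]
    {E : Type*} [NormedAddCommGroup E] [InnerProductSpace ℝ E] [FiniteDimensional ℝ E]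
    (D : ReflRot.OrthogonalDecomposition ι E) :
    Set.BijOn (fun A : ReflRot.Datum D => A.group) Set.univ {G | D.IsGroupWithComponents G} ∧
    (∀ G : Subgroup (E ≃ₗᵢ[ℝ] E), D.IsGroupWithComponents G →
      ∀ A : ReflRot.Datum D, A.IsInducedBy G ↔ A.group = G) ∧
    (∀ A : ReflRot.Datum D,
      (∃ g ∈ A.group, ReflRot.IsReflection g) ↔ A.HasUnpairedTrivialComponent) := by
  refine ⟨⟨fun A _ => A.group_isGroupWithComponents, fun A _ B _ h => ?_,
    fun G hG => ⟨ReflRot.OrthogonalDecomposition.IsGroupWithComponents.datum hG, trivial,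
      ReflRot.OrthogonalDecomposition.IsGroupWithComponents.datum_group hG⟩⟩,
    fun G hG A => ReflRot.Datum.isInducedBy_iff hG, fun A => A.exists_isReflection_iff⟩
  refine A.isInducedBy_group.unique ?_
  have h' : A.group = B.group := h
  rw [h']
  exact B.isInducedBy_group
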